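/- **Theorem 5.** Let $p\ge 1$. For parameters $\Psi$ consisting of weights $\pi_1,\dots,\pi_p\ge 0$ with $\sum_k\pi_k=1$, locations $\mu_k\in\mathbb R$, scales $\sigma_k>0$ and shapes $\lambda_k\in\mathbb R$ ($k=1,\dots,p$), let $$f(x;\Psi)=\sum_{k=1}^p \frac{2\pi_k}{\sigma_k}\,\phi\Big(\frac{x-\mu_k}{\sigma_k}\Big)\Phi\Big(\lambda_k\frac{x-\mu_k}{\sigma_k}\Big),$$ where $\phi$ and $\Phi$ are the standard normal density and distribution function. Let $\Gamma$ be the set of all these parameters, regarded as a subset of $\mathbb R^{4p-1}$ through the coordinates $(\pi_1,\dots,\pi_{p-1},\mu_1,\dots,\mu_p,\sigma_1,\dots,\sigma_p,\lambda_1,\dots,\lambda_p)$, with $\pi_p=1-\sum_{k<p}\pi_k$. Let $\Psi_0\in\Gamma$ have positive weights and pairwise distinct component parameters $(\mu_k,\sigma_k,\lambda_k)$ (so the order of the fitted mixture is the true one), and suppose that the model is regular at $\Psi_0$, i.e. the Fisher information matrix of one observation, $$I(\Psi_0)=E_{\Psi_0}\big[\nabla_\Psi\log f(X;\Psi_0)\,\nabla_\Psi\log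 f(X;\Psi_0)^{T}\big]\in\mathbb R^{(4p-1)\times(4p-1)},$$ is positive definite. Let $X_1,X_2,\dots$ be i.i.d. with density $f(\cdot;\Psi_0)$. Let $p_n(\sigma)$ ($\sigma>0$) and $p_n(\lambda)$ ($\lambda\in\mathbb R$) be penalty functions, which may depend on the data, such that almost surely: * C1. $p_n(\sigma)=o(n)$ for every $\sigma>0$, and $\sup_{\sigma>0}\max\{0,p_n(\sigma)\}=o(n)$. * C2. For all large $n$, $p_n(\sigma)\le(\log n)^2\log\sigma$ whenever $0<\sigma<n^{-1}\log n$. * C3. For all large $n$, $\lambda\mapsto p_n(\lambda)$ is continuous, is maximal at $\lambda=0$, tends to $-\infty$ as $|\lambda|\to\infty$, and $p_n(0)=0$. * C4. For all large $n$, $p_n(\sigma)$ and $p_n(\lambda)$ are differentiable in $\sigma>0$ and $\lambda\in\mathbb R$ respectively, and $p_n'(\sigma)=o(n^{1/2})$ and $p_n'(\lambda)=o(n^{1/2})$ as $n\to\infty$, uniformly for $\sigma$ in compact subsets of $(0,\infty)$ and for $\lambda$ in compact subsets of $\mathbb R$. Let $\tilde\Psi_n$ be random elements of $\mathbb R^{4p-1}$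 which, almost surely for all large $n$, are penalized maximum likelihood estimators, i.e. lie in $\Gamma$ and maximize over $\Gamma$ the penalized log-likelihood $$p\ell_n(\Psi)=\sum_{i=1}^n\log f(X_i;\Psi)+\sum_{k=1}^p p_n(\sigma_k)+\sum_{k=1}^p p_n(\lambda_k),$$ the components being numbered so that no renumbering of the components of $\tilde\Psi_n$ is closer to $\Psi_0$ in Euclidean distance on $\mathbb R^{4p-1}$ ($p\ell_n$ does not depend on the numbering). Then, as $n\to\infty$, $$\sqrt n\,(\tilde\Psi_n-\Psi_0)\longrightarrow N\big(\mathbf 0,\,I^{-1}(\Psi_0)\big)\quad\text{in distribution.}$$ That is, the penalized maximum likelihood estimator is asymptotically normal and efficient, in the sense that its asymptotic covariance matrix is the inverse Fisher information. -/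

import Mathlib

open MeasureTheory ProbabilityTheory Filter Topology Asymptotics

noncomputable section

namespace SkewNormalMixture

/-- The density of the skew normal distribution with location `μ`, scale `σ` and shape `lam`:
`(2 / σ) φ((x - μ) / σ) Φ(lam (x - μ) / σ)`, with `φ` and `Φ` the standard normal density and
distribution function. -/
def snDensity (μ σ lam x : ℝ) : ℝ :=
  2 / σ * gaussianPDFReal 0 1 ((x - μ) / σ) * cdf (gaussianReal 0 1) (lam * ((x - μ) / σ))

/-- Coordinates of a mixture with `p = m + 1` components: the weights of all components but the
last one, then the locations, the scales and the shapes of all components. -/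
abbrev Idx (m : ℕ) : Type := Fin m ⊕ Fin (m + 1) ⊕ Fin (m + 1) ⊕ Fin (m + 1)

/-- Parameter vectors of mixtures with `p = m + 1` components, as points of `ℝ^(4 p - 1)`.
The weight of the last component is one minus the sum of the others. -/
abbrev Param (m : ℕ) : Type := EuclideanSpace ℝ (Idx m)

variable {m : ℕ}

/-- The mixing proportions. -/
def weight (Ψ : Param m) (k : Fin (m + 1)) : ℝ :=
  Fin.lastCases (motive := fun _ => ℝ) (1 - ∑ j : Fin m, Ψ (Sum.inl j))
    (fun j => Ψ (Sum.inl j)) k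

/-- The location parameters. -/
def loc (Ψ : Param m) (k : Fin (m + 1)) : ℝ := Ψ (Sum.inr (Sum.inl k))

/-- The scale parameters. -/
def scale (Ψ : Param m) (k : Fin (m + 1)) : ℝ := Ψ (Sum.inr (Sum.inr (Sum.inl k)))

/-- The shape (skewness) parameters. -/
def shape (Ψ : Param m) (k : Fin (m + 1)) : ℝ := Ψ (Sum.inr (Sum.inr (Sum.inr k)))

/-- The parameter space: the weights are nonnegative (their sum is one by construction) and the
scales are positive, locations and shapes are arbitrary. -/
def paramSpace (m : ℕ) : Set (Param m) :=
  {Ψ | ∀ k, 0 ≤ weight Ψ k ∧ 0 < scale Ψ k}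

/-- The same mixture with its components renumbered by `τ`. -/
def relabel (τ : Equiv.Perm (Fin (m + 1))) (Ψ : Param m) : Param m :=
  WithLp.toLp 2 (Sum.elim (fun j : Fin m => weight Ψ (τ j.castSucc))
    (Sum.elim (fun k => loc Ψ (τ k))
      (Sum.elim (fun k => scale Ψ (τ k)) (fun k => shape Ψ (τ k)))))

/-- The density of the skew normal mixture. -/
def mixDensity (Ψ : Param m) (x : ℝ) : ℝ :=
  ∑ k, weight Ψ k * snDensity (loc Ψ k) (scale Ψ k) (shape Ψ k) x

/-- The distribution on `ℝ` whose density is the mixture density. -/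
def mixLaw (Ψ : Param m) : Measure ℝ :=
  volume.withDensity (fun x => ENNReal.ofReal (mixDensity Ψ x))

/-- The score of one observation `x`: the gradient of the log density in the parameter. -/
def score (Ψ : Param m) (x : ℝ) (i : Idx m) : ℝ :=
  fderiv ℝ (fun Ψ' : Param m => Real.log (mixDensity Ψ' x)) Ψ (EuclideanSpace.single i 1)

/-- The Fisher information matrix of one observation. -/
def fisherInfo (Ψ : Param m) : Matrix (Idx m) (Idx m) ℝ :=
  Matrix.of fun i j => ∫ x, score Ψ x i * score Ψ x j ∂(mixLaw Ψ)

/-- The log-likelihood of the first `n` terms of the sequence `x`. -/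
def logLik (n : ℕ) (x : ℕ → ℝ) (Ψ : Param m) : ℝ :=
  ∑ i ∈ Finset.range n, Real.log (mixDensity Ψ (x i))

/-- The penalized log-likelihood, with the penalty `q` on each scale and `r` on each shape. -/
def penLogLik (n : ℕ) (x : ℕ → ℝ) (q r : ℝ → ℝ) (Ψ : Param m) : ℝ :=
  logLik n x Ψ + ((∑ k, q (scale Ψ k)) + ∑ k, r (shape Ψ k))

/-- `Ψ` maximizes the penalized log-likelihood over the parameter space. -/
def IsPMLE (n : ℕ) (x : ℕ → ℝ) (q r : ℝ → ℝ) (Ψ : Param m) : Prop :=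
  Ψ ∈ paramSpace m ∧ IsMaxOn (penLogLik n x q r) (paramSpace m) Ψ

/-- Condition C1 on the scale penalties: `q n σ = o(n)` for each `σ > 0`, and
`sup_{σ > 0} max {0, q n σ} = o(n)`. -/
def C1 (q : ℕ → ℝ → ℝ) : Prop :=
  (∀ σ : ℝ, 0 < σ → (fun n => q n σ) =o[atTop] (fun n : ℕ => (n : ℝ))) ∧
    ∀ ε : ℝ, 0 < ε → ∀ᶠ n : ℕ in atTop, ∀ σ : ℝ, 0 < σ → max 0 (q n σ) ≤ ε * n

/-- Condition C2 on the scale penalties. -/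
def C2 (q : ℕ → ℝ → ℝ) : Prop :=
  ∀ᶠ n : ℕ in atTop, ∀ σ : ℝ, 0 < σ → σ < Real.log n / n →
    q n σ ≤ Real.log n ^ 2 * Real.log σ

/-- Condition C3 on the shape penalties. -/
def C3 (r : ℕ → ℝ → ℝ) : Prop :=
  ∀ᶠ n : ℕ in atTop, Continuous (r n) ∧ (∀ lam, r n lam ≤ r n 0) ∧
    Tendsto (r n) atTop atBot ∧ Tendsto (r n) atBot atBot ∧ r n 0 = 0

/-- Condition C4: the penalties are differentiable, with derivatives of order `o(√n)`, locally
uniformly in the argument. -/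
def C4 (q r : ℕ → ℝ → ℝ) : Prop :=
  (∀ᶠ n : ℕ in atTop, DifferentiableOn ℝ (q n) (Set.Ioi 0)) ∧
  (∀ᶠ n : ℕ in atTop, Differentiable ℝ (r n)) ∧
  TendstoLocallyUniformlyOn (fun (n : ℕ) σ => deriv (q n) σ / √(n : ℝ)) (fun _ => 0) atTop
    (Set.Ioi 0) ∧
  TendstoLocallyUniformly (fun (n : ℕ) lam => deriv (r n) lam / √(n : ℝ)) (fun _ => 0) atTop

end SkewNormalMixture

end

open SkewNormalMixture

/-! The proof has two halves: strong consistency by Wald's method on a compactified parameter space,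
and the classical expansion of the likelihood equations, in which the penalties are negligible.

Identifiability. A skew normal density combines a Gaussian with a Gaussian times a normal tail;
these are the functions `gaussTail`. Near `+∞`, dividing by the slowest decaying Gaussian reduces
their linear independence to that of Mills ratios with different rates. This follows from the
asymptotic expansion of the Mills ratio and a Vandermonde-type argument
(`coeff_eq_zero_of_rapid_decay`, `gaussTail_linearIndependent`). Hence the true mixture determines
its parameters up to renumbering, even among limits of mixtures with extended real components
(`exists_perm_of_mixExt_ae_eq`), provided that no shape vanishes and no two components differ only
in the sign of their shape. In both exceptional cases the Fisher information is singular
(`shape_ne_zero_of_posDef`, `abs_shape_ne_of_posDef`), so regularity excludes them.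

Consistency. The likelihood is unbounded because a scale may tend to zero at an observation.
`log_sub_log_le` bounds the log-likelihood ratio by a truncated ratio `truncLog`, which has an
integrable envelope, plus the excess of the component log densities over `log A`. Away from the true
parameter and its renumberings, the truncated ratio has mean at most `-c`, with `c` independent of
`A`, by compactness and a Kullback-Leibler type inequality (`exists_forall_integral_truncLog_le`); a
one-sided uniform law of large numbers carries this to the sample. The excess is controlled by
counting observations in windows of width of order `√σ`: `card_window_le` bounds their number for
moderate `σ`, and for tiny `σ` there is at most one by `ae_eventually_spacing`, so the scale penalty
compensates (`eventually_penalty_add_sum_le`).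

Normality. The log density is a log-sum-exp of functions whose derivatives up to order two grow at
most exponentially in `x`, locally uniformly in the parameter (`tameAt_log_mixDensity`). As Gaussian
tails beat every exponential, one may differentiate under the integral, which gives the centred
score and the information identity. The uniform law of large numbers for the Hessian and the mean
value inequality turn the likelihood equations into a perturbed linear system whose error, being
relative to the unknown, is absorbed without any prior rate (`ae_eventually_sum_abs_sub_le`). The
central limit theorem and Slutsky's lemma conclude. -/

/-! ### One-sided uniform laws of large numbers. -/

section LawOfLargeNumbers

variable {Ω : Type*} [MeasurableSpace Ω] {P : Measure Ω} {Q : Measure ℝ} {X : ℕ → Ω → ℝ}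

theorem slln_comp (hindep : iIndepFun X P) (hlaw : ∀ i, HasLaw (X i) Q P) {h : ℝ → ℝ}
    (hm : Measurable h) (hi : Integrable h Q) :
    ∀ᵐ ω ∂P, Tendsto (fun n : ℕ => (∑ i ∈ Finset.range n, h (X i ω)) / n) atTop
      (𝓝 (∫ x, h x ∂Q)) := by
  have hident : ∀ i, IdentDistrib (X i) (X 0) P P := fun i =>
    ⟨(hlaw i).aemeasurable, (hlaw 0).aemeasurable, by rw [(hlaw i).map_eq, (hlaw 0).map_eq]⟩
  have h0 : ∫ ω, h (X 0 ω) ∂P = ∫ x, h x ∂Q := by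
    rw [← (hlaw 0).map_eq, integral_map (hlaw 0).aemeasurable hm.aestronglyMeasurable]
  have := strong_law_ae_real (μ := P) (fun i ω => h (X i ω))
    (by
      have : Integrable h (P.map (X 0)) := by rw [(hlaw 0).map_eq]; exact hi
      exact this.comp_aemeasurable (hlaw 0).aemeasurable)
    (fun i j hij => (hindep.indepFun hij).comp hm hm)
    (fun i => (hident i).comp hm)
  simpa [h0] using this

/-- The mean of the squares is eventually below a constant `N`, so each single square is at most `N
* n ≤ n ^ 2` once `n ≥ N`. -/
theorem ae_eventually_abs_le (hindep : iIndepFun X P) (hlaw : ∀ i, HasLaw (X i) Q P)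
    (h2 : Integrable (fun x : ℝ => x ^ 2) Q) :
    ∀ᵐ ω ∂P, ∀ᶠ n : ℕ in atTop, ∀ i < n, |X i ω| ≤ n := by
  filter_upwards [slln_comp hindep hlaw (by fun_prop) h2] with ω hω
  obtain ⟨N, hN⟩ := exists_nat_gt (∫ x, x ^ 2 ∂Q)
  filter_upwards [hω.eventually_lt_const hN, eventually_ge_atTop N, eventually_gt_atTop 0]
    with n hn hnN hn0 i hi
  have hn0' : (0 : ℝ) < n := by exact_mod_cast hn0
  rw [div_lt_iff₀ hn0'] at hn
  have h1 : (X i ω) ^ 2 ≤ ∑ j ∈ Finset.range n, (X j ω) ^ 2 :=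
    Finset.single_le_sum (f := fun j => (X j ω) ^ 2) (fun j _ => sq_nonneg _)
      (Finset.mem_range.2 hi)
  have h3 : (N : ℝ) ≤ n := by exact_mod_cast hnN
  exact abs_le_of_sq_le_sq (by nlinarith) hn0'.le

/-- One-sided uniform law of large numbers near a point `θ`, the parameters `γ` being mapped into
the space of `θ` by `emb`. -/
theorem exists_nhds_sum_le (hindep : iIndepFun X P) (hlaw : ∀ i, HasLaw (X i) Q P)
    {Θ Γ : Type*} [TopologicalSpace Θ] [FirstCountableTopology Θ] [TopologicalSpace Γ]
    [SecondCountableTopology Γ] {emb : Γ → Θ} (hemb : Continuous emb)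
    {v : Γ → ℝ → ℝ} (hmeas : ∀ γ, Measurable (v γ)) (hcont : ∀ x, Continuous fun γ => v γ x)
    {B : ℝ → ℝ} (hB : Integrable B Q) (hvB : ∀ γ x, |v γ x| ≤ B x) (θ : Θ) {vbar : ℝ → ℝ}
    (hlim : ∀ᵐ x ∂Q, Tendsto (fun γ => v γ x) (comap emb (𝓝 θ)) (𝓝 (vbar x)))
    {c : ℝ} (hc : ∫ x, vbar x ∂Q < c) :
    ∃ U ∈ 𝓝 θ, ∀ᵐ ω ∂P, ∀ᶠ n : ℕ in atTop, ∀ γ, emb γ ∈ U →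
      ∑ i ∈ Finset.range n, v γ (X i ω) ≤ c * n := by
  classical
  obtain ⟨b, hb⟩ := (𝓝 θ).exists_antitone_basis
  -- The point `θ` may lie outside the closure of the range of `emb`; the claim is then vacuous near
  -- `θ`.
  by_cases hne : ∀ j, ∃ γ, emb γ ∈ b j
  swap
  · push Not at hne
    obtain ⟨j, hj⟩ := hne
    exact ⟨b j, hb.1.mem_of_mem trivial, .of_forall fun ω => .of_forall fun n γ h => absurd h (hj γ)⟩
  obtain ⟨D, hDc, hDd⟩ := TopologicalSpace.exists_countable_dense Γ
  have := hDc.to_subtype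
  let S : ℕ → Set Γ := fun j => emb ⁻¹' (interior (b j))
  have hSo : ∀ j, IsOpen (S j) := fun j => isOpen_interior.preimage hemb
  have hSne : ∀ j, (S j ∩ D).Nonempty := fun j => by
    obtain ⟨k, hk⟩ := hb.1.mem_iff.1 (interior_mem_nhds.2 (hb.1.mem_of_mem (i := j) trivial))
    obtain ⟨γ, hγ⟩ := hne k
    exact hDd.inter_open_nonempty _ (hSo j) ⟨γ, hk.2 hγ⟩
  -- The supremum runs over a countable dense subset to be measurable; by continuity in `γ` it
  -- dominates `v` on all of `S j`.
  let w : ℕ → ℝ → ℝ := fun j x => ⨆ γ : (S j ∩ D : Set Γ), v γ x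
  have hbdd : ∀ j x, BddAbove (Set.range fun γ : (S j ∩ D : Set Γ) => v γ x) := fun j x =>
    ⟨B x, by rintro _ ⟨γ, rfl⟩; exact (abs_le.1 (hvB _ _)).2⟩
  have hle : ∀ j x γ, γ ∈ S j → v γ x ≤ w j x := by
    intro j x γ hγ
    have hcl : γ ∈ closure (S j ∩ D) := by
      exact hDd.open_subset_closure_inter (hSo j) hγ
    exact (isClosed_le (hcont x) continuous_const).closure_subset_iff.2
      (fun γ' hγ' => le_ciSup (hbdd j x) ⟨γ', hγ'⟩) hcl
  have hcount : ∀ j, Countable (S j ∩ D : Set Γ) := fun j =>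
    (hDc.mono Set.inter_subset_right).to_subtype
  have hwm : ∀ j, Measurable (w j) := fun j =>
    haveI := hcount j
    Measurable.iSup fun γ => hmeas _
  have hwB : ∀ j x, |w j x| ≤ B x := by
    intro j x
    obtain ⟨γ, hγ⟩ := hSne j
    have : Nonempty (S j ∩ D : Set Γ) := ⟨⟨γ, hγ⟩⟩
    refine abs_le.2 ⟨(abs_le.1 (hvB γ x)).1.trans (hle j x γ hγ.1), ?_⟩
    exact ciSup_le fun γ => (abs_le.1 (hvB _ _)).2
  have hwlim : ∀ᵐ x ∂Q, Tendsto (fun j => w j x) atTop (𝓝 (vbar x)) := by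
    filter_upwards [hlim] with x hx
    rw [Metric.tendsto_atTop]
    intro ε hε
    have hmem := hx (Metric.closedBall_mem_nhds (vbar x) (half_pos hε))
    obtain ⟨s, hs, hs'⟩ := mem_comap.1 (mem_map.1 hmem)
    obtain ⟨N, -, hN⟩ := hb.1.mem_iff.1 hs
    refine ⟨N, fun j hj => ?_⟩
    have hcl : ∀ γ ∈ S j, v γ x ∈ Metric.closedBall (vbar x) (ε / 2) := fun γ hγ =>
      hs' (hN (hb.2 hj (interior_subset hγ)))
    obtain ⟨γ, hγ⟩ := hSne j
    have : Nonempty (S j ∩ D : Set Γ) := ⟨⟨γ, hγ⟩⟩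
    have h1 : w j x ≤ vbar x + ε / 2 := ciSup_le fun γ => by
      have := hcl γ γ.2.1
      rw [Metric.mem_closedBall, Real.dist_eq, abs_le] at this
      linarith
    have h2 : vbar x - ε / 2 ≤ w j x := by
      have := hcl γ hγ.1
      rw [Metric.mem_closedBall, Real.dist_eq, abs_le] at this
      linarith [hle j x γ hγ.1]
    rw [Real.dist_eq, abs_lt]
    constructor <;> linarith
  -- The means of the suprema decrease to a value below `c`, so the ordinary strong law for one
  -- single `w j` suffices.
  have hint := tendsto_integral_of_dominated_convergence (μ := Q) B
    (fun j => (hwm j).aestronglyMeasurable) hB (fun j => .of_forall fun x => hwB j x) hwlim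
  obtain ⟨j, hj⟩ := (hint.eventually_lt_const hc).exists
  refine ⟨interior (b j), interior_mem_nhds.2 (hb.1.mem_of_mem trivial), ?_⟩
  filter_upwards [slln_comp hindep hlaw (hwm j)
    (hB.mono' (hwm j).aestronglyMeasurable (.of_forall fun x => hwB j x))] with ω hω
  filter_upwards [hω.eventually_lt_const hj, eventually_gt_atTop 0] with n hn hn0 γ hγ
  have hn0' : (0 : ℝ) < n := by exact_mod_cast hn0
  rw [div_lt_iff₀ hn0'] at hn
  exact (Finset.sum_le_sum fun i _ => hle j (X i ω) γ hγ).trans hn.le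

/-- One-sided uniform law of large numbers over a compact set. -/
theorem eventually_forall_sum_le_of_isCompact (hindep : iIndepFun X P)
    (hlaw : ∀ i, HasLaw (X i) Q P)
    {Θ Γ : Type*} [TopologicalSpace Θ] [FirstCountableTopology Θ] [TopologicalSpace Γ]
    [SecondCountableTopology Γ] {emb : Γ → Θ} (hemb : Continuous emb)
    {v : Γ → ℝ → ℝ} (hmeas : ∀ γ, Measurable (v γ)) (hcont : ∀ x, Continuous fun γ => v γ x)
    {B : ℝ → ℝ} (hB : Integrable B Q) (hvB : ∀ γ x, |v γ x| ≤ B x) {K : Set Θ}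
    (hK : IsCompact K) {vbar : Θ → ℝ → ℝ}
    (hlim : ∀ θ ∈ K, ∀ᵐ x ∂Q, Tendsto (fun γ => v γ x) (comap emb (𝓝 θ)) (𝓝 (vbar θ x)))
    {c : ℝ} (hc : ∀ θ ∈ K, ∫ x, vbar θ x ∂Q < c) :
    ∀ᵐ ω ∂P, ∀ᶠ n : ℕ in atTop, ∀ γ, emb γ ∈ K →
      ∑ i ∈ Finset.range n, v γ (X i ω) ≤ c * n := by
  refine hK.induction_on (p := fun S => ∀ᵐ ω ∂P, ∀ᶠ n : ℕ in atTop, ∀ γ, emb γ ∈ S →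
      ∑ i ∈ Finset.range n, v γ (X i ω) ≤ c * n) ?_ ?_ ?_ ?_
  · simp
  · intro s t hst ht
    filter_upwards [ht] with ω hω
    filter_upwards [hω] with n hn γ hγ using hn γ (hst hγ)
  · intro s t hs ht
    filter_upwards [hs, ht] with ω h1 h2
    filter_upwards [h1, h2] with n h1 h2 γ hγ
    exact hγ.elim (h1 γ) (h2 γ)
  · intro θ hθ
    obtain ⟨U, hU, h⟩ := exists_nhds_sum_le hindep hlaw hemb hmeas hcont hB hvB θ (hlim θ hθ)
      (hc θ hθ)
    exact ⟨U, mem_nhdsWithin_of_mem_nhds hU, h⟩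

end LawOfLargeNumbers

/-! ### The standard normal density and distribution function. -/

/-- The standard normal density. -/
noncomputable abbrev npdf : ℝ → ℝ := gaussianPDFReal 0 1

/-- The standard normal distribution function. -/
noncomputable abbrev ncdf : ℝ → ℝ := fun t => cdf (gaussianReal 0 1) t

section StandardNormal

theorem npdf_eq (t : ℝ) : npdf t = (√(2 * Real.pi))⁻¹ * Real.exp (-t ^ 2 / 2) := by
  simp [npdf, gaussianPDFReal]

theorem npdf_pos (t : ℝ) : 0 < npdf t := gaussianPDFReal_pos _ _ _ one_ne_zero

theorem npdf_neg (t : ℝ) : npdf (-t) = npdf t := by simp [npdf_eq]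

theorem two_mul_npdf_le (t : ℝ) : 2 * npdf t ≤ Real.exp (-t ^ 2 / 2) := by
  have h : (2 : ℝ) ≤ √(2 * Real.pi) := by
    apply Real.le_sqrt_of_sq_le
    nlinarith [Real.pi_gt_three]
  rw [npdf_eq, ← mul_assoc]
  refine mul_le_of_le_one_left (Real.exp_pos _).le ?_
  rw [mul_inv_le_iff₀ (by positivity)]
  linarith

theorem continuous_npdf : Continuous npdf := by
  have : npdf = fun t => (√(2 * Real.pi))⁻¹ * Real.exp (-t ^ 2 / 2) := funext npdf_eq
  rw [this]; fun_prop

theorem hasDerivAt_npdf (t : ℝ) : HasDerivAt npdf (-t * npdf t) t := by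
  have : npdf = fun t => (√(2 * Real.pi))⁻¹ * Real.exp (-t ^ 2 / 2) := funext npdf_eq
  rw [this]
  have h : HasDerivAt (fun t : ℝ => -t ^ 2 / 2) (-t) t := by
    exact (((hasDerivAt_id' t).pow 2).neg.div_const 2).congr_deriv (by simp; ring)
  exact (h.exp.const_mul (√(2 * Real.pi))⁻¹).congr_deriv (by ring)

theorem ncdf_eq_integral (t : ℝ) : ncdf t = ∫ x in Set.Iic t, npdf x := by
  rw [ncdf, cdf_eq_real, Measure.real, gaussianReal_apply_eq_integral _ one_ne_zero,
    ENNReal.toReal_ofReal]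
  exact setIntegral_nonneg measurableSet_Iic fun x _ => (npdf_pos x).le

theorem integrable_npdf : Integrable npdf := integrable_gaussianPDFReal 0 1

theorem ncdf_sub_ncdf (a b : ℝ) : ncdf b - ncdf a = ∫ x in a..b, npdf x := by
  rw [ncdf_eq_integral, ncdf_eq_integral]
  exact intervalIntegral.integral_Iic_sub_Iic integrable_npdf.integrableOn
    integrable_npdf.integrableOn

theorem hasDerivAt_ncdf (t : ℝ) : HasDerivAt ncdf (npdf t) t := by
  have h : ncdf = fun b => ncdf 0 + ∫ x in (0 : ℝ)..b, npdf x := by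
    funext b; rw [← ncdf_sub_ncdf]; ring
  rw [h]
  exact (intervalIntegral.integral_hasDerivAt_right
    (continuous_npdf.intervalIntegrable _ _)
    (continuous_npdf.stronglyMeasurableAtFilter _ _)
    continuous_npdf.continuousAt).const_add _

theorem continuous_ncdf : Continuous ncdf :=
  continuous_iff_continuousAt.2 fun t => (hasDerivAt_ncdf t).continuousAt

theorem ncdf_nonneg (t : ℝ) : 0 ≤ ncdf t := cdf_nonneg _ _

theorem ncdf_le_one (t : ℝ) : ncdf t ≤ 1 := cdf_le_one _ _

theorem strictMono_ncdf : StrictMono ncdf :=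
  strictMono_of_deriv_pos fun t => by rw [(hasDerivAt_ncdf t).deriv]; exact npdf_pos t

theorem ncdf_pos (t : ℝ) : 0 < ncdf t :=
  (ncdf_nonneg (t - 1)).trans_lt (strictMono_ncdf (by linarith))

theorem ncdf_neg (t : ℝ) : ncdf (-t) = 1 - ncdf t := by
  have h1 : ncdf (-t) = ∫ x in Set.Ioi t, npdf x := by
    rw [ncdf_eq_integral]
    have := integral_comp_neg_Iic (-t) npdf
    simpa only [npdf_neg, neg_neg] using this
  have h2 := intervalIntegral.integral_Iic_add_Ioi (b := t) integrable_npdf.integrableOn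
    integrable_npdf.integrableOn
  rw [integral_gaussianPDFReal_eq_one 0 one_ne_zero, ← ncdf_eq_integral, ← h1] at h2
  linarith

theorem ncdf_zero : ncdf 0 = 1 / 2 := by
  have := ncdf_neg 0
  rw [neg_zero] at this
  linarith

/-- A crude lower bound of the normal tail. -/
theorem npdf_le_ncdf_neg {t : ℝ} (ht : 0 ≤ t) : npdf (t + 1) ≤ ncdf (-t) := by
  have h1 := ncdf_sub_ncdf (-(t + 1)) (-t)
  have h2 : ∫ _ in (-(t + 1))..(-t), npdf (t + 1) ≤ ∫ x in (-(t + 1))..(-t), npdf x := by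
    refine intervalIntegral.integral_mono_on (by linarith) (by simp)
      (continuous_npdf.intervalIntegrable _ _) fun x hx => ?_
    rw [npdf_eq, npdf_eq]
    have : x ^ 2 ≤ (t + 1) ^ 2 := by
      rw [← neg_sq x]
      exact pow_le_pow_left₀ (by linarith [hx.2]) (by linarith [hx.1]) 2
    gcongr
  simp only [intervalIntegral.integral_const, smul_eq_mul] at h2
  have := ncdf_nonneg (-(t + 1))
  nlinarith

end StandardNormal

/-! ### Skew normal densities: bounds and total mass. -/

section SkewNormalDensity

theorem snDensity_eq (μ σ lam x : ℝ) :
    snDensity μ σ lam x = 2 / σ * npdf ((x - μ) / σ) * ncdf (lam * ((x - μ) / σ)) := rfl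

theorem snDensity_pos {σ : ℝ} (hσ : 0 < σ) (μ lam x : ℝ) : 0 < snDensity μ σ lam x :=
  mul_pos (mul_pos (by positivity) (npdf_pos _)) (ncdf_pos _)

/-- The factor `G` is arbitrary so that the bound also serves the limits with infinite shape. -/
theorem skew_kernel_le {σ z G : ℝ} (hσ : 0 < σ) (hG1 : G ≤ 1) :
    2 / σ * npdf z * G ≤ 1 / σ * Real.exp (-z ^ 2 / 2) := by
  have h1 : 2 / σ * npdf z = 1 / σ * (2 * npdf z) := by ring
  have h2 : 0 ≤ 2 / σ * npdf z := mul_nonneg (by positivity) (npdf_pos _).le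
  refine (mul_le_of_le_one_right h2 hG1).trans ?_
  rw [h1]
  gcongr
  exact two_mul_npdf_le z

theorem snDensity_le {σ : ℝ} (hσ : 0 < σ) (μ lam x : ℝ) :
    snDensity μ σ lam x ≤ 1 / σ * Real.exp (-((x - μ) / σ) ^ 2 / 2) :=
  skew_kernel_le hσ (ncdf_le_one _)

/-- Completing the square: with `z = (x - μ) / σ`, `a|x| ≤ aσ|z| + a|μ|` and `aσ|z| ≤ a²σ²/2 +
z²/2`. The rate `a` is free, so any exponential growth in `x` can be beaten later. -/
theorem gaussian_kernel_le_exp {σ : ℝ} (hσ : 0 < σ) (μ x : ℝ) {a : ℝ} (ha : 0 ≤ a) :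
    1 / σ * Real.exp (-((x - μ) / σ) ^ 2 / 2) ≤
      1 / σ * Real.exp (a ^ 2 * σ ^ 2 / 2 + a * |μ|) * Real.exp (-(a * |x|)) := by
  rw [mul_assoc, ← Real.exp_add]
  gcongr
  have h1 : |x| ≤ |x - μ| + |μ| := by
    have := abs_add_le (x - μ) μ
    simpa using this
  have h2 : |x - μ| = σ * |(x - μ) / σ| := by
    rw [abs_div, abs_of_pos hσ]; field_simp
  have h3 := sq_nonneg (a * σ - |(x - μ) / σ|)
  rw [sub_sq, sq_abs] at h3
  nlinarith [mul_le_mul_of_nonneg_left h1 ha]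

theorem continuous_snDensity (μ σ lam : ℝ) : Continuous (snDensity μ σ lam) := by
  have : snDensity μ σ lam =
      fun x => 2 / σ * npdf ((x - μ) / σ) * ncdf (lam * ((x - μ) / σ)) := rfl
  rw [this]
  have h1 := continuous_npdf
  have h2 := continuous_ncdf
  fun_prop

/-- The normal density is even, so averaging over `z` and `-z` replaces `G` by `1/2`. -/
theorem integral_npdf_mul_eq_half {G : ℝ → ℝ} (hm : Measurable G) (h0 : ∀ z, 0 ≤ G z)
    (h1 : ∀ z, G z ≤ 1) (hs : ∀ z, z ≠ 0 → G z + G (-z) = 1) :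
    Integrable (fun z => npdf z * G z) ∧ ∫ z, npdf z * G z = 1 / 2 := by
  have hi : Integrable fun z => npdf z * G z := by
    refine integrable_npdf.mono' (continuous_npdf.measurable.mul hm).aestronglyMeasurable
      (.of_forall fun z => ?_)
    rw [Real.norm_of_nonneg (mul_nonneg (npdf_pos z).le (h0 z))]
    exact mul_le_of_le_one_right (npdf_pos z).le (h1 z)
  refine ⟨hi, ?_⟩
  have h2 : ∫ z, npdf z * G (-z) = ∫ z, npdf z * G z := by
    rw [← integral_neg_eq_self (fun z => npdf z * G z)]
    simp [npdf_neg]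
  have hi2 : Integrable fun z => npdf z * G (-z) := by
    have := hi.comp_neg
    simpa [npdf_neg] using this
  have h3 : (∫ z, npdf z * G z) + ∫ z, npdf z * G (-z) = 1 := by
    rw [← integral_add hi hi2, ← integral_gaussianPDFReal_eq_one 0 (one_ne_zero (α := NNReal))]
    refine integral_congr_ae ?_
    filter_upwards [(measure_eq_zero_iff_ae_notMem).1 (Real.volume_singleton (a := 0))] with z hz
    rw [← mul_add, hs z hz, mul_one]
  linarith

theorem integral_skew_kernel {G : ℝ → ℝ} (hm : Measurable G) (h0 : ∀ z, 0 ≤ G z)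
    (h1 : ∀ z, G z ≤ 1) (hs : ∀ z, z ≠ 0 → G z + G (-z) = 1) (μ : ℝ) {σ : ℝ} (hσ : 0 < σ) :
    Integrable (fun x => 2 / σ * npdf ((x - μ) / σ) * G ((x - μ) / σ)) ∧
      ∫ x, 2 / σ * npdf ((x - μ) / σ) * G ((x - μ) / σ) = 1 := by
  obtain ⟨hi, he⟩ := integral_npdf_mul_eq_half hm h0 h1 hs
  have hi' := ((hi.const_mul (2 / σ)).comp_div hσ.ne').comp_sub_right μ
  refine ⟨by simpa [mul_assoc] using hi', ?_⟩
  have e1 : ∀ x, 2 / σ * npdf ((x - μ) / σ) * G ((x - μ) / σ) =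
      2 / σ * (fun z => npdf z * G z) ((x - μ) / σ) := fun x => by ring
  simp_rw [e1]
  rw [integral_const_mul, integral_sub_right_eq_self (fun y => (fun z => npdf z * G z) (y / σ)) μ,
    Measure.integral_comp_div (fun z => npdf z * G z), he, abs_of_pos hσ, smul_eq_mul]
  field_simp

theorem integrable_snDensity {σ : ℝ} (hσ : 0 < σ) (μ lam : ℝ) :
    Integrable (snDensity μ σ lam) ∧ ∫ x, snDensity μ σ lam x = 1 := by
  refine integral_skew_kernel (G := fun z => ncdf (lam * z))
    (continuous_ncdf.comp (continuous_const.mul continuous_id)).measurable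
    (fun z => ncdf_nonneg _) (fun z => ncdf_le_one _) (fun z _ => ?_) μ hσ
  rw [mul_neg, ncdf_neg]; ring

end SkewNormalDensity

/-! ### Pointwise limits of skew normal densities at extended parameters. -/

section ExtendedDensity

/-- The standard normal distribution function on the extended real line. -/
noncomputable def ncdfE (t : EReal) : ℝ := if t = ⊥ then 0 else if t = ⊤ then 1 else ncdf t.toReal

theorem ncdfE_coe (t : ℝ) : ncdfE t = ncdf t := by simp [ncdfE]

theorem ncdfE_top : ncdfE ⊤ = 1 := by simp [ncdfE]

theorem ncdfE_bot : ncdfE ⊥ = 0 := by simp [ncdfE]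

theorem ncdfE_nonneg (t : EReal) : 0 ≤ ncdfE t := by
  induction t with
  | bot => rw [ncdfE_bot]
  | top => rw [ncdfE_top]; norm_num
  | coe t => rw [ncdfE_coe]; exact ncdf_nonneg t

theorem ncdfE_le_one (t : EReal) : ncdfE t ≤ 1 := by
  induction t with
  | bot => rw [ncdfE_bot]; norm_num
  | top => rw [ncdfE_top]
  | coe t => rw [ncdfE_coe]; exact ncdf_le_one t

theorem ncdfE_neg (t : EReal) : ncdfE (-t) = 1 - ncdfE t := by
  induction t with
  | bot => simp [ncdfE_bot, ncdfE_top]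
  | top => simp [ncdfE_bot, ncdfE_top]
  | coe t => rw [← EReal.coe_neg, ncdfE_coe, ncdfE_coe, ncdf_neg]

theorem monotone_ncdfE : Monotone ncdfE := by
  intro a b hab
  induction a with
  | bot => rw [ncdfE_bot]; exact ncdfE_nonneg b
  | top => rw [top_le_iff.1 hab]
  | coe a =>
    induction b with
    | bot => exact absurd hab (by simp)
    | top => rw [ncdfE_top]; exact ncdfE_le_one _
    | coe b =>
      rw [ncdfE_coe, ncdfE_coe]
      exact strictMono_ncdf.monotone (EReal.coe_le_coe_iff.1 hab)

theorem continuous_ncdfE : Continuous ncdfE := by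
  rw [continuous_iff_continuousAt]
  intro a
  induction a with
  | coe a =>
    have h : Tendsto (fun t => ncdf t) (𝓝 a) (𝓝 (ncdf a)) := continuous_ncdf.continuousAt
    rw [ContinuousAt, EReal.nhds_coe, tendsto_map'_iff, ncdfE_coe]
    exact h.congr fun t => (ncdfE_coe t).symm
  | top =>
    rw [ContinuousAt, ncdfE_top, tendsto_order]
    refine ⟨fun b hb => ?_, fun b hb => .of_forall fun t => (ncdfE_le_one t).trans_lt hb⟩
    obtain ⟨t, ht⟩ := ((tendsto_cdf_atTop (gaussianReal 0 1)).eventually_const_lt hb).exists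
    filter_upwards [Ioi_mem_nhds (EReal.coe_lt_top t)] with s hs
    refine lt_of_lt_of_le ?_ (monotone_ncdfE (le_of_lt hs))
    rw [ncdfE_coe]; exact ht
  | bot =>
    rw [ContinuousAt, ncdfE_bot, tendsto_order]
    refine ⟨fun b hb => .of_forall fun t => hb.trans_le (ncdfE_nonneg t), fun b hb => ?_⟩
    obtain ⟨t, ht⟩ := ((tendsto_cdf_atBot (gaussianReal 0 1)).eventually_lt_const hb).exists
    filter_upwards [Iio_mem_nhds (EReal.bot_lt_coe t)] with s hs
    refine lt_of_le_of_lt (monotone_ncdfE (le_of_lt hs)) ?_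
    rw [ncdfE_coe]; exact ht

open Classical in
/-- The pointwise limits of skew normal densities as the parameters tend to extended reals. -/
noncomputable def snExt (μ σ lam : EReal) (x : ℝ) : ℝ :=
  if μ = ⊤ ∨ μ = ⊥ ∨ σ = ⊤ ∨ σ ≤ 0 then 0
  else 2 / σ.toReal * npdf ((x - μ.toReal) / σ.toReal) *
    ncdfE (lam * ((x - μ.toReal) / σ.toReal : ℝ))

theorem snExt_of_pos (μ : ℝ) {σ : ℝ} (hσ : 0 < σ) (lam : EReal) (x : ℝ) :
    snExt μ σ lam x = 2 / σ * npdf ((x - μ) / σ) * ncdfE (lam * ((x - μ) / σ : ℝ)) := by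
  rw [snExt, if_neg]
  · simp
  · simpa using hσ

theorem snExt_coe (μ : ℝ) {σ : ℝ} (hσ : 0 < σ) (lam x : ℝ) :
    snExt μ σ lam x = snDensity μ σ lam x := by
  rw [snExt_of_pos μ hσ, ← EReal.coe_mul, ncdfE_coe, snDensity_eq]

theorem snExt_eq_zero_or (μ σ : EReal) : (∀ lam x, snExt μ σ lam x = 0) ∨
    ∃ (a b : ℝ), 0 < b ∧ μ = a ∧ σ = b := by
  by_cases h : μ = ⊤ ∨ μ = ⊥ ∨ σ = ⊤ ∨ σ ≤ 0
  · exact .inl fun lam x => by rw [snExt, if_pos h]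
  · right
    push Not at h
    obtain ⟨h1, h2, h3, h4⟩ := h
    lift μ to ℝ using ⟨h1, h2⟩
    lift σ to ℝ using ⟨h3, (EReal.bot_lt_zero.trans h4).ne'⟩
    exact ⟨μ, σ, by exact_mod_cast h4, rfl, rfl⟩

theorem snExt_nonneg (μ σ lam : EReal) (x : ℝ) : 0 ≤ snExt μ σ lam x := by
  obtain h | ⟨a, b, hb, rfl, rfl⟩ := snExt_eq_zero_or μ σ
  · rw [h]
  · rw [snExt_of_pos a hb]
    exact mul_nonneg (mul_nonneg (by positivity) (npdf_pos _).le) (ncdfE_nonneg _)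

theorem measurable_ereal_mul_coe (lam : EReal) : Measurable fun z : ℝ => ncdfE (lam * (z : EReal)) := by
  have : Measurable fun z : ℝ => lam * (z : EReal) := by fun_prop
  exact continuous_ncdfE.measurable.comp this

theorem measurable_snExt (μ σ lam : EReal) : Measurable (snExt μ σ lam) := by
  obtain h | ⟨a, b, hb, rfl, rfl⟩ := snExt_eq_zero_or μ σ
  · rw [funext (h lam)]; exact measurable_const
  · rw [funext (snExt_of_pos a hb lam)]
    have h1 := continuous_npdf.measurable
    have h2 := measurable_ereal_mul_coe lam
    refine ((h1.comp (by fun_prop)).const_mul _).mul (h2.comp (by fun_prop))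

theorem integrable_snExt (μ σ lam : EReal) :
    Integrable (snExt μ σ lam) ∧ ∫ x, snExt μ σ lam x ≤ 1 := by
  obtain h | ⟨a, b, hb, rfl, rfl⟩ := snExt_eq_zero_or μ σ
  · rw [funext (h lam)]; simp
  by_cases hlam : lam = 0
  · subst hlam
    have := integrable_snDensity hb a 0
    have e : snExt a b 0 = snDensity a b 0 := funext (snExt_coe a hb 0)
    rw [e]
    exact ⟨this.1, this.2.le⟩
  · have := integral_skew_kernel (G := fun z => ncdfE (lam * (z : EReal)))
      (measurable_ereal_mul_coe lam) (fun z => ncdfE_nonneg _) (fun z => ncdfE_le_one _)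
      (fun z _ => by rw [EReal.coe_neg, mul_neg, ncdfE_neg]; ring) a hb
    rw [funext (snExt_of_pos a hb lam)]
    exact ⟨this.1, this.2.le⟩

theorem exp_neg_sq_div_two_le {z : ℝ} : Real.exp (-z ^ 2 / 2) ≤ 1 := by
  rw [Real.exp_le_one_iff]; nlinarith [sq_nonneg z]

theorem abs_mul_exp_neg_sq_le (z : ℝ) : |z| * Real.exp (-z ^ 2 / 2) ≤ 1 := by
  have h1 := Real.add_one_le_exp (z ^ 2 / 2)
  have h2 : |z| ≤ Real.exp (z ^ 2 / 2) := by
    nlinarith [sq_abs z, sq_nonneg (|z| - 1)]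
  rw [neg_div, Real.exp_neg]
  exact mul_inv_le_one_of_le₀ h2 (Real.exp_pos _).le

theorem sq_mul_exp_neg_sq_le (z : ℝ) : z ^ 2 * Real.exp (-z ^ 2 / 2) ≤ 1 := by
  have h1 := Real.add_one_le_exp (z ^ 2 / 4)
  have h2 : z ^ 2 ≤ Real.exp (z ^ 2 / 2) := by
    have e : Real.exp (z ^ 2 / 2) = Real.exp (z ^ 2 / 4) ^ 2 := by
      rw [← Real.exp_nat_mul]; congr 1; push_cast; ring
    rw [e]
    nlinarith [sq_nonneg (z ^ 2 / 4 - 1), sq_nonneg z]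
  rw [neg_div, Real.exp_neg]
  exact mul_inv_le_one_of_le₀ h2 (Real.exp_pos _).le

theorem snExt_le_inv_scale (μ : ℝ) {σ : ℝ} (hσ : 0 < σ) (lam : EReal) (x : ℝ) :
    snExt μ σ lam x ≤ 1 / σ := by
  rw [snExt_of_pos μ hσ]
  refine (skew_kernel_le hσ (ncdfE_le_one _)).trans ?_
  exact mul_le_of_le_one_right (by positivity) exp_neg_sq_div_two_le

theorem snExt_le_inv_abs (μ : ℝ) {σ : ℝ} (hσ : 0 < σ) (lam : EReal) {x : ℝ} (hx : x ≠ μ) :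
    snExt μ σ lam x ≤ 1 / |x - μ| := by
  rw [snExt_of_pos μ hσ]
  refine (skew_kernel_le hσ (ncdfE_le_one _)).trans ?_
  have h := abs_mul_exp_neg_sq_le ((x - μ) / σ)
  have h0 : 0 < |x - μ| := abs_pos.2 (sub_ne_zero.2 hx)
  rw [abs_div, abs_of_pos hσ, div_mul_eq_mul_div, div_le_one hσ] at h
  rw [le_div_iff₀ h0, one_div, inv_mul_eq_div, div_mul_eq_mul_div, div_le_one hσ]
  linarith

theorem snExt_le_scale_div (μ : ℝ) {σ : ℝ} (hσ : 0 < σ) (lam : EReal) {x : ℝ} (hx : x ≠ μ) :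
    snExt μ σ lam x ≤ σ / (x - μ) ^ 2 := by
  rw [snExt_of_pos μ hσ]
  refine (skew_kernel_le hσ (ncdfE_le_one _)).trans ?_
  have h := sq_mul_exp_neg_sq_le ((x - μ) / σ)
  have h0 : 0 < (x - μ) ^ 2 := by have := sub_ne_zero.2 hx; positivity
  rw [le_div_iff₀ h0]
  have e : 1 / σ * Real.exp (-((x - μ) / σ) ^ 2 / 2) * (x - μ) ^ 2 =
    σ * (((x - μ) / σ) ^ 2 * Real.exp (-((x - μ) / σ) ^ 2 / 2)) := by field_simp
  rw [e]
  exact mul_le_of_le_one_right hσ.le h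

/-- Extended parameters without a finite location and a finite positive scale give the value `0`, so
only the others need an upper bound. -/
theorem continuousAt_snExt_of_zero {μ σ lam : EReal} {x : ℝ} (h0 : snExt μ σ lam x = 0)
    (h : ∀ ε : ℝ, 0 < ε → ∀ᶠ p : EReal × EReal × EReal in 𝓝 (μ, σ, lam),
      ∀ a b : ℝ, 0 < b → p.1 = a → p.2.1 = b → snExt a b p.2.2 x ≤ ε) :
    ContinuousAt (fun p : EReal × EReal × EReal => snExt p.1 p.2.1 p.2.2 x) (μ, σ, lam) := by
  rw [ContinuousAt, h0, Metric.tendsto_nhds]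
  intro ε hε
  filter_upwards [h (ε / 2) (half_pos hε)] with p hp
  rw [Real.dist_eq, sub_zero, abs_of_nonneg (snExt_nonneg _ _ _ _)]
  obtain h | ⟨a, b, hb, h1, h2⟩ := snExt_eq_zero_or p.1 p.2.1
  · rw [h]; exact hε
  · rw [h1, h2]
    linarith [hp a b hb h1 h2]

/-- The degenerate limits are `0` by the bounds `1/|x - μ|` (location to infinity), `1/σ` (scale to
infinity) and `σ/(x - μ)²` (scale to zero). The excluded point is a genuine singularity, since a
density concentrates there as its scale tends to zero, but it forms a null set. -/
theorem continuousAt_snExt {μ σ lam : EReal} {x : ℝ} (hx : (x : EReal) ≠ μ) :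
    ContinuousAt (fun p : EReal × EReal × EReal => snExt p.1 p.2.1 p.2.2 x) (μ, σ, lam) := by
  have c1 : ContinuousAt (fun p : EReal × EReal × EReal => p.1) (μ, σ, lam) := by fun_prop
  have c2 : ContinuousAt (fun p : EReal × EReal × EReal => p.2.1) (μ, σ, lam) := by fun_prop
  have c3 : ContinuousAt (fun p : EReal × EReal × EReal => p.2.2) (μ, σ, lam) := by fun_prop
  have zero_of : μ = ⊤ ∨ μ = ⊥ ∨ σ = ⊤ ∨ σ ≤ 0 → snExt μ σ lam x = 0 := fun h => by
    rw [snExt, if_pos h]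
  induction μ with
  | top =>
    refine continuousAt_snExt_of_zero (zero_of (by simp)) fun ε hε => ?_
    filter_upwards [c1 (Ioi_mem_nhds (EReal.coe_lt_top (x + 1 / ε)))] with p hp a b hb h1 h2
    have ha : x + 1 / ε < a := by
      have : ((x + 1 / ε : ℝ) : EReal) < p.1 := hp
      rw [h1] at this; exact_mod_cast this
    have hε' : 0 < 1 / ε := by positivity
    refine (snExt_le_inv_abs a hb _ (by linarith)).trans ?_
    rw [one_div_le (abs_pos.2 (by linarith)) hε]
    have := neg_le_abs (x - a)
    linarith
  | bot =>
    refine continuousAt_snExt_of_zero (zero_of (by simp)) fun ε hε => ?_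
    filter_upwards [c1 (Iio_mem_nhds (EReal.bot_lt_coe (x - 1 / ε)))] with p hp a b hb h1 h2
    have ha : a < x - 1 / ε := by
      have : p.1 < ((x - 1 / ε : ℝ) : EReal) := hp
      rw [h1] at this; exact_mod_cast this
    have hε' : 0 < 1 / ε := by positivity
    refine (snExt_le_inv_abs a hb _ (by linarith)).trans ?_
    rw [one_div_le (abs_pos.2 (by linarith)) hε]
    have := le_abs_self (x - a)
    linarith
  | coe μ =>
    have hxμ : x ≠ μ := fun h => hx (by rw [h])
    obtain hσ | hσ | hσ := lt_trichotomy σ 0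
    · refine continuousAt_snExt_of_zero (zero_of (by simp [hσ.le])) fun ε hε => ?_
      filter_upwards [c2 (Iio_mem_nhds hσ)] with p hp a b hb h1 h2
      have : p.2.1 < 0 := hp
      rw [h2] at this
      exact absurd hb (not_lt.2 (by exact_mod_cast this.le))
    · subst hσ
      refine continuousAt_snExt_of_zero (zero_of (by simp)) fun ε hε => ?_
      -- Locations within `d` of `μ` stay at distance at least `d` from `x`, and then `σ / d²` is
      -- small once `σ < ε * d²`.
      set d := |x - μ| / 2 with hd
      have hd0 : 0 < d := by have := abs_pos.2 (sub_ne_zero.2 hxμ); positivity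
      have n1 : Set.Ioo ((μ - d : ℝ) : EReal) (μ + d : ℝ) ∈ 𝓝 (μ : EReal) :=
        Ioo_mem_nhds (by exact_mod_cast (by linarith)) (by exact_mod_cast (by linarith))
      have n2 : Set.Iio ((ε * d ^ 2 : ℝ) : EReal) ∈ 𝓝 (0 : EReal) :=
        Iio_mem_nhds (by exact_mod_cast (by positivity))
      filter_upwards [c1 n1, c2 n2] with p hp hp2 a b hb h1 h2
      have hp' : p.1 ∈ Set.Ioo ((μ - d : ℝ) : EReal) (μ + d : ℝ) := hp
      have hp2' : p.2.1 < ((ε * d ^ 2 : ℝ) : EReal) := hp2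
      rw [h1] at hp'
      rw [h2] at hp2'
      have ha1 : μ - d < a := by exact_mod_cast hp'.1
      have ha2 : a < μ + d := by exact_mod_cast hp'.2
      have hb2 : b < ε * d ^ 2 := by exact_mod_cast hp2'
      have hda : d ≤ |x - a| := by
        have h3 : |x - μ| ≤ |x - a| + |a - μ| := abs_sub_le _ _ _
        have h4 : |a - μ| < d := by rw [abs_lt]; constructor <;> linarith
        linarith
      have hxa : x ≠ a := fun h => by rw [h] at hda; simp at hda; linarith
      refine (snExt_le_scale_div a hb _ hxa).trans ?_
      have h5 : d ^ 2 ≤ (x - a) ^ 2 := by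
        rw [← sq_abs (x - a)]; exact pow_le_pow_left₀ hd0.le hda 2
      rw [div_le_iff₀ (by nlinarith [sq_pos_of_pos hd0])]
      nlinarith
    · induction σ with
      | bot => exact absurd hσ (by simp)
      | top =>
        refine continuousAt_snExt_of_zero (zero_of (by simp)) fun ε hε => ?_
        filter_upwards [c2 (Ioi_mem_nhds (EReal.coe_lt_top (1 / ε)))] with p hp a b hb h1 h2
        have hb' : 1 / ε < b := by
          have : ((1 / ε : ℝ) : EReal) < p.2.1 := hp
          rw [h2] at this; exact_mod_cast this
        refine (snExt_le_inv_scale a hb _ _).trans ?_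
        rw [one_div_le hb hε]; exact hb'.le
      | coe σ =>
        have hσ' : 0 < σ := by exact_mod_cast hσ
        have t1 : ContinuousAt (fun p : EReal × EReal × EReal => p.1.toReal)
            ((μ : EReal), (σ : EReal), lam) :=
          ContinuousAt.comp (f := fun p : EReal × EReal × EReal => p.1)
            (EReal.tendsto_toReal (EReal.coe_ne_top μ) (EReal.coe_ne_bot μ)) c1
        have t2 : ContinuousAt (fun p : EReal × EReal × EReal => p.2.1.toReal)
            ((μ : EReal), (σ : EReal), lam) :=
          ContinuousAt.comp (f := fun p : EReal × EReal × EReal => p.2.1)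
            (EReal.tendsto_toReal (EReal.coe_ne_top σ) (EReal.coe_ne_bot σ)) c2
        have tz : ContinuousAt (fun p : EReal × EReal × EReal =>
            (x - p.1.toReal) / p.2.1.toReal) ((μ : EReal), (σ : EReal), lam) :=
          (continuousAt_const.sub t1).div t2 (by simpa using hσ'.ne')
        -- For an infinite shape, multiplication of extended reals is continuous only where the
        -- other factor is nonzero; this is where `x ≠ μ` enters.
        have hz : (((x - μ) / σ : ℝ) : EReal) ≠ 0 := by
          have : (x - μ) / σ ≠ 0 := div_ne_zero (sub_ne_zero.2 hxμ) hσ'.ne'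
          exact_mod_cast this
        have tm : ContinuousAt (fun p : EReal × EReal × EReal =>
            ncdfE (p.2.2 * ((x - p.1.toReal) / p.2.1.toReal : ℝ)))
            ((μ : EReal), (σ : EReal), lam) := by
          refine continuous_ncdfE.continuousAt.comp ?_
          have hm := EReal.continuousAt_mul (p := (lam, (((x - μ) / σ : ℝ) : EReal)))
            (by simp) (by simp) (.inr hz) (.inr hz)
          have hpair : ContinuousAt (fun p : EReal × EReal × EReal =>
            (p.2.2, (((x - p.1.toReal) / p.2.1.toReal : ℝ) : EReal)))
            ((μ : EReal), (σ : EReal), lam) :=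
            c3.prodMk (continuous_coe_real_ereal.continuousAt.comp tz)
          exact ContinuousAt.comp (f := fun p : EReal × EReal × EReal =>
            (p.2.2, (((x - p.1.toReal) / p.2.1.toReal : ℝ) : EReal))) (by simpa using hm) hpair
        have hcont : ContinuousAt (fun p : EReal × EReal × EReal =>
            2 / p.2.1.toReal * npdf ((x - p.1.toReal) / p.2.1.toReal) *
            ncdfE (p.2.2 * ((x - p.1.toReal) / p.2.1.toReal : ℝ)))
            ((μ : EReal), (σ : EReal), lam) :=
          ((continuousAt_const.div t2 (by simpa using hσ'.ne')).mul
            (continuous_npdf.continuousAt.comp tz)).mul tm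
        refine hcont.congr ?_
        filter_upwards [c1 (Ioo_mem_nhds (EReal.bot_lt_coe μ) (EReal.coe_lt_top μ)),
          c2 (Ioo_mem_nhds hσ (EReal.coe_lt_top σ))] with p hp1 hp2
        rw [snExt, if_neg]
        rintro (h | h | h | h)
        · exact hp1.2.ne h
        · exact hp1.1.ne' h
        · exact hp2.2.ne h
        · exact absurd h (not_le.2 hp2.1)

end ExtendedDensity

/-! ### Asymptotic expansion of the Mills ratio. -/

section MillsRatio

theorem hasDerivAt_sum_neg_pow_div_factorial (k : ℕ) (v : ℝ) :
    HasDerivAt (fun v : ℝ => ∑ j ∈ Finset.range (k + 1), (-v) ^ j / (j.factorial : ℝ))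
      (-∑ j ∈ Finset.range k, (-v) ^ j / (j.factorial : ℝ)) v := by
  induction k with
  | zero => simpa using hasDerivAt_const v (1 : ℝ)
  | succ k ih =>
    simp_rw [Finset.sum_range_succ _ (k + 1)]
    rw [Finset.sum_range_succ _ k, neg_add]
    refine ih.add ?_
    refine (((hasDerivAt_neg' v).pow (k + 1)).div_const _).congr_deriv ?_
    rw [Nat.factorial_succ]
    have h1 : ((k : ℝ) + 1) ≠ 0 := by positivity
    have h2 : ((k.factorial : ℕ) : ℝ) ≠ 0 := by positivity
    push_cast
    field_simp

/-- The signed remainder of order `k + 1` vanishes at `0` and its derivative is the signed remainder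
of order `k`. -/
theorem neg_one_pow_mul_exp_remainder_nonneg (k : ℕ) : ∀ v : ℝ, 0 ≤ v →
    0 ≤ (-1) ^ k * (Real.exp (-v) - ∑ j ∈ Finset.range k, (-v) ^ j / (j.factorial : ℝ)) := by
  induction k with
  | zero => intro v _; simpa using (Real.exp_pos _).le
  | succ k ih =>
    intro v hv
    have hd : ∀ v, HasDerivAt (fun v : ℝ => (-1) ^ (k + 1) * (Real.exp (-v) -
        ∑ j ∈ Finset.range (k + 1), (-v) ^ j / (j.factorial : ℝ)))
        ((-1) ^ k * (Real.exp (-v) - ∑ j ∈ Finset.range k, (-v) ^ j / (j.factorial : ℝ))) v := by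
      intro v
      refine (((hasDerivAt_neg' v).exp.sub
        (hasDerivAt_sum_neg_pow_div_factorial k v)).const_mul _).congr_deriv ?_
      rw [pow_succ]; ring
    have hm := monotoneOn_of_deriv_nonneg (convex_Ici (0 : ℝ))
      (fun v _ => (hd v).continuousAt.continuousWithinAt)
      (fun v _ => (hd v).differentiableAt.differentiableWithinAt)
      (fun v h => by rw [(hd v).deriv]; rw [interior_Ici] at h; exact ih v (le_of_lt h))
    have := hm (Set.self_mem_Ici) hv hv
    simpa [Finset.sum_range_succ'] using this

/-- Consecutive remainders have opposite signs, so each is at most the next term in absolute value.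
-/
theorem abs_exp_neg_sub_sum_le (k : ℕ) {v : ℝ} (hv : 0 ≤ v) :
    |Real.exp (-v) - ∑ j ∈ Finset.range k, (-v) ^ j / (j.factorial : ℝ)| ≤
      v ^ k / k.factorial := by
  have h1 := neg_one_pow_mul_exp_remainder_nonneg k v hv
  have h2 := neg_one_pow_mul_exp_remainder_nonneg (k + 1) v hv
  rw [Finset.sum_range_succ, neg_pow v k] at h2
  have h3 : ((-1 : ℝ) ^ k) * (-1) ^ k = 1 := by rw [← mul_pow]; simp
  have h4 : (-1 : ℝ) ^ (k + 1) * (Real.exp (-v) - (∑ j ∈ Finset.range k,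
      (-v) ^ j / (j.factorial : ℝ) + (-1) ^ k * v ^ k / k.factorial)) =
      -((-1) ^ k * (Real.exp (-v) - ∑ j ∈ Finset.range k, (-v) ^ j / (j.factorial : ℝ))) +
        ((-1 : ℝ) ^ k * (-1) ^ k) * (v ^ k / k.factorial) := by ring
  rw [h4, h3, one_mul] at h2
  have h5 : |Real.exp (-v) - ∑ j ∈ Finset.range k, (-v) ^ j / (j.factorial : ℝ)| =
      |(-1) ^ k * (Real.exp (-v) - ∑ j ∈ Finset.range k, (-v) ^ j / (j.factorial : ℝ))| := by
    rw [abs_mul]; simp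
  rw [h5, abs_of_nonneg h1]
  linarith

/-- The Mills ratio of the standard normal distribution, as a Laplace transform. -/
noncomputable def mills (y : ℝ) : ℝ := ∫ t in Set.Ioi 0, Real.exp (-(y * t) - t ^ 2 / 2)

theorem integrable_mills_integrand (y : ℝ) :
    Integrable fun t : ℝ => Real.exp (-(y * t) - t ^ 2 / 2) := by
  have h := (integrable_npdf.comp_add_right y).const_mul (√(2 * Real.pi) * Real.exp (y ^ 2 / 2))
  refine h.congr (.of_forall fun t => ?_)
  have : √(2 * Real.pi) ≠ 0 := by positivity
  simp only [npdf_eq]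
  rw [show √(2 * Real.pi) * Real.exp (y ^ 2 / 2) * ((√(2 * Real.pi))⁻¹ *
    Real.exp (-(t + y) ^ 2 / 2)) = (√(2 * Real.pi) * (√(2 * Real.pi))⁻¹) *
    (Real.exp (y ^ 2 / 2) * Real.exp (-(t + y) ^ 2 / 2)) by ring,
    mul_inv_cancel₀ this, one_mul, ← Real.exp_add]
  congr 1; ring

theorem one_sub_ncdf_eq (y : ℝ) : 1 - ncdf y = npdf y * mills y := by
  have h1 := intervalIntegral.integral_Iic_add_Ioi (b := y) integrable_npdf.integrableOn
    integrable_npdf.integrableOn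
  rw [integral_gaussianPDFReal_eq_one 0 one_ne_zero, ← ncdf_eq_integral] at h1
  have h2 := (measurePreserving_add_left volume y).setIntegral_preimage_emb
    (Homeomorph.addLeft y).measurableEmbedding npdf (Set.Ioi y)
  have h3 : (fun x => y + x) ⁻¹' Set.Ioi y = Set.Ioi 0 := by ext; simp
  rw [h3] at h2
  rw [← h1, add_sub_cancel_left, ← h2, mills, ← integral_const_mul]
  refine integral_congr_ae (.of_forall fun t => ?_)
  simp only [npdf_eq]
  rw [mul_assoc, ← Real.exp_add]
  congr 2; ring

theorem mills_pos (y : ℝ) : 0 < mills y := by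
  have h := one_sub_ncdf_eq y
  rw [← ncdf_neg] at h
  have h1 := ncdf_pos (-y)
  rw [h] at h1
  exact pos_of_mul_pos_right h1 (npdf_pos y).le

theorem mills_le {y : ℝ} (hy : 0 ≤ y) : mills y ≤ mills 0 := by
  refine setIntegral_mono_on (integrable_mills_integrand y).integrableOn
    (integrable_mills_integrand 0).integrableOn measurableSet_Ioi fun t ht => ?_
  rw [Set.mem_Ioi] at ht
  gcongr

theorem integral_exp_neg_mul_mul_pow {y : ℝ} (hy : 0 < y) (k : ℕ) :
    IntegrableOn (fun t : ℝ => Real.exp (-(y * t)) * t ^ k) (Set.Ioi 0) ∧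
      ∫ t in Set.Ioi 0, Real.exp (-(y * t)) * t ^ k = k.factorial / y ^ (k + 1) := by
  have h := Real.integral_rpow_mul_exp_neg_mul_Ioi (a := k + 1) (r := y) (by positivity) hy
  have e : ∀ t : ℝ, t ^ ((k : ℝ) + 1 - 1) * Real.exp (-(y * t)) = Real.exp (-(y * t)) * t ^ k := by
    intro t; rw [add_sub_cancel_right, Real.rpow_natCast, mul_comm]
  simp_rw [e] at h
  rw [Real.Gamma_nat_eq_factorial, ← Nat.cast_succ, Real.rpow_natCast] at h
  have h' : ∫ t in Set.Ioi 0, Real.exp (-(y * t)) * t ^ k = k.factorial / y ^ (k + 1) := by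
    rw [h, div_pow, one_pow, div_mul_eq_mul_div, one_mul]
  refine ⟨?_, h'⟩
  -- The integral of a non-integrable function is `0` by convention, whereas the value just computed
  -- is positive.
  by_contra hn
  rw [integral_undef hn] at h'
  have : (0 : ℝ) < k.factorial / y ^ (k + 1) := by positivity
  linarith

/-- The coefficients of the asymptotic expansion of the Mills ratio. -/
noncomputable def millsCoeff (k : ℕ) : ℝ := (-1) ^ k * (2 * k).factorial / (2 ^ k * k.factorial)

theorem millsCoeff_ne_zero (k : ℕ) : millsCoeff k ≠ 0 := by
  rw [millsCoeff]; positivity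

/-- Expand `exp (-t²/2)` under the Laplace integral: the alternating remainder is bounded by the
next term, which integrates to the next term of the expansion. -/
theorem abs_mills_sub_sum_le {y : ℝ} (hy : 0 < y) (k : ℕ) :
    |mills y - ∑ j ∈ Finset.range k, millsCoeff j / y ^ (2 * j + 1)| ≤
      |millsCoeff k| / y ^ (2 * k + 1) := by
  have key : ∀ j, IntegrableOn (fun t : ℝ =>
      Real.exp (-(y * t)) * ((-(t ^ 2 / 2)) ^ j / j.factorial)) (Set.Ioi 0) ∧
      ∫ t in Set.Ioi 0, Real.exp (-(y * t)) * ((-(t ^ 2 / 2)) ^ j / j.factorial) =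
        millsCoeff j / y ^ (2 * j + 1) := by
    intro j
    obtain ⟨h1, h2⟩ := integral_exp_neg_mul_mul_pow hy (2 * j)
    have e : ∀ t : ℝ, Real.exp (-(y * t)) * ((-(t ^ 2 / 2)) ^ j / j.factorial) =
        (-1) ^ j / (2 ^ j * j.factorial) * (Real.exp (-(y * t)) * t ^ (2 * j)) := by
      intro t
      rw [neg_pow, div_pow, ← pow_mul]
      field_simp
    simp_rw [e]
    refine ⟨h1.const_mul _, ?_⟩
    rw [integral_const_mul, h2, millsCoeff]
    field_simp
  have hsum : ∑ j ∈ Finset.range k, millsCoeff j / y ^ (2 * j + 1) =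
      ∫ t in Set.Ioi 0, Real.exp (-(y * t)) *
        ∑ j ∈ Finset.range k, ((-(t ^ 2 / 2)) ^ j / j.factorial) := by
    simp_rw [Finset.mul_sum]
    rw [integral_finsetSum _ fun j _ => (key j).1]
    exact Finset.sum_congr rfl fun j _ => (key j).2.symm
  have hsi : IntegrableOn (fun t : ℝ => Real.exp (-(y * t)) *
        ∑ j ∈ Finset.range k, ((-(t ^ 2 / 2)) ^ j / j.factorial)) (Set.Ioi 0) := by
    simp_rw [Finset.mul_sum]
    exact integrable_finsetSum _ fun j _ => (key j).1
  rw [hsum, mills, ← integral_sub (integrable_mills_integrand y).integrableOn hsi]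
  have hk : ∫ t in Set.Ioi 0, Real.exp (-(y * t)) * ((t ^ 2 / 2) ^ k / k.factorial) =
      |millsCoeff k| / y ^ (2 * k + 1) := by
    have h1 : |millsCoeff k| = (-1) ^ k * millsCoeff k := by
      rw [millsCoeff, abs_div, abs_mul, abs_pow, abs_neg, abs_one, one_pow, one_mul, mul_div_assoc,
        ← mul_assoc, ← mul_pow]
      simp
    rw [h1, mul_div_assoc, ← (key k).2, ← integral_const_mul]
    refine integral_congr_ae (.of_forall fun t => ?_)
    simp only
    rw [neg_pow (t ^ 2 / 2) k]
    have h3 : ((-1 : ℝ) ^ k) * (-1) ^ k = 1 := by rw [← mul_pow]; simp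
    linear_combination (-Real.exp (-(y * t)) * (t ^ 2 / 2) ^ k / k.factorial) * h3
  rw [← hk]
  have hki : IntegrableOn (fun t : ℝ => Real.exp (-(y * t)) * ((t ^ 2 / 2) ^ k / k.factorial))
      (Set.Ioi 0) := by
    refine ((key k).1.norm).congr (.of_forall fun t => ?_)
    simp only
    rw [norm_mul, Real.norm_of_nonneg (Real.exp_pos _).le, norm_div, norm_pow, norm_neg,
      Real.norm_of_nonneg (by positivity : (0 : ℝ) ≤ t ^ 2 / 2),
      Real.norm_of_nonneg (by positivity : (0 : ℝ) ≤ k.factorial)]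
  rw [← Real.norm_eq_abs]
  refine (norm_integral_le_integral_norm _).trans (integral_mono_of_nonneg
    (.of_forall fun t => norm_nonneg _) hki (.of_forall fun t => ?_))
  simp only
  rw [sub_eq_add_neg (-(y * t)), Real.exp_add, ← mul_sub, norm_mul,
    Real.norm_of_nonneg (Real.exp_pos _).le]
  gcongr
  exact abs_exp_neg_sub_sum_le k (by positivity)

theorem tendsto_mills_atTop : Tendsto mills atTop (𝓝 0) := by
  have h : Tendsto (fun y : ℝ => |millsCoeff 0| / y) atTop (𝓝 0) :=
    tendsto_const_nhds.div_atTop tendsto_id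
  refine squeeze_zero' (.of_forall fun y => (mills_pos y).le) ?_ h
  filter_upwards [eventually_gt_atTop 0] with y hy
  simpa [abs_of_pos (mills_pos y)] using abs_mills_sub_sum_le hy 0

end MillsRatio

/-! ### Linear independence of Gaussian kernels times normal tails. -/

section LinearIndependence

/-- A combination of Mills ratios with different rates that decays faster than any power vanishes
identically: first for positive rates. -/
theorem coeff_eq_zero_of_rapid_decay_of_pos {ι : Type*} (S : Finset ι) (s c : ι → ℝ)
    (hs : ∀ i ∈ S, 0 < s i) (hinj : Set.InjOn s S)
    (h : ∀ N : ℕ, Tendsto (fun y : ℝ => y ^ N * ∑ i ∈ S, c i * mills (s i * y)) atTop (𝓝 0)) :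
    ∀ i ∈ S, c i = 0 := by
  classical
  -- Multiplying the expansion by `y ^ (2k+1)` isolates the moment of order `k`: lower orders vanish
  -- by induction and the remainder is of order `y⁻²`.
  have hmom : ∀ k : ℕ, ∑ i ∈ S, c i / s i ^ (2 * k + 1) = 0 := by
    intro k
    induction k using Nat.strong_induction_on with
    | _ k ih =>
      have hrem : Tendsto (fun y : ℝ => y ^ (2 * k + 1) * ∑ i ∈ S, c i * (mills (s i * y) -
          ∑ j ∈ Finset.range (k + 1), millsCoeff j / (s i * y) ^ (2 * j + 1))) atTop (𝓝 0) := by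
        simp_rw [Finset.mul_sum]
        rw [← Finset.sum_const_zero (s := S)]
        refine tendsto_finsetSum _ fun i hi => ?_
        have hsi := hs i hi
        have hb : Tendsto (fun y : ℝ =>
            (|c i| * |millsCoeff (k + 1)| / s i ^ (2 * k + 3)) / y ^ 2) atTop (𝓝 0) :=
          tendsto_const_nhds.div_atTop (tendsto_pow_atTop two_ne_zero)
        refine squeeze_zero_norm' ?_ hb
        filter_upwards [eventually_gt_atTop 0] with y hy
        have := abs_mills_sub_sum_le (mul_pos hsi hy) (k + 1)
        rw [norm_mul, norm_mul, Real.norm_of_nonneg (pow_pos hy _).le]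
        calc y ^ (2 * k + 1) * (‖c i‖ * ‖_‖)
            ≤ y ^ (2 * k + 1) * (‖c i‖ * (|millsCoeff (k + 1)| / (s i * y) ^ (2 * (k + 1) + 1))) := by
              gcongr; exact this
          _ = _ := by
            rw [Real.norm_eq_abs, mul_pow, show 2 * (k + 1) + 1 = 2 * k + 1 + 2 by ring,
              pow_add y (2 * k + 1) 2, show 2 * k + 3 = 2 * k + 1 + 2 by ring]
            have hy' := (pow_pos hy (2 * k + 1)).ne'
            generalize y ^ (2 * k + 1) = z at hy' ⊢
            field_simp
      have hsum : ∀ y : ℝ, 0 < y → y ^ (2 * k + 1) * ∑ i ∈ S, c i *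
          ∑ j ∈ Finset.range (k + 1), millsCoeff j / (s i * y) ^ (2 * j + 1) =
          millsCoeff k * ∑ i ∈ S, c i / s i ^ (2 * k + 1) := by
        intro y hy
        simp_rw [Finset.mul_sum]
        rw [Finset.sum_comm, Finset.sum_range_succ, Finset.sum_eq_zero, zero_add]
        · refine Finset.sum_congr rfl fun i hi => ?_
          rw [mul_pow]
          field_simp
        · intro j hj
          have hz := ih j (Finset.mem_range.1 hj)
          have : ∑ i ∈ S, y ^ (2 * k + 1) * (c i * (millsCoeff j / (s i * y) ^ (2 * j + 1))) =
              y ^ (2 * k + 1) * millsCoeff j / y ^ (2 * j + 1) *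
                ∑ i ∈ S, c i / s i ^ (2 * j + 1) := by
            rw [Finset.mul_sum]
            refine Finset.sum_congr rfl fun i hi => ?_
            rw [mul_pow]
            field_simp
          rw [this, hz, mul_zero]
      have hlim : Tendsto (fun _ : ℝ => millsCoeff k * ∑ i ∈ S, c i / s i ^ (2 * k + 1)) atTop
          (𝓝 0) := by
        have := (h (2 * k + 1)).sub hrem
        rw [sub_zero] at this
        refine this.congr' ?_
        filter_upwards [eventually_gt_atTop 0] with y hy
        rw [← hsum y hy, ← mul_sub, ← Finset.sum_sub_distrib]
        congr 1
        exact Finset.sum_congr rfl fun i _ => by ring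
      have := tendsto_nhds_unique hlim tendsto_const_nhds
      exact (mul_eq_zero.1 this.symm).resolve_left (millsCoeff_ne_zero k)
  intro i hi
  -- The vanishing moments say that the masses `c j / s j` at the distinct nodes `(s j)⁻²`
  -- annihilate every polynomial; the product over `j ≠ i` of `X - (s j)⁻²` then isolates `c i`.
  have hpoly : ∀ p : Polynomial ℝ, ∑ j ∈ S, c j / s j * p.eval ((s j ^ 2)⁻¹) = 0 := by
    intro p
    simp_rw [Polynomial.eval_eq_sum_range, Finset.mul_sum]
    rw [Finset.sum_comm]
    refine Finset.sum_eq_zero fun k _ => ?_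
    have : ∑ j ∈ S, c j / s j * (p.coeff k * (s j ^ 2)⁻¹ ^ k) =
        p.coeff k * ∑ j ∈ S, c j / s j ^ (2 * k + 1) := by
      rw [Finset.mul_sum]
      refine Finset.sum_congr rfl fun j hj => ?_
      have := (hs j hj).ne'
      rw [inv_pow, ← pow_mul, pow_succ]
      field_simp
    rw [this, hmom, mul_zero]
  have h1 := hpoly (∏ j ∈ S.erase i, (Polynomial.X - Polynomial.C ((s j ^ 2)⁻¹)))
  simp only [Polynomial.eval_prod, Polynomial.eval_sub, Polynomial.eval_X, Polynomial.eval_C] at h1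
  rw [Finset.sum_eq_single_of_mem i hi] at h1
  · have hne : ∏ j ∈ S.erase i, ((s i ^ 2)⁻¹ - (s j ^ 2)⁻¹) ≠ 0 := by
      refine Finset.prod_ne_zero_iff.2 fun j hj => ?_
      have hj' := Finset.mem_of_mem_erase hj
      intro he
      have : s i ^ 2 = s j ^ 2 := inv_injective (sub_eq_zero.1 he)
      have : s i = s j := (pow_left_inj₀ (hs i hi).le (hs j hj').le two_ne_zero).1 this
      exact Finset.ne_of_mem_erase hj (hinj hi hj' this).symm
    have := (mul_eq_zero.1 h1).resolve_right hne
    exact (div_eq_zero_iff.1 this).resolve_right (hs i hi).ne'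
  · intro j hj hji
    rw [Finset.prod_eq_zero (Finset.mem_erase.2 ⟨hji, hj⟩) (sub_self _), mul_zero]

/-- A zero rate contributes a constant while the other terms tend to `0`, so the case `N = 0`
removes it. -/
theorem coeff_eq_zero_of_rapid_decay {ι : Type*} (S : Finset ι) (s c : ι → ℝ)
    (hs : ∀ i ∈ S, 0 ≤ s i) (hinj : Set.InjOn s S)
    (h : ∀ N : ℕ, Tendsto (fun y : ℝ => y ^ N * ∑ i ∈ S, c i * mills (s i * y)) atTop (𝓝 0)) :
    ∀ i ∈ S, c i = 0 := by
  classical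
  have hzero : ∀ i ∈ S, s i = 0 → c i = 0 := by
    intro i hi hi0
    have h0 := h 0
    simp only [pow_zero, one_mul] at h0
    have h1 : Tendsto (fun y : ℝ => ∑ j ∈ S, c j * mills (s j * y)) atTop
        (𝓝 (∑ j ∈ S, if j = i then c i * mills 0 else 0)) := by
      refine tendsto_finsetSum _ fun j hj => ?_
      split_ifs with hji
      · subst hji
        simp only [hi0, zero_mul]
        exact tendsto_const_nhds
      · have hsj : 0 < s j := lt_of_le_of_ne (hs j hj) fun he => hji (hinj hj hi (by rw [hi0, ← he]))
        simpa using (tendsto_mills_atTop.comp (tendsto_id.const_mul_atTop hsj)).const_mul (c j)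
    have h2 := tendsto_nhds_unique h1 h0
    rw [Finset.sum_ite_eq' S i, if_pos hi] at h2
    exact (mul_eq_zero.1 h2).resolve_right (mills_pos 0).ne'
  intro i hi
  by_cases hi0 : s i = 0
  · exact hzero i hi hi0
  refine coeff_eq_zero_of_rapid_decay_of_pos (S.filter fun j => s j ≠ 0) s c
    (fun j hj => lt_of_le_of_ne (hs j (Finset.mem_filter.1 hj).1) (Finset.mem_filter.1 hj).2.symm)
    (hinj.mono (Finset.coe_subset.2 (Finset.filter_subset _ _))) (fun N => ?_) i
    (Finset.mem_filter.2 ⟨hi, hi0⟩)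
  refine (h N).congr fun y => ?_
  congr 1
  rw [Finset.sum_filter]
  refine Finset.sum_congr rfl fun j hj => ?_
  split_ifs with hj0
  · rfl
  · rw [hzero j hj (not_not.1 hj0), zero_mul]

/-- A Gaussian kernel times a normal tail. -/
noncomputable def gaussTail (t : ℝ × ℝ × ℝ) (x : ℝ) : ℝ :=
  Real.exp (-(t.2.1 * (x - t.1) ^ 2 / 2)) * (1 - ncdf (t.2.2 * (x - t.1)))

theorem gaussTail_eq (t : ℝ × ℝ × ℝ) (x : ℝ) :
    gaussTail t x = (√(2 * Real.pi))⁻¹ * Real.exp (-((t.2.1 + t.2.2 ^ 2) * (x - t.1) ^ 2 / 2)) *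
      mills (t.2.2 * (x - t.1)) := by
  rw [gaussTail, one_sub_ncdf_eq, npdf_eq, ← mul_assoc, mul_left_comm, ← Real.exp_add]
  congr 3; ring

/-- The exponent is eventually at most `-a * y`: the quadratic terms decide, or, if they cancel, the
linear term produced by the larger location `μ`. -/
theorem tendsto_pow_mul_exp_sub_quadratic {K K' μ μ' : ℝ} (hK : 0 < K)
    (h : K < K' ∨ K' = K ∧ μ' < μ) (N : ℕ) :
    Tendsto (fun y : ℝ => y ^ N * Real.exp (K * y ^ 2 / 2 - K' * (y + μ - μ') ^ 2 / 2)) atTop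
      (𝓝 0) := by
  obtain ⟨a, ha, hle⟩ : ∃ a : ℝ, 0 < a ∧ ∀ᶠ y : ℝ in atTop,
      K * y ^ 2 / 2 - K' * (y + μ - μ') ^ 2 / 2 ≤ -(a * y) := by
    obtain h | ⟨rfl, h⟩ := h
    · refine ⟨1, one_pos, ?_⟩
      filter_upwards [eventually_ge_atTop ((2 + 2 * K' * |μ - μ'|) / (K' - K)),
        eventually_gt_atTop 0] with y hy hy0
      rw [div_le_iff₀ (by linarith)] at hy
      have h1 : -|μ - μ'| ≤ μ - μ' := neg_abs_le _
      nlinarith [mul_le_mul_of_nonneg_right hy hy0.le, sq_nonneg (μ - μ'),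
        mul_nonneg (mul_nonneg (hK.trans h).le hy0.le) (by linarith : 0 ≤ μ - μ' + |μ - μ'|)]
    · refine ⟨K' * (μ - μ'), mul_pos hK (by linarith), ?_⟩
      filter_upwards [eventually_gt_atTop 0] with y hy
      nlinarith [mul_nonneg hK.le (sq_nonneg (μ - μ'))]
  have h1 := (Real.tendsto_pow_mul_exp_neg_atTop_nhds_zero N).comp
    (tendsto_id.const_mul_atTop ha)
  have h2 := h1.const_mul ((a ^ N)⁻¹)
  rw [mul_zero] at h2
  refine squeeze_zero' ?_ ?_ h2
  · filter_upwards [eventually_gt_atTop 0] with y hy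
    positivity
  · filter_upwards [hle, eventually_gt_atTop 0] with y hy hy0
    simp only [Function.comp, id]
    rw [mul_pow, ← mul_assoc, ← mul_assoc, inv_mul_cancel₀ (by positivity), one_mul]
    gcongr

/-- The functions `gaussTail` are linearly independent near `+∞`. -/
theorem gaussTail_linearIndependent (S : Finset (ℝ × ℝ × ℝ)) (c : ℝ × ℝ × ℝ → ℝ)
    (hS : ∀ t ∈ S, 0 < t.2.1 ∧ 0 ≤ t.2.2)
    (h : ∀ᶠ x in atTop, ∑ t ∈ S, c t * gaussTail t x = 0) : ∀ t ∈ S, c t = 0 := by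
  classical
  by_contra! hne
  set S' := S.filter fun t => c t ≠ 0 with hS'
  have hne' : S'.Nonempty := by
    obtain ⟨t, ht, htc⟩ := hne
    exact ⟨t, Finset.mem_filter.2 ⟨ht, htc⟩⟩
  -- The slowest Gaussian decay at `+∞`: least total precision and, among equals, largest location.
  -- Terms tied with it differ only in their rate `t.2.2`.
  obtain ⟨t₀, ht₀, hmin⟩ := Finset.exists_min_image S'
    (fun t => toLex (t.2.1 + t.2.2 ^ 2, -t.1)) hne'
  set K := t₀.2.1 + t₀.2.2 ^ 2 with hK
  set μ := t₀.1 with hμ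
  have hmem : ∀ t ∈ S', 0 < t.2.1 ∧ 0 ≤ t.2.2 := fun t ht => hS t (Finset.mem_filter.1 ht).1
  have hK0 : 0 < K := by have := (hmem t₀ ht₀).1; positivity
  set C := S'.filter fun t => t.2.1 + t.2.2 ^ 2 = K ∧ t.1 = μ with hC
  have hCrest : ∀ t ∈ S', ¬ (t.2.1 + t.2.2 ^ 2 = K ∧ t.1 = μ) →
      K < t.2.1 + t.2.2 ^ 2 ∨ t.2.1 + t.2.2 ^ 2 = K ∧ t.1 < μ := by
    intro t ht hn
    have h1 := hmin t ht
    rw [Prod.Lex.le_iff] at h1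
    simp only [ofLex_toLex] at h1
    obtain h1 | ⟨h1, h2⟩ := h1
    · exact .inl h1
    · refine .inr ⟨h1.symm, lt_of_le_of_ne (by linarith) fun he => hn ⟨h1.symm, he⟩⟩
  have hfinal := coeff_eq_zero_of_rapid_decay C (fun t => t.2.2) c
    (fun t ht => (hmem t (Finset.mem_filter.1 ht).1).2) ?_ ?_ t₀
    (Finset.mem_filter.2 ⟨ht₀, rfl, rfl⟩)
  · exact (Finset.mem_filter.1 ht₀).2 hfinal
  · intro t ht t' ht' he
    obtain ⟨-, h1, h2⟩ := Finset.mem_filter.1 (Finset.mem_coe.1 ht)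
    obtain ⟨-, h1', h2'⟩ := Finset.mem_filter.1 (Finset.mem_coe.1 ht')
    simp only at he
    ext
    · rw [h2, h2']
    · rw [he] at h1; linarith
    · exact he
  · intro N
    set R := S'.filter fun t => ¬ (t.2.1 + t.2.2 ^ 2 = K ∧ t.1 = μ) with hR
    -- Relative to the dominant Gaussian, the terms outside `C` decay faster than any power. The
    -- full sum being zero, the combination of Mills ratios over `C` decays just as fast.
    have hlim : Tendsto (fun y : ℝ => -∑ t ∈ R, c t * ((y ^ N * Real.exp (K * y ^ 2 / 2 -
        (t.2.1 + t.2.2 ^ 2) * (y + μ - t.1) ^ 2 / 2)) * mills (t.2.2 * (y + μ - t.1)))) atTop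
        (𝓝 0) := by
      suffices hs : Tendsto (fun y : ℝ => ∑ t ∈ R, c t * ((y ^ N * Real.exp (K * y ^ 2 / 2 -
          (t.2.1 + t.2.2 ^ 2) * (y + μ - t.1) ^ 2 / 2)) * mills (t.2.2 * (y + μ - t.1)))) atTop
          (𝓝 (∑ t ∈ R, 0)) by
        simpa using hs.neg
      refine tendsto_finsetSum _ fun t ht => ?_
      obtain ⟨ht1, ht2⟩ := Finset.mem_filter.1 ht
      have h1 := tendsto_pow_mul_exp_sub_quadratic hK0 (hCrest t ht1 ht2) N
      have h2 := (h1.mul_const (mills 0)).const_mul |c t|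
      rw [zero_mul, mul_zero] at h2
      refine squeeze_zero_norm' ?_ h2
      filter_upwards [eventually_ge_atTop 0, eventually_ge_atTop (t.1 - μ)] with y hy hy2
      rw [norm_mul, norm_mul, Real.norm_of_nonneg (mills_pos _).le, Real.norm_eq_abs,
        Real.norm_of_nonneg (by positivity)]
      gcongr
      exact mills_le (mul_nonneg (hmem t ht1).2 (by linarith))
    refine hlim.congr' ?_
    filter_upwards [(tendsto_atTop_add_const_right atTop μ tendsto_id).eventually h] with y hy
    simp only [id] at hy
    have h1 : ∑ t ∈ S, c t * gaussTail t (y + μ) = ∑ t ∈ S', c t * gaussTail t (y + μ) := by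
      rw [hS', Finset.sum_filter]
      refine Finset.sum_congr rfl fun t _ => ?_
      split_ifs with h
      · rfl
      · rw [not_not.1 h, zero_mul]
    rw [h1, ← Finset.sum_filter_add_sum_filter_not S'
      (fun t => t.2.1 + t.2.2 ^ 2 = K ∧ t.1 = μ), ← hC, ← hR] at hy
    set E := √(2 * Real.pi) * Real.exp (K * y ^ 2 / 2) with hE
    have hsq : √(2 * Real.pi) ≠ 0 := by positivity
    have hg : ∀ t : ℝ × ℝ × ℝ, E * gaussTail t (y + μ) = Real.exp (K * y ^ 2 / 2 -
        (t.2.1 + t.2.2 ^ 2) * (y + μ - t.1) ^ 2 / 2) * mills (t.2.2 * (y + μ - t.1)) := by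
      intro t
      rw [gaussTail_eq, hE, sub_eq_add_neg (K * y ^ 2 / 2), Real.exp_add]
      field_simp
    have hA : E * ∑ t ∈ C, c t * gaussTail t (y + μ) = ∑ t ∈ C, c t * mills (t.2.2 * y) := by
      rw [Finset.mul_sum]
      refine Finset.sum_congr rfl fun t ht => ?_
      obtain ⟨-, h1, h2⟩ := Finset.mem_filter.1 ht
      rw [mul_left_comm, hg, h1, h2, add_sub_cancel_right, sub_self, Real.exp_zero, one_mul]
    have hB : E * ∑ t ∈ R, c t * gaussTail t (y + μ) = ∑ t ∈ R, c t *
        (Real.exp (K * y ^ 2 / 2 - (t.2.1 + t.2.2 ^ 2) * (y + μ - t.1) ^ 2 / 2) *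
          mills (t.2.2 * (y + μ - t.1))) := by
      rw [Finset.mul_sum]
      exact Finset.sum_congr rfl fun t _ => by rw [mul_left_comm, hg]
    have h3 : E * ∑ t ∈ C, c t * gaussTail t (y + μ) = -(E * ∑ t ∈ R, c t * gaussTail t (y + μ)) := by
      linear_combination E * hy
    rw [← hA, h3, hB, mul_neg, Finset.mul_sum]
    congr 1
    exact Finset.sum_congr rfl fun t _ => by ring

end LinearIndependence

/-! ### Identifiability of skew normal mixtures among extended mixtures. -/

section Identifiability

theorem gaussTail_zero (μ κ x : ℝ) :
    gaussTail (μ, κ, 0) x = Real.exp (-(κ * (x - μ) ^ 2 / 2)) / 2 := by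
  simp only [gaussTail, zero_mul, ncdf_zero]; ring

theorem continuous_gaussTail (t : ℝ × ℝ × ℝ) : Continuous (gaussTail t) := by
  have : gaussTail t = fun x => Real.exp (-(t.2.1 * (x - t.1) ^ 2 / 2)) *
    (1 - ncdf (t.2.2 * (x - t.1))) := rfl
  rw [this]
  have := continuous_ncdf
  fun_prop

/-- The normalizing constant of a skew normal density with scale `b`. -/
noncomputable def snConst (b : ℝ) : ℝ := 2 / b * (√(2 * Real.pi))⁻¹

theorem snConst_pos {b : ℝ} (hb : 0 < b) : 0 < snConst b := by unfold snConst; positivity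

theorem skew_kernel_eq (a : ℝ) (b : ℝ) (x G : ℝ) :
    2 / b * npdf ((x - a) / b) * G =
      snConst b * (Real.exp (-(1 / b ^ 2 * (x - a) ^ 2 / 2)) * G) := by
  rw [npdf_eq, snConst]
  have : -((x - a) / b) ^ 2 / 2 = -(1 / b ^ 2 * (x - a) ^ 2 / 2) := by rw [div_pow]; ring
  rw [this]; ring

/-- The reflection `Φ(-t) = 1 - Φ(t)` makes all rates nonnegative. The rate `|l| / b` forgets the
sign of the shape; the sign of the second coefficient remembers it. -/
theorem snDensity_eq_gaussTail (a b l x : ℝ) :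
    snDensity a b l x = (if 0 ≤ l then 2 * snConst b else 0) * gaussTail (a, 1 / b ^ 2, 0) x +
      (if 0 ≤ l then -snConst b else snConst b) * gaussTail (a, 1 / b ^ 2, |l| / b) x := by
  rw [snDensity_eq, skew_kernel_eq, gaussTail_zero, gaussTail]
  have e : |l| / b * (x - a) = |l| * ((x - a) / b) := by ring
  simp only [e]
  split_ifs with h
  · rw [abs_of_nonneg h]; ring
  · rw [abs_of_neg (not_le.1 h), neg_mul, ncdf_neg]; ring

/-- To the right of its location, a component with infinite shape is a full Gaussian or zero. So
only nondegenerate components have a tail term, and that term determines the location, the scale and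
the shape. -/
theorem exists_gaussTail_expansion (p : EReal × EReal × EReal) :
    ∃ (A B : ℝ) (t : ℝ × ℝ × ℝ), (0 < t.2.1 ∧ 0 ≤ t.2.2) ∧
      (∀ᶠ x in atTop, snExt p.1 p.2.1 p.2.2 x =
        A * gaussTail (t.1, t.2.1, 0) x + B * gaussTail t x) ∧
      (B ≠ 0 → ∃ a b l : ℝ, 0 < b ∧ p = (↑a, ↑b, ↑l) ∧ t = (a, 1 / b ^ 2, |l| / b) ∧
        B = if 0 ≤ l then -snConst b else snConst b) := by
  obtain ⟨μ, σ, lam⟩ := p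
  obtain h | ⟨a, b, hb, rfl, rfl⟩ := snExt_eq_zero_or μ σ
  · exact ⟨0, 0, (0, 1, 0), by simp, by simp [h], by simp⟩
  have hb2 : (0 : ℝ) < 1 / b ^ 2 := by positivity
  induction lam with
  | coe l =>
    exact ⟨_, _, (a, 1 / b ^ 2, |l| / b), ⟨hb2, by positivity⟩, .of_forall fun x => by
      simp only [snExt_coe a hb]; exact snDensity_eq_gaussTail a b l x,
      fun _ => ⟨a, b, l, hb, rfl, rfl, rfl⟩⟩
  | top =>
    refine ⟨2 * snConst b, 0, (a, 1 / b ^ 2, 0), ⟨hb2, le_rfl⟩, ?_, by simp⟩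
    filter_upwards [eventually_gt_atTop a] with x hx
    have hz : (0 : ℝ) < (x - a) / b := div_pos (by linarith) hb
    rw [snExt_of_pos a hb, EReal.top_mul_coe_of_pos hz, ncdfE_top, skew_kernel_eq, gaussTail_zero]
    ring
  | bot =>
    refine ⟨0, 0, (a, 1 / b ^ 2, 0), ⟨hb2, le_rfl⟩, ?_, by simp⟩
    filter_upwards [eventually_gt_atTop a] with x hx
    have hz : (0 : ℝ) < (x - a) / b := div_pos (by linarith) hb
    rw [snExt_of_pos a hb, EReal.bot_mul_coe_of_pos hz, ncdfE_bot]
    ring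

/-- Linear independence for a family with repetitions: the coefficients of coinciding functions add
up. -/
theorem gaussTail_level_sum_eq_zero {ι : Type*} [Fintype ι] [DecidableEq (ℝ × ℝ × ℝ)]
    (a : ι → ℝ) (t : ι → ℝ × ℝ × ℝ)
    (ht : ∀ i, 0 < (t i).2.1 ∧ 0 ≤ (t i).2.2)
    (h : ∀ᶠ x in atTop, ∑ i, a i * gaussTail (t i) x = 0) (s : ℝ × ℝ × ℝ) :
    ∑ i with t i = s, a i = 0 := by
  by_cases hs : s ∈ Finset.univ.image t
  · refine gaussTail_linearIndependent (Finset.univ.image t) (fun s => ∑ i with t i = s, a i)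
      (fun u hu => ?_) ?_ s hs
    · obtain ⟨i, -, rfl⟩ := Finset.mem_image.1 hu
      exact ht i
    · filter_upwards [h] with x hx
      rw [← hx, ← Finset.sum_fiberwise_of_maps_to
        (fun i _ => Finset.mem_image_of_mem t (Finset.mem_univ i))]
      refine Finset.sum_congr rfl fun u _ => ?_
      rw [Finset.sum_mul]
      refine Finset.sum_congr rfl fun i hi => ?_
      rw [(Finset.mem_filter.1 hi).2]
  · refine Finset.sum_eq_zero fun i hi => absurd ?_ hs
    rw [← (Finset.mem_filter.1 hi).2]
    exact Finset.mem_image_of_mem t (Finset.mem_univ i)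

variable {m : ℕ}

/-- Parameters of mixtures, the component parameters being extended reals. -/
abbrev ExtParam (m : ℕ) : Type := Fin (m + 1) → ℝ × EReal × EReal × EReal

/-- The mixture with extended component parameters. -/
noncomputable def mixExt (θ : ExtParam m) (x : ℝ) : ℝ :=
  ∑ k, (θ k).1 * snExt (θ k).2.1 (θ k).2.2.1 (θ k).2.2.2 x

/-- A parameter vector as an extended one. -/
noncomputable def toExt (Ψ : Param m) : ExtParam m :=
  fun k => (weight Ψ k, (loc Ψ k : EReal), (scale Ψ k : EReal), (shape Ψ k : EReal))

theorem mixExt_toExt {Ψ : Param m} (hΨ : Ψ ∈ paramSpace m) (x : ℝ) :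
    mixExt (toExt Ψ) x = mixDensity Ψ x := by
  exact Finset.sum_congr rfl fun k _ => by rw [toExt, snExt_coe _ (hΨ k).2]

theorem continuous_mixDensity (Ψ : Param m) : Continuous (mixDensity Ψ) :=
  continuous_finsetSum _ fun _ _ => continuous_const.mul (continuous_snDensity _ _ _)

/-- Mixtures with nonzero shapes whose components differ in location, scale or absolute value of
the shape are identifiable among all mixtures with at most as many components. -/
theorem exists_perm_of_mixExt_ae_eq {Ψ₀ : Param m} (hΨ₀ : Ψ₀ ∈ paramSpace m)
    (hw : ∀ k, 0 < weight Ψ₀ k) (hshape : ∀ k, shape Ψ₀ k ≠ 0)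
    (hdist : ∀ k l, k ≠ l →
      (loc Ψ₀ k, scale Ψ₀ k, |shape Ψ₀ k|) ≠ (loc Ψ₀ l, scale Ψ₀ l, |shape Ψ₀ l|))
    {θ : ExtParam m} (hθ : ∀ k, 0 ≤ (θ k).1)
    (h : ∀ᵐ x, mixExt θ x = mixDensity Ψ₀ x) :
    ∃ τ : Equiv.Perm (Fin (m + 1)), ∀ k, θ (τ k) = toExt Ψ₀ k := by
  classical
  choose A B t ht hexp hB using fun l => exists_gaussTail_expansion (θ l).2
  set A₀ : Fin (m + 1) → ℝ := fun k => if 0 ≤ shape Ψ₀ k then 2 * snConst (scale Ψ₀ k) else 0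
  set B₀ : Fin (m + 1) → ℝ := fun k =>
    if 0 ≤ shape Ψ₀ k then -snConst (scale Ψ₀ k) else snConst (scale Ψ₀ k) with hB₀
  set t₀ : Fin (m + 1) → ℝ × ℝ × ℝ := fun k =>
    (loc Ψ₀ k, 1 / scale Ψ₀ k ^ 2, |shape Ψ₀ k| / scale Ψ₀ k) with ht₀
  have ht₀pos : ∀ k, 0 < (t₀ k).2.2 := fun k => div_pos (abs_pos.2 (hshape k)) (hΨ₀ k).2
  have ht₀inj : Function.Injective t₀ := by
    intro k l hkl
    by_contra hne
    refine hdist k l hne ?_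
    simp only [ht₀, Prod.mk.injEq] at hkl
    obtain ⟨h1, h2, h3⟩ := hkl
    have hk := (hΨ₀ k).2
    have hl := (hΨ₀ l).2
    have h4 : scale Ψ₀ k = scale Ψ₀ l := by
      have : scale Ψ₀ k ^ 2 = scale Ψ₀ l ^ 2 := by
        rw [one_div, one_div] at h2; exact inv_injective h2
      exact (pow_left_inj₀ hk.le hl.le two_ne_zero).1 this
    rw [h4, div_left_inj' hl.ne'] at h3
    rw [h1, h4, h3]
  have hmix : ∀ᶠ x in atTop, mixExt θ x =
      ∑ l, ((θ l).1 * A l * gaussTail ((t l).1, (t l).2.1, 0) x +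
        (θ l).1 * B l * gaussTail (t l) x) := by
    filter_upwards [eventually_all.2 hexp] with x hx
    refine Finset.sum_congr rfl fun l _ => ?_
    rw [hx l]; ring
  have hmix₀ : ∀ x, mixDensity Ψ₀ x = ∑ k, (weight Ψ₀ k * A₀ k *
      gaussTail ((t₀ k).1, (t₀ k).2.1, 0) x + weight Ψ₀ k * B₀ k * gaussTail (t₀ k) x) := by
    intro x
    refine Finset.sum_congr rfl fun _ _ => ?_
    rw [snDensity_eq_gaussTail]; ring
  have hev : ∀ᶠ x in atTop, (∑ l, ((θ l).1 * A l * gaussTail ((t l).1, (t l).2.1, 0) x +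
      (θ l).1 * B l * gaussTail (t l) x)) = mixDensity Ψ₀ x := by
    -- `mixExt θ` may jump, but beyond `M` its expansion is continuous, so equality almost
    -- everywhere becomes equality everywhere there.
    obtain ⟨M, hM⟩ := eventually_atTop.1 hmix
    have hae : (fun x => ∑ l, ((θ l).1 * A l * gaussTail ((t l).1, (t l).2.1, 0) x +
        (θ l).1 * B l * gaussTail (t l) x)) =ᵐ[volume.restrict (Set.Ioi M)] mixDensity Ψ₀ := by
      rw [EventuallyEq, ae_restrict_iff' measurableSet_Ioi]
      filter_upwards [h] with x hx hxM
      rw [← hM x (le_of_lt hxM), hx]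
    have hEq := Measure.eqOn_open_of_ae_eq hae isOpen_Ioi
      (continuous_finsetSum _ fun l _ => (continuous_const.mul (continuous_gaussTail _)).add
        (continuous_const.mul (continuous_gaussTail _))).continuousOn
      (continuous_mixDensity Ψ₀).continuousOn
    filter_upwards [eventually_gt_atTop M] with x hx using hEq hx
  -- At a positive rate only the tail terms are seen; the pure Gaussians all have rate `0`.
  have hlevel : ∀ s : ℝ × ℝ × ℝ, 0 < s.2.2 →
      ∑ l with t l = s, (θ l).1 * B l = ∑ k with t₀ k = s, weight Ψ₀ k * B₀ k := by
    intro s hs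
    have key := gaussTail_level_sum_eq_zero
      (ι := (Fin (m + 1) ⊕ Fin (m + 1)) ⊕ (Fin (m + 1) ⊕ Fin (m + 1)))
      (Sum.elim (Sum.elim (fun l => (θ l).1 * A l) (fun l => (θ l).1 * B l))
        (Sum.elim (fun k => -(weight Ψ₀ k * A₀ k)) (fun k => -(weight Ψ₀ k * B₀ k))))
      (Sum.elim (Sum.elim (fun l => ((t l).1, (t l).2.1, 0)) t)
        (Sum.elim (fun k => ((t₀ k).1, (t₀ k).2.1, 0)) t₀)) ?_ ?_ s
    · rw [Finset.sum_filter] at key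
      simp only [Fintype.sum_sum_type, Sum.elim_inl, Sum.elim_inr] at key
      have hz : ∀ u : ℝ × ℝ × ℝ, ((u.1, u.2.1, 0) : ℝ × ℝ × ℝ) ≠ s := fun u hu => by
        rw [← hu] at hs; exact lt_irrefl _ hs
      simp only [hz, if_false, Finset.sum_const_zero, zero_add] at key
      have key' : (∑ l, if t l = s then (θ l).1 * B l else 0) +
          ∑ k, (if t₀ k = s then -(weight Ψ₀ k * B₀ k) else 0) = 0 := by
        convert key using 4 <;> congr
      rw [← Finset.sum_filter, ← Finset.sum_filter, Finset.sum_neg_distrib] at key'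
      linarith
    · have hκ : ∀ k, 0 < (t₀ k).2.1 := fun k => by have := (hΨ₀ k).2; simp only [ht₀]; positivity
      rintro ((l | l) | (k | k))
      · exact ⟨(ht l).1, le_rfl⟩
      · exact ht l
      · exact ⟨hκ k, le_rfl⟩
      · exact ⟨hκ k, (ht₀pos k).le⟩
    · filter_upwards [hev] with x hx
      rw [hmix₀] at hx
      simp only [Fintype.sum_sum_type, Sum.elim_inl, Sum.elim_inr]
      simp only [Finset.sum_add_distrib] at hx
      simp only [neg_mul, Finset.sum_neg_distrib]
      linarith
  have hk : ∀ k, ∑ l with t l = t₀ k, (θ l).1 * B l = weight Ψ₀ k * B₀ k := by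
    intro k
    rw [hlevel _ (ht₀pos k), Finset.sum_eq_single_of_mem k (by simp)]
    intro l hl hlk
    exact absurd (ht₀inj (Finset.mem_filter.1 hl).2) hlk
  have hB₀ne : ∀ k, B₀ k ≠ 0 := by
    intro k
    have := snConst_pos (hΨ₀ k).2
    simp only [hB₀]
    split_ifs <;> linarith
  have hex : ∀ k, ∃ l, t l = t₀ k := by
    intro k
    have : ∑ l with t l = t₀ k, (θ l).1 * B l ≠ 0 := by
      rw [hk]; exact mul_ne_zero (hw k).ne' (hB₀ne k)
    obtain ⟨l, hl, -⟩ := Finset.exists_ne_zero_of_sum_ne_zero this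
    exact ⟨l, (Finset.mem_filter.1 hl).2⟩
  choose f hf using hex
  -- Each true component is matched by a different fitted one, and both mixtures have `m + 1`
  -- components, so none is left over and each level holds a single fitted component.
  have hfinj : Function.Injective f := fun k l hkl => ht₀inj (by rw [← hf, ← hf, hkl])
  have hfbij : Function.Bijective f := Finite.injective_iff_bijective.1 hfinj
  refine ⟨Equiv.ofBijective f hfbij, fun k => ?_⟩
  simp only [Equiv.ofBijective_apply]
  have h1 : (θ (f k)).1 * B (f k) = weight Ψ₀ k * B₀ k := by
    rw [← hk k, Finset.sum_eq_single_of_mem (f k) (by simp [hf])]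
    intro l hl hlk
    obtain ⟨k', rfl⟩ := hfbij.2 l
    have := (Finset.mem_filter.1 hl).2
    rw [hf] at this
    exact absurd (by rw [ht₀inj this]) hlk
  have hBne : B (f k) ≠ 0 := fun h0 => by
    rw [h0, mul_zero] at h1
    exact mul_ne_zero (hw k).ne' (hB₀ne k) h1.symm
  obtain ⟨a, b, l, hb, hp, htl, hBl⟩ := hB (f k) hBne
  have h2 := hf k
  rw [htl] at h2
  simp only [ht₀, Prod.mk.injEq] at h2
  obtain ⟨h3, h4, h5⟩ := h2
  have hs := (hΨ₀ k).2
  have h6 : b = scale Ψ₀ k := by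
    have : b ^ 2 = scale Ψ₀ k ^ 2 := by
      rw [one_div, one_div] at h4; exact inv_injective h4
    exact (pow_left_inj₀ hb.le hs.le two_ne_zero).1 this
  subst h6
  rw [div_left_inj' hb.ne'] at h5
  have hc := snConst_pos hb
  have hθk := hθ (f k)
  have hwk := hw k
  rw [hBl] at h1
  simp only [hB₀] at h1
  -- Shapes of opposite signs would give coefficients of opposite signs, which nonnegative weights
  -- forbid.
  have h7 : (θ (f k)).1 = weight Ψ₀ k ∧ l = shape Ψ₀ k := by
    split_ifs at h1 with c1 c2 c2
    · rw [abs_of_nonneg c1, abs_of_nonneg c2] at h5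
      exact ⟨mul_right_cancel₀ (neg_ne_zero.2 hc.ne') h1, h5⟩
    · nlinarith [mul_nonneg hθk hc.le, mul_pos hwk hc]
    · nlinarith [mul_nonneg hθk hc.le, mul_pos hwk hc]
    · rw [abs_of_neg (not_le.1 c1), abs_of_neg (not_le.1 c2), neg_inj] at h5
      exact ⟨mul_right_cancel₀ hc.ne' h1, h5⟩
  simp only [toExt]
  rw [← h7.1, ← h7.2, ← h3, ← hp]

end Identifiability

/-! ### Numbers of observations in short intervals and spacings of the sample. -/

section Counting

variable {Ω : Type*} [MeasurableSpace Ω] {P : Measure Ω} [IsProbabilityMeasure P]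
  {Q : Measure ℝ} {X : ℕ → Ω → ℝ}

/-- The first Borel-Cantelli lemma, after a shift past the indices where the bound is not available.
-/
theorem ae_eventually_not_of_summable {p : ℕ → Ω → Prop} {b : ℕ → ℝ} (hb : Summable b)
    (h : ∀ᶠ n in atTop, P.real {ω | p n ω} ≤ b n) : ∀ᵐ ω ∂P, ∀ᶠ n in atTop, ¬ p n ω := by
  obtain ⟨N, hN⟩ := eventually_atTop.1 h
  have hs : ∑' n, P {ω | p (n + N) ω} ≠ ⊤ := by
    have hb' : Summable fun n => b (n + N) := (summable_nat_add_iff N).2 hb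
    have h0 : ∀ n, 0 ≤ b (n + N) := fun n => measureReal_nonneg.trans (hN (n + N) (by omega))
    refine ne_top_of_le_ne_top (ENNReal.ofReal_ne_top (r := ∑' n, b (n + N))) ?_
    rw [ENNReal.ofReal_tsum_of_nonneg h0 hb']
    refine ENNReal.tsum_le_tsum fun n => ?_
    rw [← ofReal_measureReal]
    exact ENNReal.ofReal_le_ofReal (hN _ (by omega))
  filter_upwards [ae_eventually_notMem hs] with ω hω
  obtain ⟨K, hK⟩ := eventually_atTop.1 hω
  refine eventually_atTop.2 ⟨K + N, fun n hn => ?_⟩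
  have := hK (n - N) (by omega)
  rwa [Nat.sub_add_cancel (by omega)] at this

/-- Hoeffding's inequality: the centred indicators are sub-Gaussian with parameter `1/4`. -/
theorem measureReal_count_ge_le (hindep : iIndepFun X P) (hlaw : ∀ i, HasLaw (X i) Q P)
    {S : Set ℝ} (hS : MeasurableSet S) (n : ℕ) {t : ℝ} (ht : 0 ≤ t) :
    P.real {ω | (Q.real S + t) * n ≤ ∑ i ∈ Finset.range n, S.indicator 1 (X i ω)} ≤
      Real.exp (-2 * t ^ 2 * n) := by
  have hm : Measurable (S.indicator (1 : ℝ → ℝ)) := measurable_one.indicator hS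
  have hQ : IsProbabilityMeasure Q := (hlaw 0).isProbabilityMeasure_iff.1 inferInstance
  have hmean : ∀ i, ∫ ω, S.indicator (1 : ℝ → ℝ) (X i ω) ∂P = Q.real S := by
    intro i
    rw [← integral_indicator_one hS, ← (hlaw i).map_eq,
      integral_map (hlaw i).aemeasurable hm.aestronglyMeasurable]
  have hsub : ∀ i < n, HasSubgaussianMGF (fun ω => S.indicator (1 : ℝ → ℝ) (X i ω) - Q.real S)
      ((‖(1 : ℝ) - 0‖₊ / 2) ^ 2) P := by
    intro i _
    rw [← hmean i]
    refine hasSubgaussianMGF_of_mem_Icc (hm.comp_aemeasurable (hlaw i).aemeasurable)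
      (.of_forall fun ω => ?_)
    by_cases h : X i ω ∈ S <;> simp [h]
  have hind : iIndepFun (fun i ω => S.indicator (1 : ℝ → ℝ) (X i ω) - Q.real S) P :=
    hindep.comp (fun _ x => S.indicator (1 : ℝ → ℝ) x - Q.real S) fun _ => hm.sub_const _
  have := HasSubgaussianMGF.measure_sum_range_ge_le_of_iIndepFun hind hsub
    (ε := t * n) (by positivity)
  refine le_trans (le_of_eq ?_) (this.trans (le_of_eq ?_))
  · congr 1
    ext ω
    simp only [Set.mem_ofPred_eq, Finset.sum_sub_distrib, Finset.sum_const, Finset.card_range,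
      nsmul_eq_mul]
    constructor <;> intro h <;> nlinarith
  · congr 1
    rcases Nat.eq_zero_or_pos n with rfl | hn
    · simp
    · have : (n : ℝ) ≠ 0 := by positivity
      simp
      field_simp

/-- The mesh `n ^ (-1/4)`. -/
noncomputable def mesh (n : ℕ) : ℝ := (√√(n : ℝ))⁻¹

theorem mesh_pos {n : ℕ} (hn : 0 < n) : 0 < mesh n := by
  unfold mesh; positivity

theorem mesh_sq_mul (n : ℕ) : mesh n ^ 2 * n = √(n : ℝ) := by
  rw [mesh, inv_pow, Real.sq_sqrt (Real.sqrt_nonneg _)]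
  rcases Nat.eq_zero_or_pos n with rfl | hn
  · simp
  · have h : (0 : ℝ) < √(n : ℝ) := by positivity
    have := Real.mul_self_sqrt (Nat.cast_nonneg (α := ℝ) n)
    field_simp
    linarith

theorem exp_neg_sqrt_le {n : ℕ} (hn : 0 < n) : Real.exp (-√(n : ℝ)) ≤ 40320 / (n : ℝ) ^ 4 := by
  -- One term of the exponential series; the eighth power of `√n` is `n ^ 4`, and `8! = 40320`.
  have h := Real.pow_div_factorial_le_exp (x := √(n : ℝ)) (Real.sqrt_nonneg _) 8
  have h8 : √(n : ℝ) ^ 8 = (n : ℝ) ^ 4 := by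
    rw [show 8 = 2 * 4 by norm_num, pow_mul, Real.sq_sqrt (Nat.cast_nonneg n)]
  rw [h8] at h
  have hn' : (0 : ℝ) < n := by exact_mod_cast hn
  rw [Real.exp_neg, inv_le_comm₀ (Real.exp_pos _) (by positivity), inv_div]
  simpa [Nat.factorial] using h

/-- A cell has mass at most `M * mesh n`. Since `mesh n ^ 2 * n = √n`, a count of twice that order
has probability at most `exp (-√n) ≤ 40320 / n ^ 4`; the at most `3 * n ^ 2` cells give the summable
bound `120960 / n ^ 2`. -/
theorem ae_eventually_grid_count_le (hindep : iIndepFun X P) (hlaw : ∀ i, HasLaw (X i) Q P)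
    {M : ℝ} (hM : 1 ≤ M) (hQ : ∀ a b, a ≤ b → Q.real (Set.Icc a b) ≤ M * (b - a)) :
    ∀ᵐ ω ∂P, ∀ᶠ n : ℕ in atTop, ∀ k : ℤ, |k| ≤ (n : ℤ) ^ 2 →
      ∑ i ∈ Finset.range n, (Set.Icc (k * mesh n) ((k + 1) * mesh n)).indicator 1 (X i ω) ≤
        2 * M * mesh n * n := by
  set J : ℕ → ℤ → Set ℝ := fun n k => Set.Icc (k * mesh n) ((k + 1) * mesh n) with hJ
  have hsum : Summable fun n : ℕ => 120960 * (1 / (n : ℝ) ^ 2) :=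
    (Real.summable_one_div_nat_pow.2 one_lt_two).mul_left _
  have := ae_eventually_not_of_summable (P := P)
    (p := fun n ω => ∃ k ∈ Finset.Icc (-((n : ℤ) ^ 2)) ((n : ℤ) ^ 2),
      2 * M * mesh n * n ≤ ∑ i ∈ Finset.range n, (J n k).indicator 1 (X i ω)) hsum ?_
  · filter_upwards [this] with ω hω
    filter_upwards [hω] with n hn k hk
    push Not at hn
    exact (hn k (Finset.mem_Icc.2 (abs_le.1 hk))).le
  · filter_upwards [eventually_gt_atTop 0] with n hn
    have hn1 : (1 : ℝ) ≤ n := by exact_mod_cast hn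
    have hset : {ω | ∃ k ∈ Finset.Icc (-((n : ℤ) ^ 2)) ((n : ℤ) ^ 2),
      2 * M * mesh n * n ≤ ∑ i ∈ Finset.range n, (J n k).indicator 1 (X i ω)} =
      ⋃ k ∈ Finset.Icc (-((n : ℤ) ^ 2)) ((n : ℤ) ^ 2),
      {ω | 2 * M * mesh n * n ≤ ∑ i ∈ Finset.range n, (J n k).indicator 1 (X i ω)} := by
      ext ω; simp
    rw [hset]
    refine (measureReal_biUnion_finset_le _ _).trans ?_
    have hone : ∀ k ∈ Finset.Icc (-((n : ℤ) ^ 2)) ((n : ℤ) ^ 2),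
        P.real {ω | 2 * M * mesh n * n ≤ ∑ i ∈ Finset.range n, (J n k).indicator 1 (X i ω)} ≤
        40320 / (n : ℝ) ^ 4 := by
      intro k _
      have hh := mesh_pos hn
      have hQk : Q.real (J n k) ≤ M * mesh n := by
        refine (hQ _ _ (by nlinarith)).trans (le_of_eq (by ring))
      have h1 := measureReal_count_ge_le hindep hlaw (measurableSet_Icc : MeasurableSet (J n k)) n
        (t := M * mesh n) (by positivity)
      refine (measureReal_mono ?_).trans (h1.trans ((Real.exp_le_exp.2 ?_).trans
        (exp_neg_sqrt_le hn)))
      · intro ω hω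
        simp only [Set.mem_ofPred_eq] at hω ⊢
        refine le_trans ?_ hω
        nlinarith
      · have h2 := mesh_sq_mul n
        have h3 := Real.sqrt_nonneg (n : ℝ)
        have h4 : -2 * (M * mesh n) ^ 2 * n = -2 * M ^ 2 * √(n : ℝ) := by rw [← h2]; ring
        rw [h4]
        nlinarith [mul_nonneg h3 (by nlinarith : 0 ≤ 2 * M ^ 2 - 1)]
    refine (Finset.sum_le_sum hone).trans ?_
    rw [Finset.sum_const, Int.card_Icc, nsmul_eq_mul]
    have hcard : (((n : ℤ) ^ 2 + 1 - -((n : ℤ) ^ 2)).toNat : ℝ) ≤ 3 * (n : ℝ) ^ 2 := by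
      have h5 : ((n : ℤ) ^ 2 + 1 - -((n : ℤ) ^ 2)).toNat = 2 * n ^ 2 + 1 := by
        have : (n : ℤ) ^ 2 + 1 - -((n : ℤ) ^ 2) = ((2 * n ^ 2 + 1 : ℕ) : ℤ) := by push_cast; ring
        rw [this, Int.toNat_natCast]
      rw [h5]; push_cast; nlinarith
    calc _ ≤ 3 * (n : ℝ) ^ 2 * (40320 / (n : ℝ) ^ 4) := by gcongr
      _ = _ := by field_simp; norm_num

/-- A window of length `ℓ` meets at most `ℓ / mesh n + 2` cells, and this holds for all windows at
once. The cells that contain observations have indices of size at most `n ^ 2`: the bound `√√n ≤ n /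
2` leaves room for the rounding. -/
theorem card_window_le {x : ℕ → ℝ} {n : ℕ} (hn : 4 ≤ n) {M : ℝ} (hM : 1 ≤ M)
    (hgrid : ∀ k : ℤ, |k| ≤ (n : ℤ) ^ 2 →
      ∑ i ∈ Finset.range n, (Set.Icc (k * mesh n) ((k + 1) * mesh n)).indicator 1 (x i) ≤
        2 * M * mesh n * n) (habs : ∀ i < n, |x i| ≤ n) {a ℓ : ℝ} (hℓ : 0 ≤ ℓ) :
    (((Finset.range n).filter fun i => x i ∈ Set.Icc a (a + ℓ)).card : ℝ) ≤
      2 * M * n * (ℓ + 2 * mesh n) := by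
  classical
  have hn4 : (4 : ℝ) ≤ n := by exact_mod_cast hn
  have hh := mesh_pos (by omega : 0 < n)
  set W := (Finset.range n).filter fun i => x i ∈ Set.Icc a (a + ℓ) with hW
  set T := Finset.Icc ⌊a / mesh n⌋ ⌊(a + ℓ) / mesh n⌋ with hT
  have hmaps : ∀ i ∈ W, ⌊x i / mesh n⌋ ∈ T := by
    intro i hi
    obtain ⟨-, h1, h2⟩ := Finset.mem_filter.1 hi
    exact Finset.mem_Icc.2 ⟨Int.floor_mono (by gcongr), Int.floor_mono (by gcongr)⟩
  have hsqrt : √√(n : ℝ) ≤ n / 2 := by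
    rw [Real.sqrt_le_left (by positivity), Real.sqrt_le_left (by positivity)]
    nlinarith [mul_nonneg (sq_nonneg ((n : ℝ) ^ 2)) (sub_nonneg.2 hn4),
      mul_nonneg (sq_nonneg (n : ℝ)) (sub_nonneg.2 hn4), sq_nonneg ((n : ℝ) ^ 2 - 16)]
  have hfib : ∀ k ∈ T, ((W.filter fun i => ⌊x i / mesh n⌋ = k).card : ℝ) ≤ 2 * M * mesh n * n := by
    intro k _
    by_cases hne : (W.filter fun i => ⌊x i / mesh n⌋ = k).Nonempty
    · obtain ⟨i, hi⟩ := hne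
      obtain ⟨hi1, hi2⟩ := Finset.mem_filter.1 hi
      have hin := Finset.mem_range.1 (Finset.mem_filter.1 hi1).1
      have hk : |k| ≤ (n : ℤ) ^ 2 := by
        have h1 := habs i hin
        have h2 : |x i / mesh n| ≤ (n : ℝ) * (n / 2) := by
          rw [mesh, div_inv_eq_mul, abs_mul, abs_of_nonneg (Real.sqrt_nonneg _)]
          gcongr
        have h3 := Int.floor_le (x i / mesh n)
        have h4 := Int.lt_floor_add_one (x i / mesh n)
        rw [hi2] at h3 h4
        rw [abs_le] at h2
        have h5 : (k : ℝ) ≤ (n : ℝ) ^ 2 := by nlinarith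
        have h6 : -(n : ℝ) ^ 2 ≤ k := by nlinarith
        rw [abs_le]
        exact ⟨by exact_mod_cast h6, by exact_mod_cast h5⟩
      refine le_trans ?_ (hgrid k hk)
      rw [Finset.card_eq_sum_ones]
      push_cast
      rw [← Finset.sum_filter_add_sum_filter_not (Finset.range n)
        (fun i => x i ∈ Set.Icc (k * mesh n) ((k + 1) * mesh n))]
      have h0 : 0 ≤ ∑ i ∈ (Finset.range n).filter
          (fun i => ¬ x i ∈ Set.Icc (k * mesh n) ((k + 1) * mesh n)),
          (Set.Icc (k * mesh n) ((k + 1) * mesh n)).indicator (1 : ℝ → ℝ) (x i) :=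
        Finset.sum_nonneg fun i _ => Set.indicator_nonneg (fun _ _ => zero_le_one) _
      refine le_trans ?_ (le_add_of_nonneg_right h0)
      have h1 : ∑ i ∈ (Finset.range n).filter
          (fun i => x i ∈ Set.Icc (k * mesh n) ((k + 1) * mesh n)),
          (Set.Icc (k * mesh n) ((k + 1) * mesh n)).indicator (1 : ℝ → ℝ) (x i) =
          ∑ i ∈ (Finset.range n).filter
          (fun i => x i ∈ Set.Icc (k * mesh n) ((k + 1) * mesh n)), (1 : ℝ) :=
        Finset.sum_congr rfl fun i hi => by
          rw [Set.indicator_of_mem (Finset.mem_filter.1 hi).2]; rfl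
      rw [h1]
      refine Finset.sum_le_sum_of_subset_of_nonneg (fun i hi => ?_) fun _ _ _ => zero_le_one
      obtain ⟨hi1, hi2⟩ := Finset.mem_filter.1 hi
      refine Finset.mem_filter.2 ⟨(Finset.mem_filter.1 hi1).1, ?_⟩
      have h3 := Int.floor_le (x i / mesh n)
      have h4 := Int.lt_floor_add_one (x i / mesh n)
      rw [hi2] at h3 h4
      rw [le_div_iff₀ hh] at h3
      rw [div_lt_iff₀ hh] at h4
      exact ⟨h3, h4.le⟩
    · rw [Finset.not_nonempty_iff_eq_empty.1 hne]
      simp only [Finset.card_empty, Nat.cast_zero]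
      positivity
  have hcard : (W.card : ℝ) = ∑ k ∈ T, ((W.filter fun i => ⌊x i / mesh n⌋ = k).card : ℝ) := by
    exact_mod_cast Finset.card_eq_sum_card_fiberwise hmaps
  rw [hcard]
  refine (Finset.sum_le_sum hfib).trans ?_
  rw [Finset.sum_const, nsmul_eq_mul, hT, Int.card_Icc]
  have hTc : ((⌊(a + ℓ) / mesh n⌋ + 1 - ⌊a / mesh n⌋).toNat : ℝ) ≤ ℓ / mesh n + 2 := by
    have h1 : ⌊a / mesh n⌋ ≤ ⌊(a + ℓ) / mesh n⌋ := Int.floor_mono (by gcongr; linarith)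
    have h2 : ((⌊(a + ℓ) / mesh n⌋ + 1 - ⌊a / mesh n⌋).toNat : ℝ) =
        ((⌊(a + ℓ) / mesh n⌋ + 1 - ⌊a / mesh n⌋ : ℤ) : ℝ) := by
      exact_mod_cast Int.toNat_of_nonneg (by omega)
    rw [h2]
    push_cast
    have h3 := Int.floor_le ((a + ℓ) / mesh n)
    have h4 := Int.lt_floor_add_one (a / mesh n)
    rw [add_div] at h3
    rw [add_div]
    linarith
  calc _ ≤ (ℓ / mesh n + 2) * (2 * M * mesh n * n) := by gcongr
    _ = _ := by field_simp

/-- Two independent observations lie within `δ` with probability at most `2 * M * δ`; with `δ = 1 /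
n ^ 4` and at most `n ^ 2` pairs the total is summable. -/
theorem ae_eventually_spacing (hindep : iIndepFun X P) (hlaw : ∀ i, HasLaw (X i) Q P)
    {M : ℝ} (hM : 1 ≤ M) (hQ : ∀ a b, a ≤ b → Q.real (Set.Icc a b) ≤ M * (b - a)) :
    ∀ᵐ ω ∂P, ∀ᶠ n : ℕ in atTop, ∀ i < n, ∀ j < n, i ≠ j → 1 / (n : ℝ) ^ 4 < |X i ω - X j ω| := by
  have hQp : IsProbabilityMeasure Q := (hlaw 0).isProbabilityMeasure_iff.1 inferInstance
  have hpair : ∀ i j, i ≠ j → ∀ δ : ℝ, 0 ≤ δ → P.real {ω | |X i ω - X j ω| ≤ δ} ≤ 2 * M * δ := by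
    intro i j hij δ hδ
    have hmap := (indepFun_iff_map_prod_eq_prod_map_map (hlaw i).aemeasurable
      (hlaw j).aemeasurable).1 (hindep.indepFun hij)
    rw [(hlaw i).map_eq, (hlaw j).map_eq] at hmap
    have hS : MeasurableSet {p : ℝ × ℝ | |p.1 - p.2| ≤ δ} :=
      measurableSet_le (by fun_prop) measurable_const
    have h1 : P {ω | |X i ω - X j ω| ≤ δ} = (Q.prod Q) {p : ℝ × ℝ | |p.1 - p.2| ≤ δ} := by
      rw [← hmap, Measure.map_apply_of_aemeasurable
        ((hlaw i).aemeasurable.prodMk (hlaw j).aemeasurable) hS]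
      rfl
    rw [Measure.real, h1, Measure.prod_apply hS]
    refine ENNReal.toReal_le_of_le_ofReal (by positivity) ?_
    calc ∫⁻ x, Q (Prod.mk x ⁻¹' {p : ℝ × ℝ | |p.1 - p.2| ≤ δ}) ∂Q
        ≤ ∫⁻ _, ENNReal.ofReal (2 * M * δ) ∂Q := by
          refine lintegral_mono fun x => ?_
          have : Prod.mk x ⁻¹' {p : ℝ × ℝ | |p.1 - p.2| ≤ δ} = Set.Icc (x - δ) (x + δ) := by
            ext y
            simp only [Set.mem_preimage, Set.mem_ofPred_eq, Set.mem_Icc, abs_le]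
            constructor <;> rintro ⟨h1, h2⟩ <;> constructor <;> linarith
          rw [this, ← ofReal_measureReal]
          refine ENNReal.ofReal_le_ofReal ((hQ _ _ (by linarith)).trans (le_of_eq (by ring)))
      _ = ENNReal.ofReal (2 * M * δ) := by simp
  have hsum : Summable fun n : ℕ => 2 * M * (1 / (n : ℝ) ^ 2) :=
    (Real.summable_one_div_nat_pow.2 one_lt_two).mul_left _
  have := ae_eventually_not_of_summable (P := P)
    (p := fun n ω => ∃ q ∈ (Finset.range n ×ˢ Finset.range n).filter (fun q => q.1 ≠ q.2),
      |X q.1 ω - X q.2 ω| ≤ 1 / (n : ℝ) ^ 4) hsum ?_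
  · filter_upwards [this] with ω hω
    filter_upwards [hω] with n hn i hi j hj hij
    push Not at hn
    exact hn (i, j) (Finset.mem_filter.2
      ⟨Finset.mem_product.2 ⟨Finset.mem_range.2 hi, Finset.mem_range.2 hj⟩, hij⟩)
  · filter_upwards [eventually_gt_atTop 0] with n hn
    have hn' : (0 : ℝ) < n := by exact_mod_cast hn
    have hset : {ω | ∃ q ∈ (Finset.range n ×ˢ Finset.range n).filter (fun q => q.1 ≠ q.2),
      |X q.1 ω - X q.2 ω| ≤ 1 / (n : ℝ) ^ 4} =
      ⋃ q ∈ (Finset.range n ×ˢ Finset.range n).filter (fun q => q.1 ≠ q.2),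
      {ω | |X q.1 ω - X q.2 ω| ≤ 1 / (n : ℝ) ^ 4} := by
      ext ω
      simp only [Set.mem_ofPred_eq, Set.mem_iUnion, exists_prop]
    rw [hset]
    refine (measureReal_biUnion_finset_le _ _).trans ((Finset.sum_le_sum fun q hq =>
      hpair q.1 q.2 (Finset.mem_filter.1 hq).2 (1 / (n : ℝ) ^ 4) (by positivity)).trans ?_)
    rw [Finset.sum_const, nsmul_eq_mul]
    have hcard : (((Finset.range n ×ˢ Finset.range n).filter (fun q => q.1 ≠ q.2)).card : ℝ) ≤
        (n : ℝ) ^ 2 := by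
      have := Finset.card_filter_le (Finset.range n ×ˢ Finset.range n) (fun q => q.1 ≠ q.2)
      rw [Finset.card_product, Finset.card_range, ← sq] at this
      exact_mod_cast this
    calc _ ≤ (n : ℝ) ^ 2 * (2 * M * (1 / (n : ℝ) ^ 4)) := by gcongr
      _ = _ := by field_simp

end Counting

/-! ### The scale penalty against spikes of the likelihood. -/

section SmallScales

/-- The density is at most `1 / σ` everywhere, and at distance more than `√σ` from the location at
most `(1 / σ) * exp (-1 / (2σ)) ≤ 1`. The window is written as a left end plus a length to match
`card_window_le`. -/
theorem posPart_log_snDensity_le {σ A : ℝ} (hσ : 0 < σ) (hA : 1 ≤ A) (μ lam x : ℝ) :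
    max 0 (Real.log (snDensity μ σ lam x / A)) ≤
      if σ * A < 1 ∧ x ∈ Set.Icc (μ - √σ) (μ - √σ + 2 * √σ) then -Real.log σ else 0 := by
  have hs := snDensity_pos hσ μ lam x
  have hA0 : 0 < A := by linarith
  have hle := snDensity_le hσ μ lam x
  have hle1 : snDensity μ σ lam x ≤ 1 / σ :=
    hle.trans (mul_le_of_le_one_right (by positivity) exp_neg_sq_div_two_le)
  split_ifs with h
  · have hσ1 : σ ≤ 1 := by nlinarith [h.1]
    refine max_le (by have := Real.log_nonpos hσ.le hσ1; linarith) ?_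
    rw [← Real.log_inv, ← one_div]
    refine Real.log_le_log (by positivity) ((div_le_self hs.le hA).trans hle1)
  · refine max_le le_rfl (Real.log_nonpos (by positivity) ?_)
    rw [div_le_one hA0]
    rw [not_and_or] at h
    obtain h | h := h
    · refine hle1.trans ?_
      rw [div_le_iff₀ hσ]; linarith
    · refine le_trans ?_ hA
      refine hle.trans ?_
      have hsq : √σ ^ 2 = σ := Real.sq_sqrt hσ.le
      have hx : σ < (x - μ) ^ 2 := by
        have h1 : √σ < |x - μ| := by
          by_contra hcon
          rw [not_lt, abs_le] at hcon
          exact h ⟨by linarith [hcon.1], by linarith [hcon.2]⟩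
        rw [← sq_abs (x - μ), ← hsq]
        exact pow_lt_pow_left₀ h1 (Real.sqrt_nonneg _) two_ne_zero
      have h2 : 1 / σ ≤ ((x - μ) / σ) ^ 2 := by
        rw [div_pow, div_le_div_iff₀ hσ (by positivity)]; nlinarith
      have h3 := Real.quadratic_le_exp_of_nonneg (x := 1 / σ / 2) (by positivity)
      have h4 : 1 / σ ≤ Real.exp (1 / σ / 2) := by nlinarith [sq_nonneg (1 / σ - 2)]
      calc 1 / σ * Real.exp (-((x - μ) / σ) ^ 2 / 2)
          ≤ Real.exp (1 / σ / 2) * Real.exp (-(1 / σ / 2)) := by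
            gcongr; linarith
        _ = 1 := by rw [← Real.exp_add]; simp

/-- Use `log u ≤ u` at `u = σ ^ (-1/4)`. -/
theorem sqrt_mul_neg_log_le {σ : ℝ} (hσ : 0 < σ) : √σ * -Real.log σ ≤ 4 * √√σ := by
  have hu : 0 < √√σ := by positivity
  have h1 : √σ = √√σ ^ 2 := (Real.sq_sqrt (Real.sqrt_nonneg σ)).symm
  have h2 : -Real.log σ = 4 * Real.log (√√σ)⁻¹ := by
    rw [Real.log_inv, Real.log_sqrt (Real.sqrt_nonneg _), Real.log_sqrt hσ.le]; ring
  have h3 : Real.log (√√σ)⁻¹ ≤ (√√σ)⁻¹ :=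
    (Real.log_le_sub_one_of_pos (by positivity)).trans (by linarith)
  calc √σ * -Real.log σ = √√σ ^ 2 * (4 * Real.log (√√σ)⁻¹) := by rw [h2, ← h1]
    _ ≤ √√σ ^ 2 * (4 * (√√σ)⁻¹) := by gcongr
    _ = _ := by field_simp

theorem tendsto_mesh_mul_log : Tendsto (fun n : ℕ => mesh n * Real.log n) atTop (𝓝 0) := by
  have h := (isLittleO_log_rpow_atTop (r := 1 / 4) (by norm_num)).tendsto_div_nhds_zero.comp
    tendsto_natCast_atTop_atTop
  refine h.congr fun n => ?_
  simp only [Function.comp]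
  rw [mesh, Real.sqrt_eq_rpow, Real.sqrt_eq_rpow, ← Real.rpow_mul (Nat.cast_nonneg n)]
  norm_num
  rw [div_eq_inv_mul]

/-- The scale penalty outweighs the contribution of observations where one component has a large
density. -/
theorem eventually_penalty_add_sum_le {x : ℕ → ℝ} {q : ℕ → ℝ → ℝ} (hC1 : C1 q) (hC2 : C2 q)
    {M : ℝ} (hM : 1 ≤ M)
    (hwin : ∀ᶠ n : ℕ in atTop, ∀ a ℓ : ℝ, 0 ≤ ℓ →
      (((Finset.range n).filter fun i => x i ∈ Set.Icc a (a + ℓ)).card : ℝ) ≤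
        2 * M * n * (ℓ + 2 * mesh n))
    (hspace : ∀ᶠ n : ℕ in atTop, ∀ i < n, ∀ j < n, i ≠ j → 1 / (n : ℝ) ^ 4 < |x i - x j|)
    {ε : ℝ} (hε : 0 < ε) :
    ∃ A : ℕ, 1 ≤ A ∧ ∀ᶠ n : ℕ in atTop, ∀ μ σ lam : ℝ, 0 < σ →
      q n σ + 2 * ∑ i ∈ Finset.range n, max 0 (Real.log (snDensity μ σ lam (x i) / A)) ≤ ε * n := by
  classical
  -- Only scales below `1 / A` produce an excess. For those, the window of length `2√σ` will
  -- contribute at most `32 * M * σ ^ (1/4)` per observation and the grid error at most `72 * M *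
  -- mesh n * log n`; each is made at most `ε / 3`, as is the penalty.
  obtain ⟨A, hA1, hA2⟩ : ∃ A : ℕ, 1 ≤ A ∧ 32 * M * √√(1 / (A : ℝ)) ≤ ε / 3 := by
    have h : Tendsto (fun A : ℕ => 32 * M * √√(1 / (A : ℝ))) atTop (𝓝 (32 * M * √√0)) :=
      ((tendsto_one_div_atTop_nhds_zero_nat.sqrt).sqrt).const_mul _
    simp only [Real.sqrt_zero, mul_zero] at h
    exact ((eventually_ge_atTop 1).and (h.eventually_le_const (by positivity))).exists
  refine ⟨A, hA1, ?_⟩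
  have hA1' : (1 : ℝ) ≤ A := by exact_mod_cast hA1
  have hlim : ∀ᶠ n : ℕ in atTop, 72 * M * (mesh n * Real.log n) ≤ ε / 3 := by
    have := tendsto_mesh_mul_log.const_mul (72 * M)
    rw [mul_zero] at this
    exact this.eventually_le_const (by positivity)
  have hlog : ∀ᶠ n : ℕ in atTop, 2 ≤ Real.log n :=
    (Real.tendsto_log_atTop.comp tendsto_natCast_atTop_atTop).eventually_ge_atTop 2
  filter_upwards [hC1.2 (ε / 3) (by positivity), hC2, hwin, hspace, hlim, hlog,
    eventually_ge_atTop 4] with n hq1 hq2 hwin hspace hlim hlog hn4 μ σ lam hσ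
  have hn4' : (4 : ℝ) ≤ n := by exact_mod_cast hn4
  have hn0 : (0 : ℝ) < n := by linarith
  have hqle : q n σ ≤ ε / 3 * n := (le_max_right _ _).trans (hq1 σ hσ)
  have hsq : √σ ^ 2 = σ := Real.sq_sqrt hσ.le
  have hsq0 := Real.sqrt_nonneg σ
  by_cases hσA : σ * A < 1
  swap
  · have : ∑ i ∈ Finset.range n, max 0 (Real.log (snDensity μ σ lam (x i) / A)) ≤ 0 := by
      refine Finset.sum_nonpos fun i _ => (posPart_log_snDensity_le hσ hA1' μ lam (x i)).trans ?_
      simp [hσA]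
    have : 0 ≤ ε * n := by positivity
    nlinarith
  have hlogσ : 0 ≤ -Real.log σ := by
    have := Real.log_nonpos hσ.le (by nlinarith); linarith
  set W := (Finset.range n).filter fun i => x i ∈ Set.Icc (μ - √σ) (μ - √σ + 2 * √σ) with hW
  have hsum : ∑ i ∈ Finset.range n, max 0 (Real.log (snDensity μ σ lam (x i) / A)) ≤
      W.card * -Real.log σ := by
    refine (Finset.sum_le_sum fun i _ => posPart_log_snDensity_le hσ hA1' μ lam (x i)).trans ?_
    simp only [hσA, true_and]
    rw [← Finset.sum_filter, Finset.sum_const, nsmul_eq_mul]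
  -- Below `n ^ (-9)` the window is shorter than the spacing, so at most one observation
  -- contributes, and C2 with `log n ≥ 2` outweighs its `-2 log σ`. The ninth power rather than the
  -- eighth absorbs a factor `4 ≤ n`. Above, `-log σ ≤ 9 log n` and counting suffices.
  by_cases hsmall : σ * (n : ℝ) ^ 9 < 1
  · have hcard : (W.card : ℝ) ≤ 1 := by
      have : W.card ≤ 1 := by
        rw [Finset.card_le_one]
        intro i hi j hj
        by_contra hij
        obtain ⟨hi1, hi2, hi3⟩ := Finset.mem_filter.1 hi
        obtain ⟨hj1, hj2, hj3⟩ := Finset.mem_filter.1 hj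
        have h1 := hspace i (Finset.mem_range.1 hi1) j (Finset.mem_range.1 hj1) hij
        have h2 : |x i - x j| ≤ 2 * √σ := by
          rw [abs_le]; constructor <;> linarith
        have h3 : 2 * √σ ≤ 1 / (n : ℝ) ^ 4 := by
          refine le_of_sq_le_sq ?_ (by positivity)
          rw [mul_pow, hsq, div_pow, one_pow, le_div_iff₀ (by positivity)]
          have : 2 ^ 2 * σ * ((n : ℝ) ^ 4) ^ 2 ≤ σ * (n : ℝ) ^ 9 := by
            have h8 : (0 : ℝ) < n ^ 8 := by positivity
            have : (n : ℝ) ^ 9 = n ^ 8 * n := by ring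
            have h9 : ((n : ℝ) ^ 4) ^ 2 = n ^ 8 := by ring
            rw [this, h9]
            nlinarith [mul_nonneg (mul_pos hσ h8).le (sub_nonneg.2 hn4')]
          linarith
        linarith
      exact_mod_cast this
    have hσn : σ < Real.log n / n := by
      rw [lt_div_iff₀ hn0]
      have : σ * n ≤ σ * (n : ℝ) ^ 9 := by
        gcongr
        exact le_self_pow₀ (by linarith) (by norm_num)
      linarith
    have h1 := hq2 σ hσ hσn
    have h2 : W.card * -Real.log σ ≤ 1 * -Real.log σ := by gcongr
    have h3 : 0 ≤ ε * n := by positivity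
    nlinarith [mul_le_mul_of_nonneg_right hlog hlogσ, mul_nonneg hlogσ (by nlinarith :
      0 ≤ Real.log n ^ 2 - 4)]
  · rw [not_lt] at hsmall
    have hlogle : -Real.log σ ≤ 9 * Real.log n := by
      have := Real.log_nonneg hsmall
      rw [Real.log_mul hσ.ne' (by positivity), Real.log_pow] at this
      push_cast at this
      linarith
    have h1 := hwin (μ - √σ) (2 * √σ) (by positivity)
    have h2 : W.card * -Real.log σ ≤ 2 * M * n * (2 * √σ + 2 * mesh n) * -Real.log σ := by
      gcongr
    have h3 := sqrt_mul_neg_log_le hσ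
    have h4 : √√σ ≤ √√(1 / (A : ℝ)) := by
      apply Real.sqrt_le_sqrt
      apply Real.sqrt_le_sqrt
      rw [le_div_iff₀ (by positivity)]
      exact hσA.le
    have h5 : mesh n * -Real.log σ ≤ 9 * (mesh n * Real.log n) := by
      have := mesh_pos (by omega : 0 < n)
      nlinarith
    have h6 : 2 * (2 * M * n * (2 * √σ + 2 * mesh n) * -Real.log σ) =
        n * (8 * M * (√σ * -Real.log σ) + 8 * M * (mesh n * -Real.log σ)) := by ring
    have h7 : 8 * M * (√σ * -Real.log σ) + 8 * M * (mesh n * -Real.log σ) ≤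
        32 * M * √√(1 / (A : ℝ)) + 72 * M * (mesh n * Real.log n) := by
      have hM0 : 0 ≤ 8 * M := by linarith
      have h8 := mul_le_mul_of_nonneg_left (h3.trans (mul_le_mul_of_nonneg_left h4 (by norm_num))) hM0
      have h9 := mul_le_mul_of_nonneg_left h5 hM0
      linarith
    have h8 : (n : ℝ) * (8 * M * (√σ * -Real.log σ) + 8 * M * (mesh n * -Real.log σ)) ≤
        n * (ε / 3 + ε / 3) := by
      exact mul_le_mul_of_nonneg_left (by linarith) hn0.le
    linarith

end SmallScales

/-! ### The mixture density and its law: integrability. -/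

section MixtureDensity

variable {m : ℕ}

theorem weight_sum (Ψ : Param m) : ∑ k, weight Ψ k = 1 := by
  rw [Fin.sum_univ_castSucc]
  simp [weight]

theorem continuous_weight (k : Fin (m + 1)) : Continuous fun Ψ : Param m => weight Ψ k := by
  induction k using Fin.lastCases with
  | last => simp only [weight, Fin.lastCases_last]; fun_prop
  | cast j => simp only [weight, Fin.lastCases_castSucc]; fun_prop

theorem continuous_loc (k : Fin (m + 1)) : Continuous fun Ψ : Param m => loc Ψ k := by
  unfold loc; fun_prop

theorem continuous_scale (k : Fin (m + 1)) : Continuous fun Ψ : Param m => scale Ψ k := by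
  unfold scale; fun_prop

theorem continuous_shape (k : Fin (m + 1)) : Continuous fun Ψ : Param m => shape Ψ k := by
  unfold shape; fun_prop

theorem mixDensity_pos {Ψ : Param m} (hΨ : Ψ ∈ paramSpace m) (x : ℝ) : 0 < mixDensity Ψ x := by
  have h : ∀ k, 0 ≤ weight Ψ k * snDensity (loc Ψ k) (scale Ψ k) (shape Ψ k) x := fun k =>
    mul_nonneg (hΨ k).1 (snDensity_pos (hΨ k).2 _ _ _).le
  obtain ⟨k, -, hk⟩ := Finset.exists_ne_zero_of_sum_ne_zero (s := Finset.univ)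
    (f := fun k => weight Ψ k) (by rw [weight_sum]; exact one_ne_zero)
  refine Finset.sum_pos' (fun k _ => h k) ⟨k, Finset.mem_univ k, ?_⟩
  exact mul_pos (lt_of_le_of_ne (hΨ k).1 hk.symm) (snDensity_pos (hΨ k).2 _ _ _)

theorem integrable_mixDensity {Ψ : Param m} (hΨ : Ψ ∈ paramSpace m) :
    Integrable (mixDensity Ψ) ∧ ∫ x, mixDensity Ψ x = 1 := by
  have h : ∀ k, Integrable fun x =>
      weight Ψ k * snDensity (loc Ψ k) (scale Ψ k) (shape Ψ k) x := fun k =>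
    (integrable_snDensity (hΨ k).2 _ _).1.const_mul _
  refine ⟨integrable_finsetSum _ fun k _ => h k, ?_⟩
  unfold mixDensity
  rw [integral_finsetSum _ fun k _ => h k, ← weight_sum Ψ]
  refine Finset.sum_congr rfl fun k _ => ?_
  rw [integral_const_mul, (integrable_snDensity (hΨ k).2 _ _).2, mul_one]

theorem weight_le_one {Ψ : Param m} (hΨ : Ψ ∈ paramSpace m) (k : Fin (m + 1)) : weight Ψ k ≤ 1 := by
  rw [← weight_sum Ψ]
  exact Finset.single_le_sum (fun j _ => (hΨ j).1) (Finset.mem_univ k)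

theorem mixDensity_le_exp {Ψ : Param m} (hΨ : Ψ ∈ paramSpace m) {a : ℝ} (ha : 0 ≤ a) (x : ℝ) :
    mixDensity Ψ x ≤ (∑ k, 1 / scale Ψ k * Real.exp (a ^ 2 * scale Ψ k ^ 2 / 2 + a * |loc Ψ k|)) *
      Real.exp (-(a * |x|)) := by
  rw [Finset.sum_mul]
  refine Finset.sum_le_sum fun k _ => ?_
  refine (mul_le_of_le_one_left (snDensity_pos (hΨ k).2 _ _ _).le (weight_le_one hΨ k)).trans ?_
  exact (snDensity_le (hΨ k).2 _ _ _).trans (gaussian_kernel_le_exp (hΨ k).2 _ _ ha)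

theorem integrable_exp_neg_mul_abs {a : ℝ} (ha : 0 < a) :
    Integrable fun x : ℝ => Real.exp (-(a * |x|)) := by
  rw [← integrableOn_univ, ← Set.Iic_union_Ioi (a := (0 : ℝ))]
  refine IntegrableOn.union ?_ ?_
  · refine (integrableOn_exp_mul_Iic ha 0).congr_fun (fun x hx => ?_) measurableSet_Iic
    simp only [abs_of_nonpos (Set.mem_Iic.1 hx)]
    congr 1; ring
  · refine (integrableOn_exp_mul_Ioi (neg_lt_zero.2 ha) 0).congr_fun (fun x hx => ?_)
      measurableSet_Ioi
    simp only [abs_of_pos (Set.mem_Ioi.1 hx)]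
    congr 1; ring

theorem isProbabilityMeasure_mixLaw {Ψ : Param m} (hΨ : Ψ ∈ paramSpace m) :
    IsProbabilityMeasure (mixLaw Ψ) := by
  refine ⟨?_⟩
  rw [mixLaw, withDensity_apply _ MeasurableSet.univ, Measure.restrict_univ,
    ← ofReal_integral_eq_lintegral_ofReal (integrable_mixDensity hΨ).1
      (.of_forall fun x => (mixDensity_pos hΨ x).le), (integrable_mixDensity hΨ).2,
    ENNReal.ofReal_one]

theorem integral_mixLaw {Ψ : Param m} (hΨ : Ψ ∈ paramSpace m) (g : ℝ → ℝ) :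
    ∫ x, g x ∂(mixLaw Ψ) = ∫ x, mixDensity Ψ x * g x := by
  rw [mixLaw, integral_withDensity_eq_integral_toReal_smul
    (continuous_mixDensity Ψ).measurable.ennreal_ofReal (by simp)]
  refine integral_congr_ae (.of_forall fun x => ?_)
  simp only [ENNReal.toReal_ofReal (mixDensity_pos hΨ x).le, smul_eq_mul]

theorem integrable_mixLaw_iff {Ψ : Param m} (hΨ : Ψ ∈ paramSpace m) (g : ℝ → ℝ) :
    Integrable g (mixLaw Ψ) ↔ Integrable fun x => mixDensity Ψ x * g x := by
  rw [mixLaw, integrable_withDensity_iff_integrable_smul'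
    (continuous_mixDensity Ψ).measurable.ennreal_ofReal (by simp)]
  refine integrable_congr (.of_forall fun x => ?_)
  simp only [ENNReal.toReal_ofReal (mixDensity_pos hΨ x).le, smul_eq_mul]

theorem ae_mixLaw_iff {Ψ : Param m} (hΨ : Ψ ∈ paramSpace m) {p : ℝ → Prop} :
    (∀ᵐ x ∂(mixLaw Ψ), p x) ↔ ∀ᵐ x, p x := by
  refine ⟨fun h => ?_, fun h => (withDensity_absolutelyContinuous _ _).ae_le h⟩
  refine (withDensity_absolutelyContinuous' (μ := volume)
    (f := fun x => ENNReal.ofReal (mixDensity Ψ x)) ?_ ?_).ae_le h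
  · exact (continuous_mixDensity Ψ).measurable.ennreal_ofReal.aemeasurable
  · exact .of_forall fun x => by simpa using mixDensity_pos hΨ x

theorem integrable_exp_mul_abs_mixLaw {Ψ : Param m} (hΨ : Ψ ∈ paramSpace m) {a : ℝ} (ha : 0 ≤ a) :
    Integrable (fun x => Real.exp (a * |x|)) (mixLaw Ψ) := by
  rw [integrable_mixLaw_iff hΨ]
  refine ((integrable_exp_neg_mul_abs one_pos).const_mul (∑ k, 1 / scale Ψ k *
    Real.exp ((a + 1) ^ 2 * scale Ψ k ^ 2 / 2 + (a + 1) * |loc Ψ k|))).mono' ?_ ?_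
  · exact ((continuous_mixDensity Ψ).mul (by fun_prop)).aestronglyMeasurable
  · refine .of_forall fun x => ?_
    rw [Real.norm_of_nonneg (mul_nonneg (mixDensity_pos hΨ x).le (Real.exp_pos _).le)]
    refine (mul_le_mul_of_nonneg_right (mixDensity_le_exp hΨ (by linarith : 0 ≤ a + 1) x)
      (Real.exp_pos _).le).trans (le_of_eq ?_)
    rw [mul_assoc, ← Real.exp_add]
    congr 2; ring

theorem integrable_sq_mixLaw {Ψ : Param m} (hΨ : Ψ ∈ paramSpace m) :
    Integrable (fun x : ℝ => x ^ 2) (mixLaw Ψ) := by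
  refine ((integrable_exp_mul_abs_mixLaw hΨ zero_le_one).const_mul 2).mono'
    (by fun_prop) (.of_forall fun x => ?_)
  rw [Real.norm_of_nonneg (sq_nonneg x)]
  have := Real.quadratic_le_exp_of_nonneg (abs_nonneg x)
  rw [sq_abs] at this
  rw [one_mul]
  nlinarith [abs_nonneg x]

theorem mixLaw_Icc_le {Ψ : Param m} (hΨ : Ψ ∈ paramSpace m) :
    ∃ M : ℝ, 1 ≤ M ∧ (∀ x, mixDensity Ψ x ≤ M) ∧
      ∀ a b, a ≤ b → (mixLaw Ψ).real (Set.Icc a b) ≤ M * (b - a) := by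
  set M := (∑ k, 1 / scale Ψ k * Real.exp ((0 : ℝ) ^ 2 * scale Ψ k ^ 2 / 2 + 0 * |loc Ψ k|))
    with hM
  have hle : ∀ x, mixDensity Ψ x ≤ max 1 M := fun x => by
    have := mixDensity_le_exp hΨ le_rfl x
    simp only [zero_mul, neg_zero, Real.exp_zero, mul_one] at this
    refine this.trans (le_trans ?_ (le_max_right _ _))
    simp [hM]
  refine ⟨max 1 M, le_max_left _ _, hle, fun a b hab => ?_⟩
  refine ENNReal.toReal_le_of_le_ofReal (mul_nonneg (by positivity) (by linarith)) ?_
  rw [mixLaw, withDensity_apply _ measurableSet_Icc]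
  calc ∫⁻ x in Set.Icc a b, ENNReal.ofReal (mixDensity Ψ x)
      ≤ ∫⁻ _ in Set.Icc a b, ENNReal.ofReal (max 1 M) :=
        lintegral_mono fun x => ENNReal.ofReal_le_ofReal (hle x)
    _ = ENNReal.ofReal (max 1 M * (b - a)) := by
        rw [lintegral_const, Measure.restrict_apply_univ, Real.volume_Icc,
          ENNReal.ofReal_mul (by positivity)]

theorem mul_abs_log_le {y M : ℝ} (hy : 0 < y) (hyM : y ≤ M) : y * |Real.log y| ≤ 2 * (1 + M) * √y := by
  have hs : 0 < √y := Real.sqrt_pos.2 hy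
  have hsq : √y ^ 2 = y := Real.sq_sqrt hy.le
  have h2 : Real.log y = 2 * Real.log √y := by rw [Real.log_sqrt hy.le]; ring
  rw [h2, abs_mul, abs_two]
  have h1 : Real.log √y ≤ √y := (Real.log_le_sub_one_of_pos hs).trans (by linarith)
  have h3 : -Real.log √y ≤ (√y)⁻¹ := by
    rw [← Real.log_inv]
    exact (Real.log_le_sub_one_of_pos (by positivity)).trans (by linarith)
  have h4 : |Real.log √y| ≤ √y + (√y)⁻¹ := by
    have : 0 < (√y)⁻¹ := by positivity
    rw [abs_le]; constructor <;> linarith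
  have h5 : y * (√y)⁻¹ = √y := by
    nth_rw 1 [← hsq]; field_simp
  calc y * (2 * |Real.log √y|) ≤ y * (2 * (√y + (√y)⁻¹)) := by gcongr
    _ = 2 * (y * √y + y * (√y)⁻¹) := by ring
    _ ≤ 2 * (M * √y + √y) := by rw [h5]; gcongr
    _ = _ := by ring

/-- For bounded `f`, the function `f * |log f|` is dominated by a multiple of `√f`, which decays
exponentially. -/
theorem integrable_log_mixDensity {Ψ : Param m} (hΨ : Ψ ∈ paramSpace m) :
    Integrable (fun x => |Real.log (mixDensity Ψ x)|) (mixLaw Ψ) := by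
  rw [integrable_mixLaw_iff hΨ]
  obtain ⟨M, hM, hle, -⟩ := mixLaw_Icc_le hΨ
  set C := (∑ k, 1 / scale Ψ k *
    Real.exp ((2 : ℝ) ^ 2 * scale Ψ k ^ 2 / 2 + 2 * |loc Ψ k|)) with hC
  refine ((integrable_exp_neg_mul_abs one_pos).const_mul (2 * (1 + M) * √C)).mono' ?_ ?_
  · exact ((continuous_mixDensity Ψ).measurable.mul
      (continuous_mixDensity Ψ).measurable.log.abs).aestronglyMeasurable
  · refine .of_forall fun x => ?_
    rw [Real.norm_of_nonneg (mul_nonneg (mixDensity_pos hΨ x).le (abs_nonneg _)), mul_assoc]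
    refine (mul_abs_log_le (mixDensity_pos hΨ x) (hle x)).trans ?_
    gcongr
    have h1 : Real.exp (-(1 * |x|)) = √(Real.exp (-(2 * |x|))) := by
      rw [Real.sqrt_eq_rpow, ← Real.exp_mul]; congr 1; ring
    have hC0 : 0 ≤ C := Finset.sum_nonneg fun k _ => by have := (hΨ k).2; positivity
    rw [h1, ← Real.sqrt_mul hC0]
    exact Real.sqrt_le_sqrt (mixDensity_le_exp hΨ (by norm_num) x)

end MixtureDensity

/-! ### Kullback-Leibler type bounds on the compactified parameter space. -/

section KullbackLeibler

variable {m : ℕ}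

/-- The extended parameters whose weights are nonnegative and sum to one. -/
def extSpace (m : ℕ) : Set (ExtParam m) := {θ | (∀ k, 0 ≤ (θ k).1) ∧ ∑ k, (θ k).1 = 1}

/-- The weights lie in `[0, 1]` and the extended real line is compact; this is what the extended
components are for. -/
theorem isCompact_extSpace : IsCompact (extSpace m) := by
  have h1 : IsCompact (Set.pi Set.univ fun _ : Fin (m + 1) =>
      (Set.Icc (0 : ℝ) 1) ×ˢ (Set.univ : Set (EReal × EReal × EReal))) :=
    isCompact_univ_pi fun _ => isCompact_Icc.prod isCompact_univ
  have h2 : IsClosed (extSpace m) := by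
    have h3 : IsClosed {θ : ExtParam m | ∀ k, 0 ≤ (θ k).1} := by
      rw [Set.ofPred_forall]
      exact isClosed_iInter fun k => isClosed_le continuous_const (by fun_prop)
    exact h3.inter (isClosed_eq (by fun_prop) continuous_const)
  refine h1.of_isClosed_subset h2 fun θ hθ => ?_
  refine Set.mem_univ_pi.2 fun k => ⟨⟨hθ.1 k, ?_⟩, trivial⟩
  rw [← hθ.2]
  exact Finset.single_le_sum (f := fun k => (θ k).1) (fun j _ => hθ.1 j) (Finset.mem_univ k)

theorem mixExt_nonneg {θ : ExtParam m} (hθ : θ ∈ extSpace m) (x : ℝ) : 0 ≤ mixExt θ x :=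
  Finset.sum_nonneg fun k _ => mul_nonneg (hθ.1 k) (snExt_nonneg _ _ _ _)

theorem measurable_mixExt (θ : ExtParam m) : Measurable (mixExt θ) :=
  Finset.measurable_fun_sum _ fun _ _ => (measurable_snExt _ _ _).const_mul _

theorem integrable_mixExt {θ : ExtParam m} (hθ : θ ∈ extSpace m) :
    Integrable (mixExt θ) ∧ ∫ x, mixExt θ x ≤ 1 := by
  have h : ∀ k, Integrable fun x =>
      (θ k).1 * snExt (θ k).2.1 (θ k).2.2.1 (θ k).2.2.2 x := fun k =>
    (integrable_snExt _ _ _).1.const_mul _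
  refine ⟨integrable_finsetSum _ fun k _ => h k, ?_⟩
  unfold mixExt
  rw [integral_finsetSum _ fun k _ => h k, ← hθ.2]
  refine Finset.sum_le_sum fun k _ => ?_
  rw [integral_const_mul]
  exact mul_le_of_le_one_right (hθ.1 k) (integrable_snExt _ _ _).2

theorem ae_continuousAt_mixExt (θ : ExtParam m) :
    ∀ᵐ x : ℝ, ContinuousAt (fun θ' : ExtParam m => mixExt θ' x) θ := by
  have h : ∀ᵐ x : ℝ, ∀ k, (x : EReal) ≠ (θ k).2.1 := by
    rw [ae_all_iff]
    intro k
    filter_upwards [(measure_eq_zero_iff_ae_notMem).1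
      (Real.volume_singleton (a := (θ k).2.1.toReal))] with x hx he
    exact hx (by rw [Set.mem_singleton_iff, ← he, EReal.toReal_coe])
  filter_upwards [h] with x hx
  refine tendsto_finsetSum _ fun k _ => ?_
  have h1 : ContinuousAt (fun θ' : ExtParam m => (θ' k).1) θ :=
    (continuous_fst.comp (continuous_apply k)).continuousAt
  have h2 : ContinuousAt (fun θ' : ExtParam m => (θ' k).2) θ :=
    (continuous_snd.comp (continuous_apply k)).continuousAt
  exact h1.mul (ContinuousAt.comp (f := fun θ' : ExtParam m => (θ' k).2)
    (continuousAt_snExt (hx k)) h2)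

/-- The logarithm of the ratio of the average of a density truncated at `A` and a second density
to that second density. -/
noncomputable def truncLog (A y y₀ : ℝ) : ℝ := Real.log ((min y A + y₀) / (2 * y₀))

/-- A bounded lower bound of `t - 1 - log t`, at half the sum of one and a density ratio. -/
noncomputable def klGap (y y₀ : ℝ) : ℝ :=
  min ((y + y₀) / (2 * y₀) - 1 - Real.log ((y + y₀) / (2 * y₀))) 1

theorem klGap_nonneg {y y₀ : ℝ} (hy : 0 ≤ y) (hy₀ : 0 < y₀) : 0 ≤ klGap y y₀ := by
  refine le_min ?_ zero_le_one
  have := Real.log_le_sub_one_of_pos (x := (y + y₀) / (2 * y₀)) (by positivity)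
  linarith

theorem klGap_le_one (y y₀ : ℝ) : klGap y y₀ ≤ 1 := min_le_right _ _

theorem eq_of_klGap_eq_zero {y y₀ : ℝ} (hy : 0 ≤ y) (hy₀ : 0 < y₀) (h : klGap y y₀ = 0) :
    y = y₀ := by
  by_contra hne
  have ht : (y + y₀) / (2 * y₀) ≠ 1 := by
    intro h1
    rw [div_eq_one_iff_eq (by positivity)] at h1
    exact hne (by linarith)
  have := Real.log_lt_sub_one_of_pos (x := (y + y₀) / (2 * y₀)) (by positivity) ht
  have : 0 < klGap y y₀ := lt_min (by linarith) one_pos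
  exact this.ne' h

theorem truncLog_add_klGap_le {A y y₀ : ℝ} (hA : 0 ≤ A) (hy : 0 ≤ y) (hy₀ : 0 < y₀) :
    truncLog A y y₀ + klGap y y₀ ≤ (y / y₀ - 1) / 2 := by
  have h0 : 0 ≤ min y A := le_min hy hA
  have h1 : truncLog A y y₀ ≤ Real.log ((y + y₀) / (2 * y₀)) := by
    refine Real.log_le_log (by positivity) ?_
    gcongr
    exact min_le_left _ _
  have h2 : klGap y y₀ ≤ (y + y₀) / (2 * y₀) - 1 - Real.log ((y + y₀) / (2 * y₀)) := min_le_left _ _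
  have h3 : (y + y₀) / (2 * y₀) - 1 = (y / y₀ - 1) / 2 := by field_simp; ring
  linarith

/-- Averaging with `y₀` bounds the logarithm below by `-log 2`; the truncation bounds it above up to
`|log y₀|`. This is the integrable envelope for the uniform law of large numbers. -/
theorem abs_truncLog_le {A y y₀ : ℝ} (hA : 0 ≤ A) (hy : 0 ≤ y) (hy₀ : 0 < y₀) :
    |truncLog A y y₀| ≤ Real.log 2 + Real.log (1 + A) + |Real.log y₀| := by
  have h0 : 0 ≤ min y A := le_min hy hA
  have hA' : 0 ≤ Real.log (1 + A) := Real.log_nonneg (by linarith)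
  have h2 : 0 ≤ Real.log 2 := Real.log_nonneg (by norm_num)
  rw [abs_le]
  constructor
  · have : Real.log (1 / 2) ≤ truncLog A y y₀ := by
      refine Real.log_le_log (by norm_num) ?_
      rw [div_le_div_iff₀ two_pos (by positivity)]
      linarith
    rw [one_div, Real.log_inv] at this
    linarith [abs_nonneg (Real.log y₀)]
  · have h3 : truncLog A y y₀ ≤ Real.log ((1 + A) * max 1 (y₀⁻¹)) := by
      refine Real.log_le_log (by positivity) ?_
      rw [div_le_iff₀ (by positivity)]
      have h4 : min y A ≤ A := min_le_right _ _
      rcases le_total 1 y₀⁻¹ with h | h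
      · rw [max_eq_right h]
        have h5 : (1 + A) * y₀⁻¹ * (2 * y₀) = 2 * (1 + A) := by field_simp
        rw [h5]
        have : y₀ ≤ 1 := (one_le_inv₀ hy₀).1 h
        linarith
      · rw [max_eq_left h]
        have : 1 ≤ y₀ := (inv_le_one₀ hy₀).1 h
        nlinarith
    rw [Real.log_mul (by positivity) (by positivity)] at h3
    have h6 : Real.log (max 1 y₀⁻¹) ≤ |Real.log y₀| := by
      rcases le_total 1 y₀⁻¹ with h | h
      · rw [max_eq_right h, Real.log_inv]; exact neg_le_abs _
      · rw [max_eq_left h, Real.log_one]; exact abs_nonneg _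
    linarith

/-- The log-likelihood ratio in terms of the truncated one. -/
theorem log_sub_log_le {ι : Type*} [Fintype ι] {w s : ι → ℝ} (hw : ∀ k, 0 ≤ w k)
    (hw1 : ∑ k, w k = 1) (hs : ∀ k, 0 < s k) {A y₀ : ℝ} (hA : 1 ≤ A) (hy₀ : 0 < y₀)
    (hy : 0 < ∑ k, w k * s k) :
    Real.log (∑ k, w k * s k) - Real.log y₀ ≤
      2 * (truncLog A (∑ k, w k * s k) y₀ + ∑ k, max 0 (Real.log (s k / A))) := by
  set y := ∑ k, w k * s k with hydef
  have hA0 : 0 < A := by linarith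
  -- The inequality `4 * y * y₀ ≤ (y + y₀)²`, divided by `4 * y₀²`.
  have h1 : Real.log y - Real.log y₀ ≤ 2 * Real.log ((y + y₀) / (2 * y₀)) := by
    rw [← Real.log_div hy.ne' hy₀.ne']
    have : 2 * Real.log ((y + y₀) / (2 * y₀)) = Real.log (((y + y₀) / (2 * y₀)) ^ 2) := by
      rw [Real.log_pow]; norm_num
    rw [this]
    refine Real.log_le_log (by positivity) ?_
    rw [div_pow, div_le_div_iff₀ hy₀ (by positivity)]
    nlinarith [mul_nonneg hy₀.le (sq_nonneg (y - y₀))]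
  have hsum : 0 ≤ ∑ k, max 0 (Real.log (s k / A)) := Finset.sum_nonneg fun k _ => le_max_left _ _
  have h2 : Real.log ((y + y₀) / (2 * y₀)) ≤
      truncLog A y y₀ + ∑ k, max 0 (Real.log (s k / A)) := by
    rcases le_total y A with h | h
    · rw [truncLog, min_eq_left h]; linarith
    · rw [truncLog, min_eq_right h]
      have hne : (Finset.univ : Finset ι).Nonempty := by
        by_contra hne
        rw [Finset.not_nonempty_iff_eq_empty] at hne
        rw [hne, Finset.sum_empty] at hw1
        exact zero_ne_one hw1
      -- A convex combination is at most its largest term, so above the truncation level `A ≤ y ≤ s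
      -- k` and the excess of this one component pays for the truncation.
      obtain ⟨k, -, hk⟩ := Finset.exists_max_image Finset.univ s hne
      have hyk : y ≤ s k := by
        calc y ≤ ∑ j, w j * s k := Finset.sum_le_sum fun j _ =>
              mul_le_mul_of_nonneg_left (hk j (Finset.mem_univ j)) (hw j)
          _ = s k := by rw [← Finset.sum_mul, hw1, one_mul]
      have h3 : Real.log (s k / A) ≤ ∑ k, max 0 (Real.log (s k / A)) :=
        (le_max_right _ _).trans (Finset.single_le_sum (f := fun k => max 0 (Real.log (s k / A)))
          (fun j _ => le_max_left _ _) (Finset.mem_univ k))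
      have h4 : Real.log ((y + y₀) / (2 * y₀)) ≤ Real.log ((A + y₀) / (2 * y₀) * (s k / A)) := by
        refine Real.log_le_log (by positivity) ?_
        rw [div_mul_div_comm, div_le_div_iff₀ (by positivity) (by positivity)]
        have h5 : A * (y + y₀) ≤ (A + y₀) * s k := by nlinarith [hs k]
        have h6 : 0 ≤ 2 * y₀ := by linarith
        nlinarith [mul_le_mul_of_nonneg_left h5 h6]
      rw [Real.log_mul (by positivity) (div_pos (hs k) hA0).ne'] at h4
      linarith
  linarith

variable {Ψ₀ : Param m}

/-- Extended mixtures have mass at most one, so `mixExt θ / mixDensity Ψ₀ - 1` has nonpositive mean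
under the true law. The resulting bound does not involve `A`. -/
theorem integral_truncLog_le (hΨ₀ : Ψ₀ ∈ paramSpace m) {θ : ExtParam m} (hθ : θ ∈ extSpace m)
    {A : ℝ} (hA : 0 ≤ A) :
    ∫ x, truncLog A (mixExt θ x) (mixDensity Ψ₀ x) ∂(mixLaw Ψ₀) ≤
      -∫ x, klGap (mixExt θ x) (mixDensity Ψ₀ x) ∂(mixLaw Ψ₀) := by
  have := isProbabilityMeasure_mixLaw hΨ₀
  have hmf := measurable_mixExt θ
  have hm0 := (continuous_mixDensity Ψ₀).measurable
  have hp := mixDensity_pos hΨ₀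
  have hq := mixExt_nonneg hθ
  have i1 : Integrable (fun x => truncLog A (mixExt θ x) (mixDensity Ψ₀ x)) (mixLaw Ψ₀) := by
    refine ((integrable_const (Real.log 2 + Real.log (1 + A))).add
      (integrable_log_mixDensity hΨ₀)).mono' ?_ (.of_forall fun x => ?_)
    · unfold truncLog
      exact (((hmf.min measurable_const).add hm0).div (hm0.const_mul 2)).log.aestronglyMeasurable
    · exact abs_truncLog_le hA (hq x) (hp x)
  have i2 : Integrable (fun x => klGap (mixExt θ x) (mixDensity Ψ₀ x)) (mixLaw Ψ₀) := by
    refine (integrable_const (1 : ℝ)).mono' ?_ (.of_forall fun x => ?_)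
    · unfold klGap
      have h := (hmf.add hm0).div (hm0.const_mul 2)
      exact ((((h.sub_const 1).sub h.log).min measurable_const)).aestronglyMeasurable
    · rw [Real.norm_of_nonneg (klGap_nonneg (hq x) (hp x))]
      exact klGap_le_one _ _
  have e3 : ∀ x, mixDensity Ψ₀ x * ((mixExt θ x / mixDensity Ψ₀ x - 1) / 2) =
      (mixExt θ x - mixDensity Ψ₀ x) / 2 := fun x => by
    have := (hp x).ne'
    field_simp
  have i3 : Integrable (fun x => (mixExt θ x / mixDensity Ψ₀ x - 1) / 2) (mixLaw Ψ₀) := by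
    rw [integrable_mixLaw_iff hΨ₀]
    simp_rw [e3]
    exact ((integrable_mixExt hθ).1.sub (integrable_mixDensity hΨ₀).1).div_const 2
  have h := integral_mono (i1.add i2) i3 fun x => truncLog_add_klGap_le hA (hq x) (hp x)
  simp only [Pi.add_apply] at h
  rw [integral_add i1 i2, integral_mixLaw hΨ₀ (fun x => (mixExt θ x / mixDensity Ψ₀ x - 1) / 2)] at h
  simp_rw [e3] at h
  rw [integral_div, integral_sub (integrable_mixExt hθ).1 (integrable_mixDensity hΨ₀).1,
    (integrable_mixDensity hΨ₀).2] at h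
  linarith [(integrable_mixExt hθ).2]

theorem continuousOn_integral_klGap (hΨ₀ : Ψ₀ ∈ paramSpace m) :
    ContinuousOn (fun θ : ExtParam m =>
      ∫ x, klGap (mixExt θ x) (mixDensity Ψ₀ x) ∂(mixLaw Ψ₀)) (extSpace m) := by
  have := isProbabilityMeasure_mixLaw hΨ₀
  have hm0 := (continuous_mixDensity Ψ₀).measurable
  have hp := mixDensity_pos hΨ₀
  intro θ hθ
  refine tendsto_integral_filter_of_dominated_convergence (fun _ => (1 : ℝ)) ?_ ?_
    (integrable_const _) ?_
  · refine .of_forall fun θ' => ?_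
    unfold klGap
    have h := ((measurable_mixExt θ').add hm0).div (hm0.const_mul 2)
    exact ((((h.sub_const 1).sub h.log).min measurable_const)).aestronglyMeasurable
  · filter_upwards [self_mem_nhdsWithin] with θ' hθ'
    refine .of_forall fun x => ?_
    rw [Real.norm_of_nonneg (klGap_nonneg (mixExt_nonneg hθ' x) (hp x))]
    exact klGap_le_one _ _
  · rw [ae_mixLaw_iff hΨ₀]
    filter_upwards [ae_continuousAt_mixExt θ] with x hx
    have hx' := hx.continuousWithinAt (s := extSpace m)
    have h0 := mixExt_nonneg hθ x
    have hpx := hp x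
    unfold klGap
    have h1 : ContinuousWithinAt (fun θ' : ExtParam m =>
        (mixExt θ' x + mixDensity Ψ₀ x) / (2 * mixDensity Ψ₀ x)) (extSpace m) θ :=
      (hx'.add continuousWithinAt_const).div_const _
    exact ((h1.sub continuousWithinAt_const).sub (h1.log (by positivity))).min
      continuousWithinAt_const

theorem ae_eq_of_integral_klGap_eq_zero (hΨ₀ : Ψ₀ ∈ paramSpace m) {θ : ExtParam m}
    (hθ : θ ∈ extSpace m)
    (h : ∫ x, klGap (mixExt θ x) (mixDensity Ψ₀ x) ∂(mixLaw Ψ₀) = 0) :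
    ∀ᵐ x, mixExt θ x = mixDensity Ψ₀ x := by
  have := isProbabilityMeasure_mixLaw hΨ₀
  have hm0 := (continuous_mixDensity Ψ₀).measurable
  have hp := mixDensity_pos hΨ₀
  have hq := mixExt_nonneg hθ
  have hi : Integrable (fun x => klGap (mixExt θ x) (mixDensity Ψ₀ x)) (mixLaw Ψ₀) := by
    refine (integrable_const (1 : ℝ)).mono' ?_ (.of_forall fun x => ?_)
    · unfold klGap
      have h := ((measurable_mixExt θ).add hm0).div (hm0.const_mul 2)
      exact ((((h.sub_const 1).sub h.log).min measurable_const)).aestronglyMeasurable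
    · rw [Real.norm_of_nonneg (klGap_nonneg (hq x) (hp x))]
      exact klGap_le_one _ _
  rw [integral_eq_zero_iff_of_nonneg (fun x => klGap_nonneg (hq x) (hp x)) hi] at h
  rw [← ae_mixLaw_iff hΨ₀]
  filter_upwards [h] with x hx using eq_of_klGap_eq_zero (hq x) (hp x) hx

/-- The mean of `klGap` is continuous and positive on `K`, so its minimum serves as `c`. That `c`
precedes `A` is essential: the truncation level is later chosen in terms of `c`. -/
theorem exists_forall_integral_truncLog_le (hΨ₀ : Ψ₀ ∈ paramSpace m) {K : Set (ExtParam m)}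
    (hK : IsCompact K) (hKS : K ⊆ extSpace m)
    (hne : ∀ θ ∈ K, ¬ ∀ᵐ x, mixExt θ x = mixDensity Ψ₀ x) :
    ∃ c : ℝ, 0 < c ∧ ∀ A : ℝ, 0 ≤ A → ∀ θ ∈ K,
      ∫ x, truncLog A (mixExt θ x) (mixDensity Ψ₀ x) ∂(mixLaw Ψ₀) ≤ -c := by
  rcases K.eq_empty_or_nonempty with rfl | hKne
  · exact ⟨1, one_pos, fun A _ θ hθ => absurd hθ (Set.notMem_empty θ)⟩
  obtain ⟨θ₀, hθ₀, hmin⟩ := hK.exists_isMinOn hKne ((continuousOn_integral_klGap hΨ₀).mono hKS)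
  refine ⟨∫ x, klGap (mixExt θ₀ x) (mixDensity Ψ₀ x) ∂(mixLaw Ψ₀), ?_, fun A hA θ hθ => ?_⟩
  · refine lt_of_le_of_ne (integral_nonneg fun x =>
      klGap_nonneg (mixExt_nonneg (hKS hθ₀) x) (mixDensity_pos hΨ₀ x)) fun h => ?_
    exact hne θ₀ hθ₀ (ae_eq_of_integral_klGap_eq_zero hΨ₀ (hKS hθ₀) h.symm)
  · exact (integral_truncLog_le hΨ₀ (hKS hθ) hA).trans (neg_le_neg (hmin hθ))

end KullbackLeibler

/-! ### Strong consistency of the estimator. -/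

section Consistency

variable {m : ℕ}

theorem continuous_toExt : Continuous (toExt : Param m → ExtParam m) := by
  refine continuous_pi fun k => ?_
  exact (continuous_weight k).prodMk ((continuous_coe_real_ereal.comp (continuous_loc k)).prodMk
    ((continuous_coe_real_ereal.comp (continuous_scale k)).prodMk
      (continuous_coe_real_ereal.comp (continuous_shape k))))

theorem toExt_mem_extSpace {Ψ : Param m} (hΨ : Ψ ∈ paramSpace m) : toExt Ψ ∈ extSpace m :=
  ⟨fun k => (hΨ k).1, weight_sum Ψ⟩

theorem continuousOn_snDensity (x : ℝ) :
    ContinuousOn (fun t : ℝ × ℝ × ℝ => snDensity t.1 t.2.1 t.2.2 x) {t | 0 < t.2.1} := by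
  have h : ContinuousOn (fun t : ℝ × ℝ × ℝ => (x - t.1) / t.2.1) {t | 0 < t.2.1} :=
    ContinuousOn.div (by fun_prop) (by fun_prop) fun t ht => (Set.mem_ofPred_eq ▸ ht).ne'
  unfold snDensity
  refine ContinuousOn.mul (ContinuousOn.mul ?_ ?_) ?_
  · exact ContinuousOn.div (by fun_prop) (by fun_prop) fun t ht => (Set.mem_ofPred_eq ▸ ht).ne'
  · exact continuous_npdf.comp_continuousOn h
  · exact continuous_ncdf.comp_continuousOn (ContinuousOn.mul (by fun_prop) h)

theorem continuousOn_mixDensity (x : ℝ) :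
    ContinuousOn (fun Ψ : Param m => mixDensity Ψ x) {Ψ | ∀ k, 0 < scale Ψ k} := by
  unfold mixDensity
  refine continuousOn_finsetSum _ fun k _ => (continuous_weight k).continuousOn.mul ?_
  exact (continuousOn_snDensity x).comp (f := fun Ψ : Param m => (loc Ψ k, scale Ψ k, shape Ψ k))
    ((continuous_loc k).prodMk ((continuous_scale k).prodMk (continuous_shape k))).continuousOn
    fun Ψ hΨ => hΨ k

/-- The extended parameters which agree with `Ψ` up to `ε` in every coordinate, after some
renumbering. -/
def extNhd (Ψ : Param m) (ε : ℝ) : Set (ExtParam m) :=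
  ⋃ τ : Equiv.Perm (Fin (m + 1)), ⋂ k, {θ | θ (τ k) ∈
    Set.Ioo (weight Ψ k - ε) (weight Ψ k + ε) ×ˢ
    Set.Ioo ((loc Ψ k - ε : ℝ) : EReal) (loc Ψ k + ε : ℝ) ×ˢ
    Set.Ioo ((scale Ψ k - ε : ℝ) : EReal) (scale Ψ k + ε : ℝ) ×ˢ
    Set.Ioo ((shape Ψ k - ε : ℝ) : EReal) (shape Ψ k + ε : ℝ)}

theorem isOpen_extNhd (Ψ : Param m) (ε : ℝ) : IsOpen (extNhd Ψ ε) := by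
  refine isOpen_iUnion fun τ => isOpen_iInter_of_finite fun k => ?_
  exact (isOpen_Ioo.prod (isOpen_Ioo.prod (isOpen_Ioo.prod isOpen_Ioo))).preimage
    (continuous_apply _)

theorem exists_dist_relabel_le {Ψ Ψ₀ : Param m} {ε : ℝ} (hε : 0 < ε)
    (h : toExt Ψ ∈ extNhd Ψ₀ ε) :
    ∃ τ, dist (relabel τ Ψ) Ψ₀ ≤ (Fintype.card (Idx m) + 1) * ε := by
  obtain ⟨τ, hτ⟩ := Set.mem_iUnion.1 h
  refine ⟨τ, ?_⟩
  have hc : ∀ k, |weight Ψ (τ k) - weight Ψ₀ k| ≤ ε ∧ |loc Ψ (τ k) - loc Ψ₀ k| ≤ ε ∧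
      |scale Ψ (τ k) - scale Ψ₀ k| ≤ ε ∧ |shape Ψ (τ k) - shape Ψ₀ k| ≤ ε := by
    intro k
    obtain ⟨⟨h1, h2⟩, ⟨h3, h4⟩, ⟨h5, h6⟩, ⟨h7, h8⟩⟩ := Set.mem_iInter.1 hτ k
    simp only [toExt, EReal.coe_lt_coe_iff] at h1 h2 h3 h4 h5 h6 h7 h8
    simp only [abs_le]
    refine ⟨⟨?_, ?_⟩, ⟨?_, ?_⟩, ⟨?_, ?_⟩, ⟨?_, ?_⟩⟩ <;> linarith
  have hi : ∀ i : Idx m, dist (relabel τ Ψ i) (Ψ₀ i) ≤ ε := by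
    rintro (j | k | k | k)
    · have := (hc j.castSucc).1
      simpa [Real.dist_eq, relabel, weight] using this
    · exact (hc k).2.1
    · exact (hc k).2.2.1
    · exact (hc k).2.2.2
  rw [EuclideanSpace.dist_eq]
  refine Real.sqrt_le_iff.2 ⟨by positivity, ?_⟩
  calc ∑ i, dist (relabel τ Ψ i) (Ψ₀ i) ^ 2 ≤ ∑ _i : Idx m, ε ^ 2 :=
        Finset.sum_le_sum fun i _ => pow_le_pow_left₀ dist_nonneg (hi i) 2
    _ = Fintype.card (Idx m) * ε ^ 2 := by rw [Finset.sum_const, Finset.card_univ, nsmul_eq_mul]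
    _ ≤ _ := by
      have : (0 : ℝ) ≤ Fintype.card (Idx m) := by positivity
      rw [mul_pow]
      gcongr
      nlinarith

/-- The penalty vanishes at `0` by C3, and by C4 its derivative is at most `√n` between `0` and
`lam`, so its value at `lam` is at most `√n * |lam|` in size, which is `o(n)`. -/
theorem eventually_neg_mul_le_shape_penalty {q r : ℕ → ℝ → ℝ} (hC3 : C3 r) (hC4 : C4 q r)
    (lam : ℝ) {ε : ℝ} (hε : 0 < ε) : ∀ᶠ n : ℕ in atTop, -(ε * n) ≤ r n lam := by
  have hu := (tendstoLocallyUniformlyOn_iff_tendstoUniformlyOn_of_compact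
    (isCompact_uIcc (a := (0 : ℝ)) (b := lam))).1
    (hC4.2.2.2.tendstoLocallyUniformlyOn (s := Set.uIcc 0 lam))
  have hu := Metric.tendstoUniformlyOn_iff.1 hu 1 one_pos
  have hl : ∀ᶠ n : ℕ in atTop, |lam| / ε ≤ √(n : ℝ) :=
    (Real.tendsto_sqrt_atTop.comp tendsto_natCast_atTop_atTop).eventually_ge_atTop _
  filter_upwards [hC3, hC4.2.1, hu, hl, eventually_gt_atTop 0] with n h3 hd hu hl hn
  have hs : 0 < √(n : ℝ) := Real.sqrt_pos.2 (by exact_mod_cast hn)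
  have h := (convex_uIcc 0 lam).norm_image_sub_le_of_norm_deriv_le (f := r n)
    (C := √n) (fun x _ => hd x) (fun x hx => ?_) (Set.left_mem_uIcc)
    (Set.right_mem_uIcc)
  · rw [h3.2.2.2.2, sub_zero, sub_zero, Real.norm_eq_abs, Real.norm_eq_abs] at h
    have h1 : |lam| ≤ ε * √n := by rwa [div_le_iff₀' hε] at hl
    have h2 : √(n : ℝ) * |lam| ≤ ε * n := by
      calc √(n : ℝ) * |lam| ≤ √n * (ε * √n) := by gcongr
        _ = ε * (√n * √n) := by ring
        _ = ε * n := by rw [Real.mul_self_sqrt (by positivity)]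
    linarith [(abs_le.1 h).1]
  · have := hu x hx
    rw [dist_zero_left, norm_div, Real.norm_of_nonneg hs.le, div_lt_one hs] at this
    exact this.le

theorem eventually_neg_mul_le_penalty {q r : ℕ → ℝ → ℝ} (hC1 : C1 q) (hC3 : C3 r) (hC4 : C4 q r)
    {Ψ₀ : Param m} (hΨ₀ : Ψ₀ ∈ paramSpace m) {ε : ℝ} (hε : 0 < ε) :
    ∀ᶠ n : ℕ in atTop, -(2 * (m + 1) * ε * n) ≤
      (∑ k, q n (scale Ψ₀ k)) + ∑ k, r n (shape Ψ₀ k) := by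
  have h1 : ∀ᶠ n : ℕ in atTop, ∀ k, -(ε * n) ≤ q n (scale Ψ₀ k) := by
    refine eventually_all.2 fun k => ?_
    filter_upwards [(hC1.1 _ (hΨ₀ k).2).def hε] with n hn
    rw [Real.norm_eq_abs, Real.norm_of_nonneg (by positivity)] at hn
    exact (abs_le.1 hn).1
  have h2 : ∀ᶠ n : ℕ in atTop, ∀ k, -(ε * n) ≤ r n (shape Ψ₀ k) :=
    eventually_all.2 fun k => eventually_neg_mul_le_shape_penalty hC3 hC4 _ hε
  filter_upwards [h1, h2] with n h1 h2
  have e1 := Finset.sum_le_sum fun k (_ : k ∈ Finset.univ) => h1 k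
  have e2 := Finset.sum_le_sum fun k (_ : k ∈ Finset.univ) => h2 k
  simp only [Finset.sum_const, Finset.card_univ, Fintype.card_fin, nsmul_eq_mul] at e1 e2
  push_cast at e1 e2
  linarith

variable {Ω : Type*} [MeasurableSpace Ω] {P : Measure Ω}
  {X : ℕ → Ω → ℝ} {Ψ₀ : Param m}

/-- The uniform law of large numbers, with genuine parameters embedded in the compact extended
space. The levels `A` are natural numbers so that one null set serves all of them. -/
theorem ae_eventually_sum_truncLog_le (hΨ₀ : Ψ₀ ∈ paramSpace m) (hindep : iIndepFun X P)
    (hlaw : ∀ i, HasLaw (X i) (mixLaw Ψ₀) P) {K : Set (ExtParam m)} (hK : IsCompact K)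
    (hKS : K ⊆ extSpace m) (hne : ∀ θ ∈ K, ¬ ∀ᵐ x, mixExt θ x = mixDensity Ψ₀ x) :
    ∃ c : ℝ, 0 < c ∧ ∀ᵐ ω ∂P, ∀ A : ℕ, ∀ᶠ n : ℕ in atTop, ∀ Ψ ∈ paramSpace m, toExt Ψ ∈ K →
      ∑ i ∈ Finset.range n, truncLog A (mixDensity Ψ (X i ω)) (mixDensity Ψ₀ (X i ω)) ≤ -c * n := by
  obtain ⟨c, hc, hcK⟩ := exists_forall_integral_truncLog_le hΨ₀ hK hKS hne
  refine ⟨c / 2, half_pos hc, ae_all_iff.2 fun A => ?_⟩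
  have := isProbabilityMeasure_mixLaw hΨ₀
  have hA : (0 : ℝ) ≤ A := Nat.cast_nonneg A
  have hp := mixDensity_pos hΨ₀
  have hcont : ∀ x, Continuous fun γ : paramSpace m => mixDensity γ.1 x := fun x =>
    continuousOn_iff_continuous_domRestrict.1
      ((continuousOn_mixDensity x).mono fun Ψ hΨ k => (hΨ k).2)
  have h := eventually_forall_sum_le_of_isCompact hindep hlaw
    (emb := fun γ : paramSpace m => toExt γ.1) (continuous_toExt.comp continuous_subtype_val)
    (v := fun γ x => truncLog A (mixDensity γ.1 x) (mixDensity Ψ₀ x))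
    (B := fun x => Real.log 2 + Real.log (1 + A) + |Real.log (mixDensity Ψ₀ x)|)
    (vbar := fun θ x => truncLog A (mixExt θ x) (mixDensity Ψ₀ x)) (c := -(c / 2))
    ?_ ?_ ?_ ?_ hK ?_ ?_
  · filter_upwards [h] with ω hω
    filter_upwards [hω] with n hn Ψ hΨ hK using hn ⟨Ψ, hΨ⟩ hK
  · intro γ
    unfold truncLog
    have h1 := (continuous_mixDensity γ.1).measurable
    have h2 := (continuous_mixDensity Ψ₀).measurable
    exact (((h1.min measurable_const).add h2).div (h2.const_mul 2)).log
  · intro x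
    have hpx := hp x
    unfold truncLog
    refine Continuous.log ((((hcont x).min continuous_const).add continuous_const).div_const _) ?_
    intro γ
    have : 0 ≤ min (mixDensity γ.1 x) A := le_min (mixDensity_pos γ.2 x).le hA
    positivity
  · exact (integrable_const _).add (integrable_log_mixDensity hΨ₀)
  · exact fun γ x => abs_truncLog_le hA (mixDensity_pos γ.2 x).le (hp x)
  · intro θ hθ
    rw [ae_mixLaw_iff hΨ₀]
    filter_upwards [ae_continuousAt_mixExt θ] with x hx
    have hpx := hp x
    have h0 := mixExt_nonneg (hKS hθ) x
    have h1 : Tendsto (fun γ : paramSpace m => mixDensity γ.1 x)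
        (comap (fun γ : paramSpace m => toExt γ.1) (𝓝 θ)) (𝓝 (mixExt θ x)) := by
      refine (hx.tendsto.comp tendsto_comap).congr fun γ => ?_
      exact mixExt_toExt γ.2 x
    unfold truncLog
    refine Tendsto.log (((h1.min tendsto_const_nhds).add_const _).div_const _) ?_
    have : 0 ≤ min (mixExt θ x) A := le_min h0 hA
    positivity
  · intro θ hθ
    linarith [hcK A hA θ hθ]

/-- Pathwise, a penalized maximum likelihood estimator is not in a set of parameters over which
the mean truncated log-likelihood ratio is negative. -/
theorem eventually_notMem_of_sum_truncLog_le {x : ℕ → ℝ} {q r : ℕ → ℝ → ℝ} (hC1 : C1 q)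
    (hC2 : C2 q) (hC3 : C3 r) (hC4 : C4 q r) (hΨ₀ : Ψ₀ ∈ paramSpace m)
    {M : ℝ} (hM : 1 ≤ M)
    (hwin : ∀ᶠ n : ℕ in atTop, ∀ a ℓ : ℝ, 0 ≤ ℓ →
      (((Finset.range n).filter fun i => x i ∈ Set.Icc a (a + ℓ)).card : ℝ) ≤
        2 * M * n * (ℓ + 2 * mesh n))
    (hspace : ∀ᶠ n : ℕ in atTop, ∀ i < n, ∀ j < n, i ≠ j → 1 / (n : ℝ) ^ 4 < |x i - x j|)
    {S : Set (Param m)} {c : ℝ} (hc : 0 < c)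
    (hS : ∀ A : ℕ, ∀ᶠ n : ℕ in atTop, ∀ Ψ ∈ paramSpace m, Ψ ∈ S →
      ∑ i ∈ Finset.range n, truncLog A (mixDensity Ψ (x i)) (mixDensity Ψ₀ (x i)) ≤ -c * n) :
    ∀ᶠ n : ℕ in atTop, ∀ Ψ, IsPMLE n x (q n) (r n) Ψ → Ψ ∉ S := by
  have hm : (0 : ℝ) < m + 1 := by positivity
  -- With this `ε` the `m + 1` scale terms cost at most `c * n / 4` and the penalty at `Ψ₀` at most
  -- `c * n / 2`, less than the `2 * c * n` lost in the truncated ratio.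
  set ε := c / (4 * (m + 1)) with hε
  have hεpos : 0 < ε := by positivity
  have hεm : (m + 1) * ε = c / 4 := by rw [hε]; field_simp
  obtain ⟨A, hA, hpen⟩ := eventually_penalty_add_sum_le hC1 hC2 hM hwin hspace hεpos
  have hA' : (1 : ℝ) ≤ A := by exact_mod_cast hA
  filter_upwards [hpen, hS A, eventually_neg_mul_le_penalty hC1 hC3 hC4 hΨ₀ hεpos, hC3,
    eventually_gt_atTop 0] with n hpen hS h0 h3 hn Ψ hΨ hmem
  have hn' : (0 : ℝ) < n := by exact_mod_cast hn
  have hsn : ∀ k y, 0 < snDensity (loc Ψ k) (scale Ψ k) (shape Ψ k) y := fun k y =>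
    snDensity_pos (hΨ.1 k).2 _ _ _
  have hmax := hΨ.2 hΨ₀
  simp only [Set.mem_ofPred_eq, penLogLik, logLik] at hmax
  have h1 : ∑ i ∈ Finset.range n, (Real.log (mixDensity Ψ (x i)) -
      Real.log (mixDensity Ψ₀ (x i))) ≤
      ∑ i ∈ Finset.range n, 2 * (truncLog A (mixDensity Ψ (x i)) (mixDensity Ψ₀ (x i)) +
        ∑ k, max 0 (Real.log (snDensity (loc Ψ k) (scale Ψ k) (shape Ψ k) (x i) / A))) :=
    Finset.sum_le_sum fun i _ => log_sub_log_le (fun k => (hΨ.1 k).1) (weight_sum Ψ)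
      (fun k => hsn k (x i)) hA' (mixDensity_pos hΨ₀ _) (mixDensity_pos hΨ.1 _)
  rw [Finset.sum_sub_distrib, ← Finset.mul_sum, Finset.sum_add_distrib, Finset.sum_comm] at h1
  have h2 := Finset.sum_le_sum fun k (_ : k ∈ Finset.univ) =>
    hpen (loc Ψ k) (scale Ψ k) (shape Ψ k) (hΨ.1 k).2
  rw [Finset.sum_add_distrib, ← Finset.mul_sum, Finset.sum_const, Finset.card_univ,
    Fintype.card_fin, nsmul_eq_mul] at h2
  push_cast at h2
  have h4 : ∑ k, r n (shape Ψ k) ≤ 0 := Finset.sum_nonpos fun k _ => by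
    have := h3.2.1 (shape Ψ k)
    rwa [h3.2.2.2.2] at this
  have h5 := hS Ψ hΨ.1 hmem
  have e1 : ((m : ℝ) + 1) * (ε * n) = c / 4 * n := by rw [← mul_assoc, hεm]
  have e2 : 2 * ((m : ℝ) + 1) * ε * n = c / 2 * n := by
    rw [mul_assoc 2, hεm]; ring
  rw [e1] at h2
  rw [e2] at h0
  have : 0 < c * n := by positivity
  linarith

/-- Strong consistency of the penalized maximum likelihood estimator. -/
theorem ae_tendsto_of_isPMLE [IsProbabilityMeasure P] (hΨ₀ : Ψ₀ ∈ paramSpace m) (hw : ∀ k, 0 < weight Ψ₀ k)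
    (hshape : ∀ k, shape Ψ₀ k ≠ 0)
    (hdist : ∀ k l, k ≠ l →
      (loc Ψ₀ k, scale Ψ₀ k, |shape Ψ₀ k|) ≠ (loc Ψ₀ l, scale Ψ₀ l, |shape Ψ₀ l|))
    (hindep : iIndepFun X P) (hlaw : ∀ i, HasLaw (X i) (mixLaw Ψ₀) P) {q r : ℕ → Ω → ℝ → ℝ}
    (hC1 : ∀ᵐ ω ∂P, C1 (fun n => q n ω)) (hC2 : ∀ᵐ ω ∂P, C2 (fun n => q n ω))
    (hC3 : ∀ᵐ ω ∂P, C3 (fun n => r n ω))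
    (hC4 : ∀ᵐ ω ∂P, C4 (fun n => q n ω) (fun n => r n ω)) {Ψ : ℕ → Ω → Param m}
    (hPMLE : ∀ᵐ ω ∂P, ∀ᶠ n in atTop, IsPMLE n (fun i => X i ω) (q n ω) (r n ω) (Ψ n ω))
    (hlabel : ∀ᵐ ω ∂P, ∀ᶠ n in atTop, ∀ τ : Equiv.Perm (Fin (m + 1)),
      dist (Ψ n ω) Ψ₀ ≤ dist (relabel τ (Ψ n ω)) Ψ₀) :
    ∀ᵐ ω ∂P, Tendsto (fun n => Ψ n ω) atTop (𝓝 Ψ₀) := by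
  obtain ⟨M, hM, -, hQ⟩ := mixLaw_Icc_le hΨ₀
  set D : ℝ := Fintype.card (Idx m) + 1 with hD
  have hDpos : 0 < D := by positivity
  have hkey : ∀ N : ℕ, ∃ c : ℝ, 0 < c ∧ ∀ᵐ ω ∂P, ∀ A : ℕ, ∀ᶠ n : ℕ in atTop,
      ∀ Ψ ∈ paramSpace m, toExt Ψ ∈ extSpace m \ extNhd Ψ₀ (1 / (N + 1)) →
      ∑ i ∈ Finset.range n, truncLog A (mixDensity Ψ (X i ω)) (mixDensity Ψ₀ (X i ω)) ≤
        -c * n := by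
    intro N
    -- By identifiability, every extended parameter with the true density is a renumbering of `Ψ₀`
    -- and so lies in the removed open set; what remains is compact.
    refine ae_eventually_sum_truncLog_le hΨ₀ hindep hlaw
      (isCompact_extSpace.diff (isOpen_extNhd _ _)) Set.sdiff_subset fun θ hθ h => hθ.2 ?_
    obtain ⟨τ, hτ⟩ := exists_perm_of_mixExt_ae_eq hΨ₀ hw hshape hdist hθ.1.1 h
    refine Set.mem_iUnion.2 ⟨τ, Set.mem_iInter.2 fun k => ?_⟩
    have hN : (0 : ℝ) < 1 / (N + 1) := by positivity
    simp only [Set.mem_ofPred_eq, hτ k, toExt, Set.mem_prod, Set.mem_Ioo, EReal.coe_lt_coe_iff]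
    refine ⟨⟨?_, ?_⟩, ⟨?_, ?_⟩, ⟨?_, ?_⟩, ⟨?_, ?_⟩⟩ <;> linarith
  choose c hc hae using hkey
  filter_upwards [ae_all_iff.2 hae, hC1, hC2, hC3, hC4, hPMLE, hlabel,
    ae_eventually_grid_count_le hindep hlaw hM hQ,
    ae_eventually_abs_le hindep hlaw (integrable_sq_mixLaw hΨ₀),
    ae_eventually_spacing hindep hlaw hM hQ] with ω hae hC1 hC2 hC3 hC4 hP hl hg ha hs
  have hwin : ∀ᶠ n : ℕ in atTop, ∀ a ℓ : ℝ, 0 ≤ ℓ →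
      (((Finset.range n).filter fun i => X i ω ∈ Set.Icc a (a + ℓ)).card : ℝ) ≤
        2 * M * n * (ℓ + 2 * mesh n) := by
    filter_upwards [hg, ha, eventually_ge_atTop 4] with n hg ha hn a ℓ hℓ
    exact card_window_le hn hM hg ha hℓ
  rw [Metric.tendsto_nhds]
  intro ε hε
  obtain ⟨N, hN⟩ := exists_nat_one_div_lt (div_pos hε hDpos)
  filter_upwards [eventually_notMem_of_sum_truncLog_le hC1 hC2 hC3 hC4 hΨ₀ hM hwin hs
    (S := toExt ⁻¹' (extSpace m \ extNhd Ψ₀ (1 / (N + 1)))) (hc N) (hae N), hP, hl]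
    with n hn hP hl
  have h := hn _ hP
  have hmem : toExt (Ψ n ω) ∈ extNhd Ψ₀ (1 / (N + 1)) := by
    by_contra hcon
    exact h ⟨toExt_mem_extSpace hP.1, hcon⟩
  obtain ⟨τ, hτ⟩ := exists_dist_relabel_le (by positivity) hmem
  -- The numbering of the estimator is the best one, so closeness after some renumbering gives
  -- closeness itself.
  refine (hl τ).trans_lt (hτ.trans_lt ?_)
  rwa [lt_div_iff₀' hDpos] at hN

end Consistency

/-! ### Calculus of bounds on functions and their first two derivatives. -/

section JetBounds

variable {E : Type*} [NormedAddCommGroup E] [NormedSpace ℝ E]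

/-- `F` is twice continuously differentiable at `Ψ`, and its value and its first two derivatives
there are bounded by `B`. -/
structure JetBound (F : E → ℝ) (Ψ : E) (B : ℝ) : Prop where
  contDiffAt : ContDiffAt ℝ 2 F Ψ
  abs_le : |F Ψ| ≤ B
  norm_fderiv_le : ‖fderiv ℝ F Ψ‖ ≤ B
  norm_fderiv_fderiv_le : ‖fderiv ℝ (fderiv ℝ F) Ψ‖ ≤ B

theorem ContDiffAt.eventually_differentiableAt_two {F : E → ℝ} {Ψ : E}
    (h : ContDiffAt ℝ 2 F Ψ) : ∀ᶠ y in 𝓝 Ψ, DifferentiableAt ℝ F y := by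
  filter_upwards [h.eventually (by simp)] with y hy using hy.differentiableAt (by simp)

theorem ContDiffAt.differentiableAt_fderiv_two {F : E → ℝ} {Ψ : E}
    (h : ContDiffAt ℝ 2 F Ψ) : DifferentiableAt ℝ (fderiv ℝ F) Ψ :=
  (h.fderiv_right (m := 1) (by norm_num)).differentiableAt (by simp)

theorem fderiv_add_fderiv {F G : E → ℝ} {Ψ : E} (hF : ContDiffAt ℝ 2 F Ψ)
    (hG : ContDiffAt ℝ 2 G Ψ) :
    fderiv ℝ (fun y => F y + G y) =ᶠ[𝓝 Ψ] fun y => fderiv ℝ F y + fderiv ℝ G y := by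
  filter_upwards [hF.eventually_differentiableAt_two, hG.eventually_differentiableAt_two]
    with y h1 h2 using fderiv_fun_add h1 h2

theorem fderiv_mul_fderiv {F G : E → ℝ} {Ψ : E} (hF : ContDiffAt ℝ 2 F Ψ)
    (hG : ContDiffAt ℝ 2 G Ψ) :
    fderiv ℝ (fun y => F y * G y) =ᶠ[𝓝 Ψ]
      fun y => F y • fderiv ℝ G y + G y • fderiv ℝ F y := by
  filter_upwards [hF.eventually_differentiableAt_two, hG.eventually_differentiableAt_two]
    with y h1 h2 using fderiv_fun_mul h1 h2

theorem norm_smul_le_of_abs_le {V : Type*} [NormedAddCommGroup V] [NormedSpace ℝ V] (a : ℝ) (v : V)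
    {s t : ℝ} (h1 : |a| ≤ s) (h2 : 0 ≤ s) (h3 : ‖v‖ ≤ t) : ‖a • v‖ ≤ s * t := by
  rw [norm_smul]
  exact mul_le_mul h1 h3 (norm_nonneg _) h2

namespace JetBound

variable {F G : E → ℝ} {Ψ : E} {A B : ℝ}

theorem nonneg (hF : JetBound F Ψ A) : 0 ≤ A := (abs_nonneg _).trans hF.abs_le

theorem mono (hF : JetBound F Ψ A) (h : A ≤ B) : JetBound F Ψ B :=
  ⟨hF.1, hF.2.trans h, hF.3.trans h, hF.4.trans h⟩

theorem congr (hF : JetBound F Ψ A) (h : G =ᶠ[𝓝 Ψ] F) : JetBound G Ψ A := by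
  refine ⟨hF.1.congr_of_eventuallyEq h, ?_, ?_, ?_⟩
  · rw [h.eq_of_nhds]; exact hF.2
  · rw [h.fderiv_eq]; exact hF.3
  · rw [h.fderiv.fderiv_eq]; exact hF.4

theorem const (c : ℝ) (Ψ : E) : JetBound (fun _ => c) Ψ |c| := by
  have h : fderiv ℝ (fun _ : E => c) = fun _ => 0 := by ext1 y; simp
  refine ⟨contDiffAt_const, le_rfl, ?_, ?_⟩
  · rw [h, norm_zero]; exact abs_nonneg c
  · rw [h, fderiv_fun_const]; exact (norm_zero (E := E →L[ℝ] E →L[ℝ] ℝ)).le.trans (abs_nonneg c)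

theorem add (hF : JetBound F Ψ A) (hG : JetBound G Ψ B) :
    JetBound (fun y => F y + G y) Ψ (A + B) := by
  refine ⟨hF.1.add hG.1, (abs_add_le _ _).trans (add_le_add hF.2 hG.2), ?_, ?_⟩
  · rw [(fderiv_add_fderiv hF.1 hG.1).eq_of_nhds]
    exact (norm_add_le _ _).trans (add_le_add hF.3 hG.3)
  · rw [(fderiv_add_fderiv hF.1 hG.1).fderiv_eq,
      fderiv_fun_add hF.1.differentiableAt_fderiv_two hG.1.differentiableAt_fderiv_two]
    have h := norm_add_le (fderiv ℝ (fderiv ℝ F) Ψ) (fderiv ℝ (fderiv ℝ G) Ψ)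
    exact h.trans (add_le_add (α := ℝ) hF.4 hG.4)

/-- The second derivative of a product has four terms, each bounded by `A * B`. -/
theorem mul (hF : JetBound F Ψ A) (hG : JetBound G Ψ B) :
    JetBound (fun y => F y * G y) Ψ (4 * A * B) := by
  have hA := hF.nonneg
  have hB := hG.nonneg
  have hAB := mul_nonneg hA hB
  refine ⟨hF.1.mul hG.1, ?_, ?_, ?_⟩
  · rw [abs_mul]
    have := mul_le_mul hF.2 hG.2 (abs_nonneg _) hA
    linarith
  · rw [(fderiv_mul_fderiv hF.1 hG.1).eq_of_nhds]
    refine (norm_add_le _ _).trans ?_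
    have h1 := norm_smul_le_of_abs_le _ (fderiv ℝ G Ψ) hF.2 hA hG.3
    have h2 := norm_smul_le_of_abs_le _ (fderiv ℝ F Ψ) hG.2 hB hF.3
    linarith
  · rw [(fderiv_mul_fderiv hF.1 hG.1).fderiv_eq]
    have dF := (hF.1.differentiableAt (by simp)).hasFDerivAt
    have dG := (hG.1.differentiableAt (by simp)).hasFDerivAt
    have d := (dF.smul hG.1.differentiableAt_fderiv_two.hasFDerivAt).add
      (dG.smul hF.1.differentiableAt_fderiv_two.hasFDerivAt)
    rw [show fderiv ℝ (fun y => F y • fderiv ℝ G y + G y • fderiv ℝ F y) Ψ = _ from d.fderiv]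
    have h1 := norm_smul_le_of_abs_le _ (fderiv ℝ (fderiv ℝ G) Ψ) hF.2 hA hG.4
    have h2 := norm_smul_le_of_abs_le _ (fderiv ℝ (fderiv ℝ F) Ψ) hG.2 hB hF.4
    have h3 : ‖(fderiv ℝ F Ψ).smulRight (fderiv ℝ G Ψ)‖ ≤ A * B := by
      rw [ContinuousLinearMap.norm_smulRight_apply]
      exact mul_le_mul hF.3 hG.3 (norm_nonneg _) hA
    have h4 : ‖(fderiv ℝ G Ψ).smulRight (fderiv ℝ F Ψ)‖ ≤ B * A := by
      rw [ContinuousLinearMap.norm_smulRight_apply]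
      exact mul_le_mul hG.3 hF.3 (norm_nonneg _) hB
    refine (norm_add_le (E := E →L[ℝ] E →L[ℝ] ℝ) _ _).trans ?_
    have h5 := norm_add_le (F Ψ • fderiv ℝ (fderiv ℝ G) Ψ)
      ((fderiv ℝ F Ψ).smulRight (fderiv ℝ G Ψ))
    have h6 := norm_add_le (G Ψ • fderiv ℝ (fderiv ℝ F) Ψ)
      ((fderiv ℝ G Ψ).smulRight (fderiv ℝ F Ψ))
    linarith

/-- The second derivative is `φ'' F' ⊗ F' + φ' F''`, of norm at most `L * (A² + A)`. -/
theorem comp {φ : ℝ → ℝ} {L : ℝ} (hF : JetBound F Ψ A) (hφ : ContDiffAt ℝ 2 φ (F Ψ))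
    (h0 : |φ (F Ψ)| ≤ L) (h1 : |deriv φ (F Ψ)| ≤ L) (h2 : |deriv (deriv φ) (F Ψ)| ≤ L) :
    JetBound (fun y => φ (F y)) Ψ (L * (1 + A) ^ 2) := by
  have hA := hF.nonneg
  have hL : 0 ≤ L := (abs_nonneg _).trans h0
  have hLA := mul_nonneg hL hA
  have hLA2 := mul_nonneg hLA hA
  have hderiv : fderiv ℝ (fun y => φ (F y)) =ᶠ[𝓝 Ψ] fun y => deriv φ (F y) • fderiv ℝ F y := by
    have hφ' := hF.1.continuousAt.eventually hφ.eventually_differentiableAt_two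
    filter_upwards [hF.1.eventually_differentiableAt_two, hφ'] with y d1 d2
    exact (d2.hasDerivAt.comp_hasFDerivAt y d1.hasFDerivAt).fderiv
  refine ⟨ContDiffAt.comp Ψ hφ hF.1, by nlinarith, ?_, ?_⟩
  · rw [hderiv.eq_of_nhds, norm_smul]
    have := mul_le_mul h1 hF.3 (norm_nonneg _) hL
    rw [Real.norm_eq_abs]
    nlinarith
  · rw [hderiv.fderiv_eq]
    have dF := (hF.1.differentiableAt (by simp)).hasFDerivAt
    have dφ : HasDerivAt (deriv φ) (deriv (deriv φ) (F Ψ)) (F Ψ) := by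
      have : ContDiffAt ℝ 1 (deriv φ) (F Ψ) := by
        have h := hφ.fderiv_right (m := 1) (by norm_num)
        exact (h.clm_apply (contDiffAt_const (c := (1 : ℝ)))).congr_of_eventuallyEq
          (.of_forall fun y => fderiv_apply_one_eq_deriv.symm)
      exact (this.differentiableAt (by simp)).hasDerivAt
    have d := (dφ.comp_hasFDerivAt Ψ dF).smul hF.1.differentiableAt_fderiv_two.hasFDerivAt
    rw [show fderiv ℝ (fun y => deriv φ (F y) • fderiv ℝ F y) Ψ = _ from d.fderiv]
    refine (norm_add_le (E := E →L[ℝ] E →L[ℝ] ℝ) _ _).trans ?_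
    have e1 := norm_smul_le_of_abs_le _ (fderiv ℝ (fderiv ℝ F) Ψ) h1 hL hF.4
    have e2 : ‖(deriv (deriv φ) (F Ψ) • fderiv ℝ F Ψ).smulRight (fderiv ℝ F Ψ)‖ ≤ L * A * A := by
      rw [ContinuousLinearMap.norm_smulRight_apply]
      exact mul_le_mul (norm_smul_le_of_abs_le _ _ h2 hL hF.3) hF.3 (norm_nonneg _) hLA
    simp only [Function.comp_apply]
    nlinarith

theorem sum {ι : Type*} {F : ι → E → ℝ} {A : ι → ℝ} (s : Finset ι)
    (h : ∀ i ∈ s, JetBound (F i) Ψ (A i)) :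
    JetBound (fun y => ∑ i ∈ s, F i y) Ψ (∑ i ∈ s, A i) := by
  classical
  induction s using Finset.induction_on with
  | empty => simpa using JetBound.const 0 Ψ
  | insert i s hi ih =>
    simp only [Finset.sum_insert hi]
    exact (h i (Finset.mem_insert_self i s)).add
      (ih fun j hj => h j (Finset.mem_insert_of_mem hj))

/-- The derivatives of a log-sum-exp are controlled by those of its terms. -/
theorem log_sum_exp {ι : Type*} [Fintype ι] [Nonempty ι] {g : ι → E → ℝ}
    (h : ∀ i, JetBound (g i) Ψ A) :
    JetBound (fun y => Real.log (∑ i, Real.exp (g i y))) Ψ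
      (A + 2 * (1 + Fintype.card ι * (1 + A) ^ 2) ^ 2) := by
  set S := ∑ i, Real.exp (g i Ψ) with hS
  have hA : 0 ≤ A := (h (Classical.arbitrary ι)).nonneg
  have hSpos : 0 < S := Finset.sum_pos (fun i _ => Real.exp_pos _) Finset.univ_nonempty
  set N : ℝ := (Fintype.card ι : ℝ) with hN
  have hN1 : 1 ≤ N := by rw [hN]; exact_mod_cast Fintype.card_pos
  -- Normalized by the constant `S`, the terms are at most `1` at `Ψ` and sum to `1` there. So no
  -- exponential of `A` enters the bound, and the outer logarithm is differentiated at `1`, where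
  -- its derivatives are bounded by `1`.
  have hterm : ∀ i, JetBound (fun y => Real.exp (g i y - Real.log S)) Ψ (1 * (1 + A) ^ 2) := by
    intro i
    have hle : |Real.exp (g i Ψ - Real.log S)| ≤ 1 := by
      rw [abs_of_pos (Real.exp_pos _), Real.exp_sub, Real.exp_log hSpos, div_le_one hSpos]
      exact Finset.single_le_sum (f := fun i => Real.exp (g i Ψ))
        (fun j _ => (Real.exp_pos _).le) (Finset.mem_univ i)
    have hd : deriv (fun t => Real.exp (t - Real.log S)) = fun t => Real.exp (t - Real.log S) := by
      ext t
      simp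
    refine (h i).comp (φ := fun t => Real.exp (t - Real.log S)) (by fun_prop) hle ?_ ?_
    · rw [hd]; exact hle
    · rw [hd, hd]; exact hle
  have hsum := JetBound.sum Finset.univ fun i _ => hterm i
  simp only [one_mul, Finset.sum_const, Finset.card_univ, nsmul_eq_mul] at hsum
  have hone : ∑ i, Real.exp (g i Ψ - Real.log S) = 1 := by
    simp_rw [Real.exp_sub, Real.exp_log hSpos]
    rw [← Finset.sum_div, div_self hSpos.ne']
  have hlog := hsum.comp (φ := Real.log) (L := 1) (by
      simp only [hone]; exact Real.contDiffAt_log.2 one_ne_zero) (by simp [hone]) (by simp [hone])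
      (by simp [hone])
  have hc : |Real.log S| ≤ A + (1 + N * (1 + A) ^ 2) ^ 2 := by
    have hNA : N ≤ N * (1 + A) ^ 2 := le_mul_of_one_le_right (by linarith) (by nlinarith)
    have h1 : S ≤ N * Real.exp A := by
      rw [hN, ← nsmul_eq_mul, ← Finset.card_univ, ← Finset.sum_const]
      exact Finset.sum_le_sum fun i _ => Real.exp_le_exp.2 ((le_abs_self _).trans (h i).2)
    have h2 := Real.log_le_log hSpos h1
    rw [Real.log_mul (by linarith) (Real.exp_pos _).ne', Real.log_exp] at h2
    have h3 := Real.log_le_sub_one_of_pos (by linarith : 0 < N)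
    have i := Classical.arbitrary ι
    have h4 : g i Ψ ≤ Real.log S := by
      rw [Real.le_log_iff_exp_le hSpos]
      exact Finset.single_le_sum (f := fun i => Real.exp (g i Ψ))
        (fun j _ => (Real.exp_pos _).le) (Finset.mem_univ i)
    have h5 := (_root_.abs_le.1 (h i).abs_le).1
    rw [_root_.abs_le]
    constructor <;> nlinarith
  refine ((hlog.add (JetBound.const (Real.log S) Ψ)).mono (by linarith)).congr ?_
  refine .of_forall fun y => ?_
  have hy : 0 < ∑ i, Real.exp (g i y) :=
    Finset.sum_pos (fun i _ => Real.exp_pos _) Finset.univ_nonempty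
  simp_rw [Real.exp_sub, Real.exp_log hSpos, ← Finset.sum_div]
  rw [Real.log_div hy.ne' hSpos.ne', sub_add_cancel]

end JetBound

/-- Near `Ψ₀`, the functions `g · x` are twice continuously differentiable, and their values and
first two derivatives are of exponential growth in `x`, locally uniformly. -/
def TameAt (g : E → ℝ → ℝ) (Ψ₀ : E) : Prop :=
  ∃ C : ℝ, 0 ≤ C ∧ ∀ᶠ Ψ in 𝓝 Ψ₀, ∀ x, JetBound (fun Ψ' => g Ψ' x) Ψ (Real.exp (C * (1 + |x|)))

namespace TameAt

variable {g g' : E → ℝ → ℝ} {Ψ₀ : E}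

theorem congr (hg : TameAt g Ψ₀) (h : ∀ᶠ Ψ in 𝓝 Ψ₀, g' Ψ = g Ψ) : TameAt g' Ψ₀ := by
  obtain ⟨C, hC, hg⟩ := hg
  refine ⟨C, hC, ?_⟩
  filter_upwards [hg, h.eventually_nhds] with Ψ hg h x
  exact (hg x).congr (h.mono fun y hy => congrFun hy x)

theorem of_contDiffAt {F : E → ℝ} (hF : ContDiffAt ℝ 2 F Ψ₀) : TameAt (fun Ψ _ => F Ψ) Ψ₀ := by
  have h1 : ContDiffAt ℝ 1 (fderiv ℝ F) Ψ₀ := hF.fderiv_right (by norm_num)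
  have h2 : ContDiffAt ℝ 0 (fderiv ℝ (fderiv ℝ F)) Ψ₀ := h1.fderiv_right (by norm_num)
  set C := |F Ψ₀| + 1 + (‖fderiv ℝ F Ψ₀‖ + 1) + (‖fderiv ℝ (fderiv ℝ F) Ψ₀‖ + 1) with hC
  have hC0 : 0 ≤ C := by positivity
  refine ⟨C, hC0, ?_⟩
  filter_upwards [hF.eventually (by simp), hF.continuousAt.abs.eventually_le_const (lt_add_one _),
    h1.continuousAt.norm.eventually_le_const (lt_add_one _),
    (ContinuousAt.norm (E := E →L[ℝ] E →L[ℝ] ℝ) h2.continuousAt).eventually_le_const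
      (lt_add_one _)] with Ψ k0 k1 k2 k3 x
  have hx : C ≤ Real.exp (C * (1 + |x|)) := by
    have := Real.add_one_le_exp (C * (1 + |x|))
    nlinarith [mul_nonneg hC0 (abs_nonneg x)]
  have a0 := abs_nonneg (F Ψ₀)
  have a1 := norm_nonneg (fderiv ℝ F Ψ₀)
  have a2 := norm_nonneg (fderiv ℝ (fderiv ℝ F) Ψ₀)
  exact ⟨k0, by linarith, by linarith, by linarith⟩

theorem coord (Ψ₀ : E) : TameAt (fun _ x => x) Ψ₀ := by
  refine ⟨1, zero_le_one, .of_forall fun Ψ x => (JetBound.const x Ψ).mono ?_⟩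
  have := Real.add_one_le_exp (1 * (1 + |x|))
  linarith

theorem add (hg : TameAt g Ψ₀) (hg' : TameAt g' Ψ₀) : TameAt (fun Ψ x => g Ψ x + g' Ψ x) Ψ₀ := by
  obtain ⟨C, hC, h⟩ := hg
  obtain ⟨C', hC', h'⟩ := hg'
  refine ⟨C + C' + 1, by positivity, ?_⟩
  filter_upwards [h, h'] with Ψ h h' x
  refine ((h x).add (h' x)).mono ?_
  set u := 1 + |x| with hu
  have hu1 : 1 ≤ u := by rw [hu]; linarith [abs_nonneg x]
  have a1 : 1 ≤ Real.exp (C * u) := Real.one_le_exp (by positivity)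
  have a2 : 1 ≤ Real.exp (C' * u) := Real.one_le_exp (by positivity)
  have a3 : 2 ≤ Real.exp u := by linarith [Real.add_one_le_exp u]
  rw [show (C + C' + 1) * u = C * u + C' * u + u by ring, Real.exp_add, Real.exp_add]
  calc Real.exp (C * u) + Real.exp (C' * u) ≤ Real.exp (C * u) * Real.exp (C' * u) * 2 := by
        nlinarith
    _ ≤ _ := by gcongr

theorem mul (hg : TameAt g Ψ₀) (hg' : TameAt g' Ψ₀) : TameAt (fun Ψ x => g Ψ x * g' Ψ x) Ψ₀ := by
  obtain ⟨C, hC, h⟩ := hg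
  obtain ⟨C', hC', h'⟩ := hg'
  refine ⟨C + C' + 3, by positivity, ?_⟩
  filter_upwards [h, h'] with Ψ h h' x
  refine ((h x).mul (h' x)).mono ?_
  set u := 1 + |x| with hu
  have hu1 : 1 ≤ u := by rw [hu]; linarith [abs_nonneg x]
  have a3 : 4 ≤ Real.exp (3 * u) := by linarith [Real.add_one_le_exp (3 * u)]
  rw [show (C + C' + 3) * u = C * u + C' * u + 3 * u by ring, Real.exp_add, Real.exp_add]
  calc 4 * Real.exp (C * u) * Real.exp (C' * u)
      = Real.exp (C * u) * Real.exp (C' * u) * 4 := by ring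
    _ ≤ _ := by gcongr

/-- Composition with a function with derivatives of exponential growth, if the inner function is
of linear growth. -/
theorem comp (hg : TameAt g Ψ₀) {φ : ℝ → ℝ} (hφ : ContDiff ℝ 2 φ) {c : ℝ} (hc : 0 ≤ c)
    (h0 : ∀ t, |φ t| ≤ Real.exp (c * (1 + |t|))) (h1 : ∀ t, |deriv φ t| ≤ Real.exp (c * (1 + |t|)))
    (h2 : ∀ t, |deriv (deriv φ) t| ≤ Real.exp (c * (1 + |t|)))
    {D : ℝ} (hD : 0 ≤ D) (hlin : ∀ᶠ Ψ in 𝓝 Ψ₀, ∀ x, |g Ψ x| ≤ D * (1 + |x|)) :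
    TameAt (fun Ψ x => φ (g Ψ x)) Ψ₀ := by
  obtain ⟨C, hC, h⟩ := hg
  refine ⟨c * (1 + D) + 2 * C + 3, by positivity, ?_⟩
  filter_upwards [h, hlin] with Ψ h hlin x
  set u := 1 + |x| with hu
  have hu1 : 1 ≤ u := by rw [hu]; linarith [abs_nonneg x]
  have hL : Real.exp (c * (1 + |g Ψ x|)) ≤ Real.exp (c * (1 + D) * u) := by
    refine Real.exp_le_exp.2 ?_
    have := hlin x
    rw [mul_assoc]
    refine mul_le_mul_of_nonneg_left ?_ hc
    nlinarith
  refine ((h x).comp hφ.contDiffAt ((h0 _).trans hL) ((h1 _).trans hL) ((h2 _).trans hL)).mono ?_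
  have a1 : 1 ≤ Real.exp (C * u) := Real.one_le_exp (by positivity)
  have a3 : 4 ≤ Real.exp (3 * u) := by linarith [Real.add_one_le_exp (3 * u)]
  rw [show (c * (1 + D) + 2 * C + 3) * u = c * (1 + D) * u + (C * u + C * u) + 3 * u by ring,
    Real.exp_add, Real.exp_add, Real.exp_add (C * u)]
  calc Real.exp (c * (1 + D) * u) * (1 + Real.exp (C * u)) ^ 2
      ≤ Real.exp (c * (1 + D) * u) * (Real.exp (C * u) + Real.exp (C * u)) ^ 2 := by gcongr
    _ = Real.exp (c * (1 + D) * u) * (Real.exp (C * u) * Real.exp (C * u)) * 4 := by ring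
    _ ≤ _ := by gcongr

theorem log_sum_exp {ι : Type*} [Fintype ι] [Nonempty ι] {g : ι → E → ℝ → ℝ}
    (hg : ∀ i, TameAt (g i) Ψ₀) :
    TameAt (fun Ψ x => Real.log (∑ i, Real.exp (g i Ψ x))) Ψ₀ := by
  choose C hC h using hg
  set D := ∑ i, C i with hD
  have hD0 : 0 ≤ D := Finset.sum_nonneg fun i _ => hC i
  have hCD : ∀ i, C i ≤ D := fun i => Finset.single_le_sum (fun j _ => hC j) (Finset.mem_univ i)
  set N : ℝ := (Fintype.card ι : ℝ) with hN
  have hN1 : 1 ≤ N := by rw [hN]; exact_mod_cast Fintype.card_pos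
  -- With `a = exp (D * u) ≥ 1` the previous bound is at most `(1 + 2 * 5²) * N² * a⁴`.
  refine ⟨4 * D + 51 * N ^ 2, by positivity, ?_⟩
  filter_upwards [eventually_all.2 h] with Ψ h x
  set u := 1 + |x| with hu
  have hu1 : 1 ≤ u := by rw [hu]; linarith [abs_nonneg x]
  refine (JetBound.log_sum_exp (A := Real.exp (D * u)) fun i =>
    (h i x).mono (Real.exp_le_exp.2 (mul_le_mul_of_nonneg_right (hCD i) (by linarith)))).mono ?_
  have a1 : 1 ≤ Real.exp (D * u) := Real.one_le_exp (by positivity)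
  set a := Real.exp (D * u) with ha
  have a4 : Real.exp (4 * D * u) = a ^ 4 := by
    rw [ha, ← Real.exp_nat_mul]; congr 1; push_cast; ring
  have a5 : 51 * N ^ 2 ≤ Real.exp (51 * N ^ 2 * u) := by
    have := Real.add_one_le_exp (51 * N ^ 2 * u)
    nlinarith [mul_nonneg (sq_nonneg N) (sub_nonneg.2 hu1)]
  rw [add_mul, Real.exp_add, a4]
  have b1 : (1 + a) ^ 2 ≤ 4 * a ^ 2 := by nlinarith
  have b2 : 1 + N * (1 + a) ^ 2 ≤ 5 * N * a ^ 2 := by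
    have : 1 ≤ N * a ^ 2 := one_le_mul_of_one_le_of_one_le hN1 (one_le_pow₀ a1)
    nlinarith
  have b3 : a ≤ N ^ 2 * a ^ 4 := by
    calc a = 1 * a ^ 1 := by ring
      _ ≤ N ^ 2 * a ^ 4 := mul_le_mul (one_le_pow₀ hN1) (pow_le_pow_right₀ a1 (by norm_num))
        (by positivity) (by positivity)
  calc a + 2 * (1 + N * (1 + a) ^ 2) ^ 2 ≤ N ^ 2 * a ^ 4 + 2 * (5 * N * a ^ 2) ^ 2 := by gcongr
    _ = a ^ 4 * (51 * N ^ 2) := by ring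
    _ ≤ _ := by gcongr

end TameAt

end JetBounds

/-! ### Growth of the logarithm of the normal distribution function and its derivatives. -/

section LogNormalCDF

theorem contDiff_npdf {k : WithTop ℕ∞} : ContDiff ℝ k npdf := by
  have : npdf = fun t => (√(2 * Real.pi))⁻¹ * Real.exp (-t ^ 2 / 2) := by
    ext t; rw [npdf_eq]
  rw [this]
  fun_prop

theorem contDiff_ncdf : ContDiff ℝ 2 ncdf := by
  have h : deriv ncdf = npdf := funext fun t => (hasDerivAt_ncdf t).deriv
  rw [show (2 : WithTop ℕ∞) = 1 + 1 by norm_num, contDiff_succ_iff_deriv]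
  refine ⟨fun t => (hasDerivAt_ncdf t).differentiableAt, by simp, ?_⟩
  rw [h]
  exact contDiff_npdf

theorem contDiff_log_ncdf : ContDiff ℝ 2 fun t => Real.log (ncdf t) :=
  contDiff_ncdf.log fun t => (ncdf_pos t).ne'

theorem deriv_log_ncdf : deriv (fun t => Real.log (ncdf t)) = fun t => npdf t / ncdf t :=
  funext fun t => ((hasDerivAt_ncdf t).log (ncdf_pos t).ne').deriv

theorem deriv_npdf_div_ncdf (t : ℝ) : deriv (fun t => npdf t / ncdf t) t =
    -t * (npdf t / ncdf t) - (npdf t / ncdf t) ^ 2 := by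
  have h := ncdf_pos t
  rw [show deriv (fun t => npdf t / ncdf t) t = _ from
    ((hasDerivAt_npdf t).div (hasDerivAt_ncdf t) h.ne').deriv]
  field_simp

theorem half_le_ncdf {t : ℝ} (ht : 0 ≤ t) : 1 / 2 ≤ ncdf t := by
  rw [← ncdf_zero]; exact strictMono_ncdf.monotone ht

/-- For `t ≤ 0` the tail is at least `npdf (1 - t)`, and `npdf t / npdf (1 - t) = exp (1/2 - t)`.
The linear truth is not needed, as only exponential growth is tracked. -/
theorem npdf_div_ncdf_le (t : ℝ) : npdf t / ncdf t ≤ Real.exp (1 + |t|) := by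
  rw [div_le_iff₀ (ncdf_pos t)]
  rcases le_total 0 t with ht | ht
  · have h1 := half_le_ncdf ht
    have h2 : 2 * npdf t ≤ 1 :=
      (two_mul_npdf_le t).trans (Real.exp_le_one_iff.2 (by nlinarith [sq_nonneg t]))
    have h3 : 1 ≤ Real.exp (1 + |t|) := Real.one_le_exp (by positivity)
    nlinarith
  · have h1 := npdf_le_ncdf_neg (t := -t) (by linarith)
    rw [neg_neg] at h1
    have h2 : npdf t ≤ Real.exp (1 + |t|) * npdf (-t + 1) := by
      rw [npdf_eq, npdf_eq, abs_of_nonpos ht, mul_left_comm, ← Real.exp_add]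
      gcongr
      nlinarith
    exact h2.trans (mul_le_mul_of_nonneg_left h1 (Real.exp_pos _).le)

theorem abs_log_ncdf_le (t : ℝ) : |Real.log (ncdf t)| ≤ Real.exp (3 * (1 + |t|)) := by
  have hlog : Real.log (ncdf t) ≤ 0 := Real.log_nonpos (ncdf_nonneg t) (ncdf_le_one t)
  have hu := abs_nonneg t
  rw [abs_of_nonpos hlog]
  have h3 := Real.add_one_le_exp (3 * (1 + |t|))
  rcases le_total 0 t with ht | ht
  · have h1 := Real.log_le_log (by norm_num) (half_le_ncdf ht)
    rw [one_div, Real.log_inv] at h1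
    have := Real.log_two_lt_d9
    linarith
  · have h1 := npdf_le_ncdf_neg (t := -t) (by linarith)
    rw [neg_neg, npdf_eq] at h1
    have hs : 0 < √(2 * Real.pi) := by positivity
    have h2 := Real.log_le_log (by positivity) h1
    rw [Real.log_mul (by positivity) (Real.exp_pos _).ne', Real.log_exp, Real.log_inv] at h2
    have h4 : √(2 * Real.pi) ≤ 3 := by
      rw [Real.sqrt_le_left (by norm_num)]
      linarith [Real.pi_le_four]
    have h5 := Real.log_le_sub_one_of_pos hs
    have h6 := Real.quadratic_le_exp_of_nonneg (by positivity : 0 ≤ 3 * (1 + |t|))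
    rw [abs_of_nonpos ht] at h6 ⊢
    nlinarith

theorem abs_deriv_log_ncdf_le (t : ℝ) :
    |deriv (fun t => Real.log (ncdf t)) t| ≤ Real.exp (3 * (1 + |t|)) := by
  rw [deriv_log_ncdf, abs_of_nonneg (div_nonneg (npdf_pos t).le (ncdf_nonneg t))]
  exact (npdf_div_ncdf_le t).trans (Real.exp_le_exp.2 (by linarith [abs_nonneg t]))

theorem abs_deriv_deriv_log_ncdf_le (t : ℝ) :
    |deriv (deriv fun t => Real.log (ncdf t)) t| ≤ Real.exp (3 * (1 + |t|)) := by
  rw [deriv_log_ncdf, deriv_npdf_div_ncdf]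
  have h := npdf_div_ncdf_le t
  have h0 : 0 ≤ npdf t / ncdf t := div_nonneg (npdf_pos t).le (ncdf_nonneg t)
  set R := npdf t / ncdf t
  set e := Real.exp (1 + |t|) with he
  have h1 : 2 + |t| ≤ e := by linarith [Real.add_one_le_exp (1 + |t|)]
  have h3 : Real.exp (3 * (1 + |t|)) = e ^ 3 := by
    rw [he, ← Real.exp_nat_mul]; norm_num
  have ht := abs_nonneg t
  rw [h3]
  calc |-t * R - R ^ 2| ≤ |t| * R + R ^ 2 := by
        refine (abs_sub _ _).trans (le_of_eq ?_)
        rw [abs_mul, abs_neg, abs_of_nonneg h0, abs_of_nonneg (sq_nonneg R)]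
    _ ≤ e * e + e ^ 2 := by gcongr; linarith
    _ ≤ e ^ 3 := by nlinarith [sq_nonneg e]

end LogNormalCDF

/-! ### The log density as a log-sum-exp. -/

section LogDensity

variable {m : ℕ}

theorem contDiff_weight (k : Fin (m + 1)) {d : WithTop ℕ∞} :
    ContDiff ℝ d fun Ψ : Param m => weight Ψ k := by
  induction k using Fin.lastCases with
  | last => simp only [weight, Fin.lastCases_last]; fun_prop
  | cast j => simp only [weight, Fin.lastCases_castSucc]; fun_prop

theorem contDiff_loc (k : Fin (m + 1)) {d : WithTop ℕ∞} :
    ContDiff ℝ d fun Ψ : Param m => loc Ψ k := by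
  unfold loc; fun_prop

theorem contDiff_scale (k : Fin (m + 1)) {d : WithTop ℕ∞} :
    ContDiff ℝ d fun Ψ : Param m => scale Ψ k := by
  unfold scale; fun_prop

theorem contDiff_shape (k : Fin (m + 1)) {d : WithTop ℕ∞} :
    ContDiff ℝ d fun Ψ : Param m => shape Ψ k := by
  unfold shape; fun_prop

/-- The exponent is written with sums, products and one composition, the operations under which
`TameAt` is stable. -/
theorem mul_snDensity_eq_exp {π σ : ℝ} (hπ : 0 < π) (hσ : 0 < σ) (μ lam x : ℝ) :
    π * snDensity μ σ lam x = Real.exp (Real.log π + (Real.log 2 - Real.log √(2 * Real.pi) -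
      Real.log σ) + -(1 / 2) * ((x + -μ) * σ⁻¹) * ((x + -μ) * σ⁻¹) +
      Real.log (ncdf (lam * ((x + -μ) * σ⁻¹)))) := by
  have hs : 0 < √(2 * Real.pi) := by positivity
  rw [Real.exp_add, Real.exp_add, Real.exp_add, Real.exp_sub, Real.exp_sub, Real.exp_log hπ,
    Real.exp_log two_pos, Real.exp_log hs, Real.exp_log hσ, Real.exp_log (ncdf_pos _)]
  have hz : (x + -μ) * σ⁻¹ = (x - μ) / σ := by rw [div_eq_mul_inv, sub_eq_add_neg]
  rw [hz, snDensity, ← npdf, npdf_eq]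
  have : -(1 / 2) * ((x - μ) / σ) * ((x - μ) / σ) = -((x - μ) / σ) ^ 2 / 2 := by ring
  rw [this, ncdf]
  field_simp

theorem eventually_pos_of_mem {Ψ₀ : Param m} (hΨ₀ : Ψ₀ ∈ paramSpace m)
    (hw : ∀ k, 0 < weight Ψ₀ k) :
    ∀ᶠ Ψ in 𝓝 Ψ₀, ∀ k, 0 < weight Ψ k ∧ 0 < scale Ψ k :=
  eventually_all.2 fun k => ((continuous_weight k).continuousAt.eventually (lt_mem_nhds (hw k))).and
    ((continuous_scale k).continuousAt.eventually (lt_mem_nhds (hΨ₀ k).2))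

/-- The log-density of the mixture is tame at interior points of the parameter space. -/
theorem tameAt_log_mixDensity {Ψ₀ : Param m} (hΨ₀ : Ψ₀ ∈ paramSpace m)
    (hw : ∀ k, 0 < weight Ψ₀ k) :
    TameAt (fun Ψ x => Real.log (mixDensity Ψ x)) Ψ₀ := by
  have hz : ∀ k, TameAt (fun (Ψ : Param m) x => (x + -loc Ψ k) * (scale Ψ k)⁻¹) Ψ₀ := fun k =>
    ((TameAt.coord Ψ₀).add (.of_contDiffAt (contDiff_loc k).neg.contDiffAt)).mul
      (.of_contDiffAt ((contDiff_scale k).contDiffAt.inv (hΨ₀ k).2.ne'))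
  have hL : ∀ k, TameAt (fun (Ψ : Param m) x =>
      Real.log (ncdf (shape Ψ k * ((x + -loc Ψ k) * (scale Ψ k)⁻¹)))) Ψ₀ := by
    intro k
    have h1 : ContinuousAt (fun Ψ : Param m => |shape Ψ k| * (scale Ψ k)⁻¹ * (1 + |loc Ψ k|)) Ψ₀ :=
      ((continuous_shape k).abs.continuousAt.mul
        ((continuous_scale k).continuousAt.inv₀ (hΨ₀ k).2.ne')).mul
        (continuous_const.add (continuous_loc k).abs).continuousAt
    have hsc := (continuous_scale k).continuousAt.eventually (lt_mem_nhds (hΨ₀ k).2)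
    -- Composition keeps exponential growth only because the inner function is linear in `x`, with
    -- coefficients bounded near `Ψ₀`; this supplies `D`.
    refine TameAt.comp ((TameAt.of_contDiffAt (contDiff_shape k).contDiffAt).mul (hz k))
      contDiff_log_ncdf (by norm_num : (0 : ℝ) ≤ 3) abs_log_ncdf_le abs_deriv_log_ncdf_le
      abs_deriv_deriv_log_ncdf_le
      (D := |shape Ψ₀ k| * (scale Ψ₀ k)⁻¹ * (1 + |loc Ψ₀ k|) + 1)
      (by have := (hΨ₀ k).2; positivity) ?_
    filter_upwards [h1.eventually_le_const (lt_add_one _), hsc] with Ψ hΨ hs x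
    have hs' : 0 < (scale Ψ k)⁻¹ := inv_pos.2 hs
    rw [abs_mul, abs_mul, abs_of_pos hs', ← sub_eq_add_neg]
    have hx := abs_nonneg x
    have hl := abs_nonneg (loc Ψ k)
    calc |shape Ψ k| * (|x - loc Ψ k| * (scale Ψ k)⁻¹)
        ≤ |shape Ψ k| * ((|x| + |loc Ψ k|) * (scale Ψ k)⁻¹) := by gcongr; exact abs_sub _ _
      _ ≤ |shape Ψ k| * (((1 + |loc Ψ k|) * (1 + |x|)) * (scale Ψ k)⁻¹) := by
          gcongr; nlinarith
      _ = |shape Ψ k| * (scale Ψ k)⁻¹ * (1 + |loc Ψ k|) * (1 + |x|) := by ring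
      _ ≤ _ := by gcongr
  have hg : ∀ k, TameAt (fun (Ψ : Param m) x => Real.log (weight Ψ k) +
      (Real.log 2 - Real.log √(2 * Real.pi) - Real.log (scale Ψ k)) +
      -(1 / 2) * ((x + -loc Ψ k) * (scale Ψ k)⁻¹) * ((x + -loc Ψ k) * (scale Ψ k)⁻¹) +
      Real.log (ncdf (shape Ψ k * ((x + -loc Ψ k) * (scale Ψ k)⁻¹)))) Ψ₀ := fun k =>
    (((TameAt.of_contDiffAt ((contDiff_weight k).contDiffAt.log (hw k).ne')).add
      (.of_contDiffAt (contDiffAt_const.sub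
        ((contDiff_scale k).contDiffAt.log (hΨ₀ k).2.ne')))).add
      (((TameAt.of_contDiffAt contDiffAt_const).mul (hz k)).mul (hz k))).add (hL k)
  refine (TameAt.log_sum_exp hg).congr ?_
  filter_upwards [eventually_pos_of_mem hΨ₀ hw] with Ψ hΨ
  ext x
  rw [mixDensity]
  congr 1
  exact Finset.sum_congr rfl fun k _ => mul_snDensity_eq_exp (hΨ k).1 (hΨ k).2 _ _ _

/-- Near an interior point, mixture densities are bounded by multiples of `exp (-a |x|)`,
locally uniformly. -/
theorem exists_eventually_mixDensity_le {Ψ₀ : Param m} (hΨ₀ : Ψ₀ ∈ paramSpace m)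
    (hw : ∀ k, 0 < weight Ψ₀ k) {a : ℝ} (ha : 0 ≤ a) :
    ∃ K : ℝ, ∀ᶠ Ψ in 𝓝 Ψ₀, ∀ x, mixDensity Ψ x ≤ K * Real.exp (-(a * |x|)) := by
  have hc : ContinuousAt (fun Ψ : Param m => ∑ k, 1 / scale Ψ k *
      Real.exp (a ^ 2 * scale Ψ k ^ 2 / 2 + a * |loc Ψ k|)) Ψ₀ := by
    refine tendsto_finsetSum _ fun k _ => ContinuousAt.mul ?_ ?_
    · exact continuousAt_const.div (continuous_scale k).continuousAt (hΨ₀ k).2.ne'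
    · have h1 := continuous_scale (m := m) k
      have h2 := continuous_loc (m := m) k
      exact Continuous.continuousAt (by fun_prop)
  refine ⟨(∑ k, 1 / scale Ψ₀ k *
    Real.exp (a ^ 2 * scale Ψ₀ k ^ 2 / 2 + a * |loc Ψ₀ k|)) + 1,
    ((hc.eventually_le_const (lt_add_one _)).and (eventually_pos_of_mem hΨ₀ hw)).mono
    fun Ψ h x => ?_⟩
  exact (mixDensity_le_exp (fun k => ⟨(h.2 k).1.le, (h.2 k).2⟩) ha x).trans
    (mul_le_mul_of_nonneg_right h.1 (Real.exp_pos _).le)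

end LogDensity

/-! ### Differentiation under the integral: mean score and information identity. -/

section DifferentiationUnderIntegral

/-- The derivative is the pointwise limit of difference quotients along `1 / (n + 1)`, shifted to
where `F` is measurable. -/
theorem measurable_of_hasDerivAt_zero {F : ℝ → ℝ → ℝ} {F' : ℝ → ℝ}
    (hF : ∀ᶠ t in 𝓝 (0 : ℝ), Measurable (F t)) (h : ∀ x, HasDerivAt (fun t => F t x) (F' x) 0) :
    Measurable F' := by
  have hseq : Tendsto (fun n : ℕ => 1 / ((n : ℝ) + 1)) atTop (𝓝[≠] 0) :=
    tendsto_nhdsWithin_iff.2 ⟨tendsto_one_div_add_atTop_nhds_zero_nat,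
      .of_forall fun n => by simp only [Set.mem_compl_iff, Set.mem_singleton_iff]; positivity⟩
  obtain ⟨N, hN⟩ := eventually_atTop.1 ((hseq.mono_right nhdsWithin_le_nhds).eventually hF)
  have h0 : Measurable (F 0) := hF.self_of_nhds
  refine measurable_of_tendsto_metrizable (f := fun (n : ℕ) x =>
    (1 / (((n + N : ℕ) : ℝ) + 1))⁻¹ * (F (1 / (((n + N : ℕ) : ℝ) + 1)) x - F 0 x)) (fun n => ?_)
    (tendsto_pi_nhds.2 fun x => ?_)
  · exact ((hN (n + N) (Nat.le_add_left _ _)).sub h0).const_mul _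
  · have := ((h x).tendsto_slope_zero.comp hseq).comp (tendsto_add_atTop_nat N)
    simpa [Function.comp_def] using this

theorem integral_deriv_eq_zero {F F' : ℝ → ℝ → ℝ} {B : ℝ → ℝ} {c : ℝ}
    (hF : ∀ᶠ t in 𝓝 (0 : ℝ), Measurable (F t)) (hi : Integrable (F 0)) (hB : Integrable B)
    (hd : ∀ᶠ t in 𝓝 (0 : ℝ), ∀ x, HasDerivAt (fun t => F t x) (F' t x) t ∧ |F' t x| ≤ B x)
    (hc : ∀ᶠ t in 𝓝 (0 : ℝ), ∫ x, F t x = c) : ∫ x, F' 0 x = 0 := by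
  have hm : Measurable (F' 0) := measurable_of_hasDerivAt_zero hF fun x => (hd.self_of_nhds x).1
  have h := (hasDerivAt_integral_of_dominated_loc_of_deriv_le (F := F) (F' := F') (bound := B)
    (μ := volume) hd (hF.mono fun t ht => ht.aestronglyMeasurable) hi hm.aestronglyMeasurable
    (.of_forall fun x t ht => (ht x).2) hB (.of_forall fun x t ht => (ht x).1)).2
  exact h.unique ((hasDerivAt_const (0 : ℝ) c).congr_of_eventuallyEq hc)

variable {E : Type*} [NormedAddCommGroup E] [NormedSpace ℝ E]

theorem HasFDerivAt.hasDerivAt_line {F : E → ℝ} {F' : E →L[ℝ] ℝ} {Ψ v : E} {t : ℝ}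
    (h : HasFDerivAt F F' (Ψ + t • v)) : HasDerivAt (fun s : ℝ => F (Ψ + s • v)) (F' v) t := by
  have h1 : HasDerivAt (fun s : ℝ => Ψ + s • v) v t := by
    simpa using ((hasDerivAt_id t).smul_const v).const_add Ψ
  exact h.comp_hasDerivAt t h1

theorem tendsto_line (Ψ v : E) : Tendsto (fun t : ℝ => Ψ + t • v) (𝓝 0) (𝓝 Ψ) := by
  have : Continuous fun t : ℝ => Ψ + t • v := by fun_prop
  simpa using this.tendsto 0

variable {h : E → ℝ → ℝ} {Ψ₀ : E}

theorem eventually_measurable_fderiv (hmeas : ∀ Ψ, Measurable (h Ψ)) (htame : TameAt h Ψ₀) :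
    ∀ᶠ Ψ in 𝓝 Ψ₀, ∀ v, Measurable fun x => fderiv ℝ (fun Ψ' => h Ψ' x) Ψ v := by
  obtain ⟨C, hC, hj⟩ := htame
  filter_upwards [hj] with Ψ hj v
  refine measurable_of_hasDerivAt_zero (F := fun t x => h (Ψ + t • v) x)
    (.of_forall fun t => hmeas _) fun x => ?_
  have := ((hj x).1.differentiableAt (by simp)).hasFDerivAt
  rw [show Ψ = Ψ + (0 : ℝ) • v by rw [zero_smul, add_zero]] at this
  simpa using HasFDerivAt.hasDerivAt_line this

theorem hasDerivAt_fderiv_line {F : E → ℝ} {Ψ v w : E} {t : ℝ}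
    (hF : ContDiffAt ℝ 2 F (Ψ + t • w)) :
    HasDerivAt (fun s : ℝ => fderiv ℝ F (Ψ + s • w) v)
      (fderiv ℝ (fderiv ℝ F) (Ψ + t • w) w v) t := by
  have h1 : HasDerivAt (fun s : ℝ => Ψ + s • w) w t := by
    simpa using ((hasDerivAt_id t).smul_const w).const_add Ψ
  have h2 := hF.differentiableAt_fderiv_two.hasFDerivAt.comp_hasDerivAt t h1
  exact h2.clm_apply (hasDerivAt_const t v) |>.congr_deriv (by simp)

theorem eventually_measurable_fderiv_fderiv (hmeas : ∀ Ψ, Measurable (h Ψ))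
    (htame : TameAt h Ψ₀) : ∀ᶠ Ψ in 𝓝 Ψ₀, ∀ w v,
      Measurable fun x => fderiv ℝ (fderiv ℝ fun Ψ' => h Ψ' x) Ψ w v := by
  have h1 := (eventually_measurable_fderiv hmeas htame).eventually_nhds
  obtain ⟨C, hC, hj⟩ := htame
  filter_upwards [hj, h1] with Ψ hj h1 w v
  refine measurable_of_hasDerivAt_zero
    (F := fun t x => fderiv ℝ (fun Ψ' => h Ψ' x) (Ψ + t • w) v) ?_ fun x => ?_
  · exact ((tendsto_line Ψ w).eventually h1).mono fun t ht => ht v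
  · simpa using hasDerivAt_fderiv_line (t := 0) (v := v) (by simpa using (hj x).1)

theorem JetBound.abs_fderiv_apply_le {F : E → ℝ} {Ψ : E} {B : ℝ} (hF : JetBound F Ψ B) (v : E) :
    |fderiv ℝ F Ψ v| ≤ B * ‖v‖ :=
  (ContinuousLinearMap.le_opNorm _ v).trans (mul_le_mul_of_nonneg_right hF.3 (norm_nonneg v))

theorem JetBound.abs_fderiv_fderiv_apply_le {F : E → ℝ} {Ψ : E} {B : ℝ} (hF : JetBound F Ψ B)
    (w v : E) : |fderiv ℝ (fderiv ℝ F) Ψ w v| ≤ B * ‖w‖ * ‖v‖ :=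
  (ContinuousLinearMap.le_opNorm₂ _ w v).trans (mul_le_mul_of_nonneg_right
    (mul_le_mul_of_nonneg_right hF.4 (norm_nonneg w)) (norm_nonneg v))

/-- The score of a tame family of densities has mean zero. -/
theorem eventually_integral_exp_mul_fderiv_eq_zero (hmeas : ∀ Ψ, Measurable (h Ψ))
    (htame : TameAt h Ψ₀)
    (hbound : ∀ a : ℝ, 0 ≤ a → ∃ K, ∀ᶠ Ψ in 𝓝 Ψ₀, ∀ x, Real.exp (h Ψ x) ≤ K * Real.exp (-(a * |x|)))
    (hint : ∀ᶠ Ψ in 𝓝 Ψ₀, ∫ x, Real.exp (h Ψ x) = 1) :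
    ∀ᶠ Ψ in 𝓝 Ψ₀, ∀ v, ∫ x, Real.exp (h Ψ x) * fderiv ℝ (fun Ψ' => h Ψ' x) Ψ v = 0 := by
  obtain ⟨C, hC, hj⟩ := htame
  -- The decay rate exceeds the growth rate `C` of the score by one, leaving an integrable `exp
  -- (-|x|)`.
  obtain ⟨K, hK⟩ := hbound (C + 1) (by positivity)
  filter_upwards [hj.eventually_nhds, hK.eventually_nhds, hint.eventually_nhds] with Ψ hj hK hint v
  have := integral_deriv_eq_zero (F := fun t x => Real.exp (h (Ψ + t • v) x))
    (F' := fun t x => Real.exp (h (Ψ + t • v) x) *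
      fderiv ℝ (fun Ψ' => h Ψ' x) (Ψ + t • v) v)
    (B := fun x => K * Real.exp C * ‖v‖ * Real.exp (-(1 * |x|))) (c := 1)
    (.of_forall fun t => (hmeas _).exp) ?_ ((integrable_exp_neg_mul_abs one_pos).const_mul _) ?_
    ((tendsto_line Ψ v).eventually hint)
  · simpa using this
  · refine ((integrable_exp_neg_mul_abs (by positivity : 0 < C + 1)).const_mul K).mono'
      (hmeas _).exp.aestronglyMeasurable (.of_forall fun x => ?_)
    rw [Real.norm_of_nonneg (Real.exp_pos _).le]
    simpa using hK.self_of_nhds x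
  · filter_upwards [(tendsto_line Ψ v).eventually hj, (tendsto_line Ψ v).eventually hK]
      with t hj hK x
    refine ⟨(HasFDerivAt.hasDerivAt_line
      ((hj x).1.differentiableAt (by simp)).hasFDerivAt).exp, ?_⟩
    rw [abs_mul, abs_of_pos (Real.exp_pos _)]
    calc Real.exp (h (Ψ + t • v) x) * |fderiv ℝ (fun Ψ' => h Ψ' x) (Ψ + t • v) v|
        ≤ (K * Real.exp (-((C + 1) * |x|))) * (Real.exp (C * (1 + |x|)) * ‖v‖) :=
          mul_le_mul (hK x) ((hj x).abs_fderiv_apply_le v) (abs_nonneg _)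
            ((Real.exp_pos _).le.trans (hK x))
      _ = K * ‖v‖ * (Real.exp (-((C + 1) * |x|)) * Real.exp (C * (1 + |x|))) := by ring
      _ = K * ‖v‖ * (Real.exp C * Real.exp (-(1 * |x|))) := by
          rw [← Real.exp_add, ← Real.exp_add]; ring_nf
      _ = _ := by ring

/-- The information identity for a tame family of densities. -/
theorem integral_exp_mul_fderiv_fderiv_eq_zero (hmeas : ∀ Ψ, Measurable (h Ψ))
    (htame : TameAt h Ψ₀)
    (hbound : ∀ a : ℝ, 0 ≤ a → ∃ K, ∀ᶠ Ψ in 𝓝 Ψ₀, ∀ x, Real.exp (h Ψ x) ≤ K * Real.exp (-(a * |x|)))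
    (hint : ∀ᶠ Ψ in 𝓝 Ψ₀, ∫ x, Real.exp (h Ψ x) = 1) (w v : E) :
    ∫ x, Real.exp (h Ψ₀ x) * (fderiv ℝ (fun Ψ' => h Ψ' x) Ψ₀ w * fderiv ℝ (fun Ψ' => h Ψ' x) Ψ₀ v +
      fderiv ℝ (fderiv ℝ fun Ψ' => h Ψ' x) Ψ₀ w v) = 0 := by
  -- The mean score vanishes for all parameters near `Ψ₀`; differentiating this once more, along
  -- `w`, gives the identity. Products of two scores grow at rate `2 * C`, hence the decay rate `2 *
  -- C + 1`.
  have hzero := eventually_integral_exp_mul_fderiv_eq_zero hmeas htame hbound hint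
  have hm := eventually_measurable_fderiv hmeas htame
  obtain ⟨C, hC, hj⟩ := htame
  obtain ⟨K, hK⟩ := hbound (2 * C + 1) (by positivity)
  have hK0 : 0 ≤ K := by
    have := hK.self_of_nhds 0
    simp only [abs_zero, mul_zero, neg_zero, Real.exp_zero, mul_one] at this
    exact (Real.exp_pos _).le.trans this
  have hle : ∀ x : ℝ, Real.exp (C * (1 + |x|)) ≤ Real.exp (2 * C * (1 + |x|)) := fun x =>
    Real.exp_le_exp.2 (by nlinarith [mul_nonneg hC (abs_nonneg x)])
  have hmerge : ∀ x : ℝ, Real.exp (-((2 * C + 1) * |x|)) * Real.exp (2 * C * (1 + |x|)) =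
      Real.exp (2 * C) * Real.exp (-(1 * |x|)) := fun x => by
    rw [← Real.exp_add, ← Real.exp_add]; ring_nf
  have := integral_deriv_eq_zero
    (F := fun t x => Real.exp (h (Ψ₀ + t • w) x) * fderiv ℝ (fun Ψ' => h Ψ' x) (Ψ₀ + t • w) v)
    (F' := fun t x => Real.exp (h (Ψ₀ + t • w) x) * fderiv ℝ (fun Ψ' => h Ψ' x) (Ψ₀ + t • w) w *
      fderiv ℝ (fun Ψ' => h Ψ' x) (Ψ₀ + t • w) v + Real.exp (h (Ψ₀ + t • w) x) *
      fderiv ℝ (fderiv ℝ fun Ψ' => h Ψ' x) (Ψ₀ + t • w) w v)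
    (B := fun x => K * Real.exp (2 * C) * (2 * ‖w‖ * ‖v‖) * Real.exp (-(1 * |x|))) (c := 0)
    ?_ ?_ ((integrable_exp_neg_mul_abs one_pos).const_mul _) ?_ ?_
  · simpa [mul_add, mul_assoc] using this
  · filter_upwards [(tendsto_line Ψ₀ w).eventually hm] with t ht
    exact (hmeas _).exp.mul (ht v)
  · simp only [zero_smul, add_zero]
    refine ((integrable_exp_neg_mul_abs one_pos).const_mul (K * Real.exp (2 * C) * ‖v‖)).mono'
      ((hmeas _).exp.mul (hm.self_of_nhds v)).aestronglyMeasurable (.of_forall fun x => ?_)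
    rw [Real.norm_eq_abs, abs_mul, abs_of_pos (Real.exp_pos _)]
    calc _ ≤ (K * Real.exp (-((2 * C + 1) * |x|))) * (Real.exp (2 * C * (1 + |x|)) * ‖v‖) :=
          mul_le_mul (hK.self_of_nhds x) (((hj.self_of_nhds x).abs_fderiv_apply_le v).trans
            (mul_le_mul_of_nonneg_right (hle x) (norm_nonneg v))) (abs_nonneg _) (by positivity)
      _ = K * ‖v‖ * (Real.exp (-((2 * C + 1) * |x|)) * Real.exp (2 * C * (1 + |x|))) := by ring
      _ = _ := by rw [hmerge]; ring
  · filter_upwards [(tendsto_line Ψ₀ w).eventually hj, (tendsto_line Ψ₀ w).eventually hK]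
      with t hj hK x
    refine ⟨(HasFDerivAt.hasDerivAt_line ((hj x).1.differentiableAt (by simp)).hasFDerivAt).exp.mul
      (hasDerivAt_fderiv_line (hj x).1), ?_⟩
    have b1 := (hj x).abs_fderiv_apply_le w
    have b2 := (hj x).abs_fderiv_apply_le v
    have b3 := (hj x).abs_fderiv_fderiv_apply_le w v
    have e2 : Real.exp (2 * C * (1 + |x|)) = Real.exp (C * (1 + |x|)) * Real.exp (C * (1 + |x|)) := by
      rw [← Real.exp_add]; ring_nf
    set D := fderiv ℝ (fun Ψ' => h Ψ' x) (Ψ₀ + t • w)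
    set D2 := fderiv ℝ (fderiv ℝ fun Ψ' => h Ψ' x) (Ψ₀ + t • w)
    have b4 : |D w * D v + D2 w v| ≤ Real.exp (2 * C * (1 + |x|)) * (2 * ‖w‖ * ‖v‖) := by
      refine (abs_add_le _ _).trans ?_
      rw [abs_mul]
      have c1 := mul_le_mul b1 b2 (abs_nonneg _) (by positivity)
      have c2 := mul_le_mul_of_nonneg_right (hle x) (by positivity : 0 ≤ ‖w‖ * ‖v‖)
      rw [e2] at c2 ⊢
      linarith
    rw [mul_assoc, ← mul_add, abs_mul, abs_of_pos (Real.exp_pos _)]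
    calc _ ≤ (K * Real.exp (-((2 * C + 1) * |x|))) *
          (Real.exp (2 * C * (1 + |x|)) * (2 * ‖w‖ * ‖v‖)) :=
          mul_le_mul (hK x) b4 (abs_nonneg _) (by positivity)
      _ = K * (2 * ‖w‖ * ‖v‖) *
          (Real.exp (-((2 * C + 1) * |x|)) * Real.exp (2 * C * (1 + |x|))) := by ring
      _ = _ := by rw [hmerge]; ring
  · exact ((tendsto_line Ψ₀ w).eventually hzero).mono fun t ht => ht v

end DifferentiationUnderIntegral

/-! ### The multivariate central limit theorem. -/

section CentralLimitTheorem

/-- The Cramér-Wold device on characteristic functions, reducing convergence to the projections on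
each `t`. -/
theorem charFun_map_eq_charFun_map_inner {Ω E : Type*} [MeasurableSpace Ω] {P : Measure Ω}
    [NormedAddCommGroup E] [InnerProductSpace ℝ E] [MeasurableSpace E] [BorelSpace E]
    {Z : Ω → E} (hZ : AEMeasurable Z P) (t : E) :
    charFun (P.map Z) t = charFun (P.map fun ω => inner ℝ (Z ω) t) 1 := by
  have h : AEMeasurable (fun ω => inner ℝ (Z ω) t) P :=
    (Continuous.measurable (f := fun z : E => inner ℝ z t) (by fun_prop)).comp_aemeasurable hZ
  rw [charFun_apply, charFun_apply, integral_map hZ (Continuous.aestronglyMeasurable (by fun_prop)),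
    integral_map h (Continuous.aestronglyMeasurable (by fun_prop))]
  simp

variable {Ω : Type*} [MeasurableSpace Ω] {P : Measure Ω} [IsProbabilityMeasure P]
  {Q : Measure ℝ} {X : ℕ → Ω → ℝ} {ι : Type*} [Fintype ι] [DecidableEq ι]

/-- The multivariate central limit theorem for centred functions of independent, identically
distributed observations. -/
theorem tendstoInDistribution_multivariateGaussian (hindep : iIndepFun X P)
    (hlaw : ∀ i, HasLaw (X i) Q P) {V : ℝ → EuclideanSpace ℝ ι} (hV : Measurable V)
    (hV2 : ∀ i, MemLp (fun x => V x i) 2 Q) (hmean : ∀ i, ∫ x, V x i ∂Q = 0)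
    {S : Matrix ι ι ℝ} (hcov : ∀ i j, ∫ x, V x i * V x j ∂Q = S i j) (hS : S.PosSemidef) :
    TendstoInDistribution (fun (n : ℕ) ω => (√(n : ℝ))⁻¹ • ∑ k ∈ Finset.range n, V (X k ω)) atTop id
      (fun _ => P) (multivariateGaussian 0 S) := by
  have hVX : ∀ k, AEMeasurable (fun ω => V (X k ω)) P := fun k =>
    hV.comp_aemeasurable (hlaw k).aemeasurable
  have hm : ∀ n : ℕ, AEMeasurable (fun ω => (√(n : ℝ))⁻¹ • ∑ k ∈ Finset.range n, V (X k ω)) P :=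
    fun n => (Finset.aemeasurable_fun_sum (Finset.range n) fun k _ => hVX k).const_smul
      ((√(n : ℝ))⁻¹)
  have hQ : IsProbabilityMeasure Q := (hlaw 0).isProbabilityMeasure_iff.1 inferInstance
  refine ⟨hm, aemeasurable_id, ProbabilityMeasure.tendsto_iff_tendsto_charFun.2 fun t => ?_⟩
  set φ : ℝ → ℝ := fun x => inner ℝ (V x) t with hφ
  have hφm : Measurable φ :=
    (Continuous.measurable (f := fun z : EuclideanSpace ℝ ι => inner ℝ z t) (by fun_prop)).comp hV
  have hφe : ∀ x, φ x = ∑ i, t i * V x i := fun x => by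
    simp [hφ, PiLp.inner_apply]
  have hφ2 : MemLp φ 2 Q := by
    rw [show φ = fun x => ∑ i, t i * V x i from funext hφe]
    exact memLp_finsetSum _ fun i _ => (hV2 i).const_mul _
  have hφ0 : ∫ x, φ x ∂Q = 0 := by
    simp_rw [hφe]
    rw [integral_finsetSum _ fun i _ => ((hV2 i).integrable one_le_two).const_mul _]
    simp [integral_const_mul, hmean]
  have hφv : ∫ x, φ x ^ 2 ∂Q = t ⬝ᵥ S.mulVec t := by
    have hij : ∀ i j, Integrable (fun x => V x i * V x j) Q := fun i j =>
      (hV2 i).integrable_mul (hV2 j)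
    have : ∀ x, φ x ^ 2 = ∑ i, ∑ j, t i * t j * (V x i * V x j) := fun x => by
      rw [hφe, sq, Finset.sum_mul_sum]
      exact Finset.sum_congr rfl fun i _ => Finset.sum_congr rfl fun j _ => by ring
    simp_rw [this]
    rw [integral_finsetSum _ fun i _ => integrable_finsetSum _ fun j _ => (hij i j).const_mul _]
    simp only [dotProduct, Matrix.mulVec, Finset.mul_sum]
    refine Finset.sum_congr rfl fun i _ => ?_
    rw [integral_finsetSum _ fun j _ => (hij i j).const_mul _]
    refine Finset.sum_congr rfl fun j _ => ?_
    rw [integral_const_mul, hcov]; ring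
  have hident : ∀ i, IdentDistrib (X i) (X 0) P P := fun i =>
    ⟨(hlaw i).aemeasurable, (hlaw 0).aemeasurable, by rw [(hlaw i).map_eq, (hlaw 0).map_eq]⟩
  have hmap : ∀ {g : ℝ → ℝ}, Measurable g → ∫ ω, g (X 0 ω) ∂P = ∫ x, g x ∂Q := fun hg => by
    rw [← (hlaw 0).map_eq, integral_map (hlaw 0).aemeasurable hg.aestronglyMeasurable]
  have hX2 : MemLp (fun ω => φ (X 0 ω)) 2 P := by
    rw [← (hlaw 0).map_eq] at hφ2
    exact hφ2.comp_of_map (hlaw 0).aemeasurable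
  have hmean0 : ∫ ω, φ (X 0 ω) ∂P = 0 := by rw [hmap hφm, hφ0]
  have hvar : Var[fun ω => φ (X 0 ω); P] = t ⬝ᵥ S.mulVec t := by
    rw [variance_of_integral_eq_zero hX2.aestronglyMeasurable.aemeasurable hmean0]
    rw [← hφv, ← hmap (hφm.pow_const 2)]
  have hclt := tendstoInDistribution_inv_sqrt_mul_sum_sub (P := P)
    (P' := gaussianReal 0 Var[fun ω => φ (X 0 ω); P].toNNReal) (Y := id)
    (X := fun k ω => φ (X k ω)) HasLaw.id hX2 (hindep.comp (fun _ => φ) fun _ => hφm)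
    fun i => (hident i).comp hφm
  have h1 := ProbabilityMeasure.tendsto_iff_tendsto_charFun.1 hclt.tendsto 1
  simp only [ProbabilityMeasure.coe_mk, Measure.map_id, charFun_gaussianReal, hmean0, mul_zero,
    sub_zero] at h1 ⊢
  have hnn : 0 ≤ t ⬝ᵥ S.mulVec t := by rw [← hvar]; exact variance_nonneg _ _
  rw [charFun_multivariateGaussian hS]
  convert h1 using 2 with n
  · rw [charFun_map_eq_charFun_map_inner (hm n)]
    congr 2
    ext ω
    rw [real_inner_smul_left, sum_inner]
  · congr 1
    rw [hvar, Real.coe_toNNReal _ hnn]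
    simp

end CentralLimitTheorem

/-! ### Moments of the score and the Hessian at the true parameter. -/

section ScoreAndHessian

variable {m : ℕ}

/-- The second derivatives of the log density of one observation in the parameter. -/
noncomputable def hess (Ψ : Param m) (x : ℝ) (i j : Idx m) : ℝ :=
  fderiv ℝ (fderiv ℝ fun Ψ' : Param m => Real.log (mixDensity Ψ' x)) Ψ
    (EuclideanSpace.single i 1) (EuclideanSpace.single j 1)

theorem measurable_log_mixDensity (Ψ : Param m) : Measurable fun x => Real.log (mixDensity Ψ x) :=
  (continuous_mixDensity Ψ).measurable.log

theorem exists_ball_jetBound {Ψ₀ : Param m} (hΨ₀ : Ψ₀ ∈ paramSpace m)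
    (hw : ∀ k, 0 < weight Ψ₀ k) :
    ∃ C ρ : ℝ, 0 ≤ C ∧ 0 < ρ ∧ ∀ Ψ ∈ Metric.ball Ψ₀ ρ, (∀ k, 0 < weight Ψ k ∧ 0 < scale Ψ k) ∧
      (∀ x, JetBound (fun Ψ' : Param m => Real.log (mixDensity Ψ' x)) Ψ
        (Real.exp (C * (1 + |x|)))) ∧
      (∀ i, Measurable fun x => score Ψ x i) ∧ ∀ i j, Measurable fun x => hess Ψ x i j := by
  have ht := tameAt_log_mixDensity hΨ₀ hw
  have h1 := eventually_measurable_fderiv measurable_log_mixDensity ht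
  have h2 := eventually_measurable_fderiv_fderiv measurable_log_mixDensity ht
  obtain ⟨C, hC, hj⟩ := ht
  obtain ⟨ρ, hρ, h⟩ := Metric.eventually_nhds_iff_ball.1
    (((eventually_pos_of_mem hΨ₀ hw).and hj).and (h1.and h2))
  exact ⟨C, ρ, hC, hρ, fun Ψ hΨ => ⟨(h Ψ hΨ).1.1, (h Ψ hΨ).1.2, fun i => (h Ψ hΨ).2.1 _,
    fun i j => (h Ψ hΨ).2.2 _ _⟩⟩

theorem JetBound.abs_score_le {Ψ : Param m} {x B : ℝ}
    (h : JetBound (fun Ψ' : Param m => Real.log (mixDensity Ψ' x)) Ψ B) (i : Idx m) :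
    |score Ψ x i| ≤ B := by
  simpa [score] using h.abs_fderiv_apply_le (EuclideanSpace.single i 1)

theorem JetBound.abs_hess_le {Ψ : Param m} {x B : ℝ}
    (h : JetBound (fun Ψ' : Param m => Real.log (mixDensity Ψ' x)) Ψ B) (i j : Idx m) :
    |hess Ψ x i j| ≤ B := by
  simpa [hess] using h.abs_fderiv_fderiv_apply_le (EuclideanSpace.single i 1)
    (EuclideanSpace.single j 1)

theorem integrable_exp_one_add_abs_mixLaw {Ψ : Param m} (hΨ : Ψ ∈ paramSpace m) {C : ℝ}
    (hC : 0 ≤ C) : Integrable (fun x => Real.exp (C * (1 + |x|))) (mixLaw Ψ) := by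
  simp_rw [mul_add, mul_one, Real.exp_add]
  exact (integrable_exp_mul_abs_mixLaw hΨ hC).const_mul _

variable {Ψ₀ : Param m}

theorem memLp_score (hΨ₀ : Ψ₀ ∈ paramSpace m) (hw : ∀ k, 0 < weight Ψ₀ k) (i : Idx m) :
    MemLp (fun x => score Ψ₀ x i) 2 (mixLaw Ψ₀) := by
  obtain ⟨C, ρ, hC, hρ, h⟩ := exists_ball_jetBound hΨ₀ hw
  obtain ⟨-, hj, hm, -⟩ := h Ψ₀ (Metric.mem_ball_self hρ)
  have hexp : MemLp (fun x : ℝ => Real.exp (C * (1 + |x|))) 2 (mixLaw Ψ₀) := by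
    rw [memLp_two_iff_integrable_sq (Continuous.aestronglyMeasurable (by fun_prop))]
    refine (integrable_exp_one_add_abs_mixLaw hΨ₀ (by positivity : 0 ≤ 2 * C)).congr
      (.of_forall fun x => ?_)
    simp only [← Real.exp_nat_mul]
    congr 1; push_cast; ring
  refine hexp.mono (hm i).aestronglyMeasurable (.of_forall fun x => ?_)
  rw [Real.norm_eq_abs, Real.norm_of_nonneg (Real.exp_pos _).le]
  exact (hj x).abs_score_le i

theorem integrable_hess (hΨ₀ : Ψ₀ ∈ paramSpace m) (hw : ∀ k, 0 < weight Ψ₀ k) (i j : Idx m) :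
    Integrable (fun x => hess Ψ₀ x i j) (mixLaw Ψ₀) := by
  obtain ⟨C, ρ, hC, hρ, h⟩ := exists_ball_jetBound hΨ₀ hw
  obtain ⟨-, hj, -, hm⟩ := h Ψ₀ (Metric.mem_ball_self hρ)
  exact (integrable_exp_one_add_abs_mixLaw hΨ₀ hC).mono' (hm i j).aestronglyMeasurable
    (.of_forall fun x => (hj x).abs_hess_le i j)

theorem eventually_exp_log_mixDensity (hΨ₀ : Ψ₀ ∈ paramSpace m) (hw : ∀ k, 0 < weight Ψ₀ k) :
    ∀ᶠ Ψ in 𝓝 Ψ₀, Ψ ∈ paramSpace m ∧ ∀ x, Real.exp (Real.log (mixDensity Ψ x)) = mixDensity Ψ x := by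
  filter_upwards [eventually_pos_of_mem hΨ₀ hw] with Ψ hΨ
  have hmem : Ψ ∈ paramSpace m := fun k => ⟨(hΨ k).1.le, (hΨ k).2⟩
  exact ⟨hmem, fun x => Real.exp_log (mixDensity_pos hmem x)⟩

theorem exp_log_mixDensity_regularity (hΨ₀ : Ψ₀ ∈ paramSpace m) (hw : ∀ k, 0 < weight Ψ₀ k) :
    (∀ a : ℝ, 0 ≤ a → ∃ K, ∀ᶠ Ψ in 𝓝 Ψ₀, ∀ x,
      Real.exp (Real.log (mixDensity Ψ x)) ≤ K * Real.exp (-(a * |x|))) ∧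
    ∀ᶠ Ψ in 𝓝 Ψ₀, ∫ x, Real.exp (Real.log (mixDensity Ψ x)) = 1 := by
  have h := eventually_exp_log_mixDensity hΨ₀ hw
  refine ⟨fun a ha => ?_, ?_⟩
  · obtain ⟨K, hK⟩ := exists_eventually_mixDensity_le hΨ₀ hw ha
    refine ⟨K, ?_⟩
    filter_upwards [h, hK] with Ψ h hK x
    rw [h.2]; exact hK x
  · filter_upwards [h] with Ψ h
    simp_rw [h.2]
    exact (integrable_mixDensity h.1).2

theorem integral_score (hΨ₀ : Ψ₀ ∈ paramSpace m) (hw : ∀ k, 0 < weight Ψ₀ k) (i : Idx m) :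
    ∫ x, score Ψ₀ x i ∂(mixLaw Ψ₀) = 0 := by
  obtain ⟨h1, h2⟩ := exp_log_mixDensity_regularity hΨ₀ hw
  have h := (eventually_integral_exp_mul_fderiv_eq_zero measurable_log_mixDensity
    (tameAt_log_mixDensity hΨ₀ hw) h1 h2).self_of_nhds (EuclideanSpace.single i 1)
  rw [integral_mixLaw hΨ₀ fun x => score Ψ₀ x i, ← h]
  simp_rw [(eventually_exp_log_mixDensity hΨ₀ hw).self_of_nhds.2]
  rfl

theorem integral_hess (hΨ₀ : Ψ₀ ∈ paramSpace m) (hw : ∀ k, 0 < weight Ψ₀ k) (i j : Idx m) :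
    ∫ x, hess Ψ₀ x i j ∂(mixLaw Ψ₀) = -fisherInfo Ψ₀ i j := by
  obtain ⟨h1, h2⟩ := exp_log_mixDensity_regularity hΨ₀ hw
  have h := integral_exp_mul_fderiv_fderiv_eq_zero measurable_log_mixDensity
    (tameAt_log_mixDensity hΨ₀ hw) h1 h2 (EuclideanSpace.single i 1) (EuclideanSpace.single j 1)
  simp_rw [(eventually_exp_log_mixDensity hΨ₀ hw).self_of_nhds.2] at h
  have h' : ∫ x, (score Ψ₀ x i * score Ψ₀ x j + hess Ψ₀ x i j) ∂(mixLaw Ψ₀) = 0 := by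
    rw [integral_mixLaw hΨ₀ fun x => score Ψ₀ x i * score Ψ₀ x j + hess Ψ₀ x i j]
    exact h
  have hi : Integrable (fun x => score Ψ₀ x i * score Ψ₀ x j) (mixLaw Ψ₀) :=
    (memLp_score hΨ₀ hw i).integrable_mul (memLp_score hΨ₀ hw j)
  rw [integral_add hi (integrable_hess hΨ₀ hw i j)] at h'
  rw [fisherInfo, Matrix.of_apply]
  linarith

variable {Ω : Type*} [MeasurableSpace Ω] {P : Measure Ω}
  {X : ℕ → Ω → ℝ}

/-- The mean Hessian of the log-likelihood is close to minus the Fisher information, uniformly near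
the true parameter. -/
theorem exists_nhds_abs_sum_hess_add_le (hΨ₀ : Ψ₀ ∈ paramSpace m) (hw : ∀ k, 0 < weight Ψ₀ k)
    (hindep : iIndepFun X P) (hlaw : ∀ i, HasLaw (X i) (mixLaw Ψ₀) P) {ε : ℝ} (hε : 0 < ε) :
    ∃ U ∈ 𝓝 Ψ₀, ∀ᵐ ω ∂P, ∀ᶠ n : ℕ in atTop, ∀ Ψ ∈ U, ∀ i j,
      |∑ l ∈ Finset.range n, hess Ψ (X l ω) i j + n * fisherInfo Ψ₀ i j| ≤ ε * n := by
  obtain ⟨C, ρ, hC, hρ, hball⟩ := exists_ball_jetBound hΨ₀ hw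
  have hcont : ∀ x i j, ContinuousOn (fun Ψ : Param m => hess Ψ x i j) (Metric.ball Ψ₀ ρ) := by
    intro x i j Ψ hΨ
    have h1 := ((hball Ψ hΨ).2.1 x).contDiffAt.fderiv_right (m := 1) (by norm_num)
    have h2 : ContDiffAt ℝ 0 _ Ψ := h1.fderiv_right (by norm_num)
    exact ((h2.continuousAt.clm_apply continuousAt_const).clm_apply
      continuousAt_const).continuousWithinAt
  -- The law of large numbers is one-sided, so it is applied to each Hessian entry with both signs
  -- `s = 1` and `s = -1`.
  have key : ∀ (s : ℝ) (i j : Idx m), |s| = 1 → ∃ U ∈ 𝓝 Ψ₀, ∀ᵐ ω ∂P, ∀ᶠ n : ℕ in atTop,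
      ∀ γ : Metric.ball Ψ₀ ρ, γ.1 ∈ U →
        ∑ l ∈ Finset.range n, s * hess γ.1 (X l ω) i j ≤ (-(s * fisherInfo Ψ₀ i j) + ε) * n := by
    intro s i j hs
    refine exists_nhds_sum_le hindep hlaw (emb := fun γ : Metric.ball Ψ₀ ρ => γ.1)
      continuous_subtype_val (v := fun γ x => s * hess γ.1 x i j)
      (B := fun x => Real.exp (C * (1 + |x|))) (fun γ => ((hball γ.1 γ.2).2.2.2 i j).const_mul _)
      (fun x => continuous_const.mul (continuousOn_iff_continuous_domRestrict.1 (hcont x i j)))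
      (integrable_exp_one_add_abs_mixLaw hΨ₀ hC) (fun γ x => ?_) Ψ₀
      (vbar := fun x => s * hess Ψ₀ x i j) (.of_forall fun x => ?_) ?_
    · rw [abs_mul, hs, one_mul]
      exact ((hball γ.1 γ.2).2.1 x).abs_hess_le i j
    · have := ((hcont x i j).continuousAt (Metric.ball_mem_nhds Ψ₀ hρ)).tendsto
      exact (this.comp tendsto_comap).const_mul s
    · rw [integral_const_mul, integral_hess hΨ₀ hw]
      linarith
  choose U hU hae using fun (i j : Idx m) => key 1 i j abs_one
  choose U' hU' hae' using fun (i j : Idx m) => key (-1) i j (by simp)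
  refine ⟨Metric.ball Ψ₀ ρ ∩ ((⋂ i, ⋂ j, U i j) ∩ ⋂ i, ⋂ j, U' i j), ?_, ?_⟩
  · refine inter_mem (Metric.ball_mem_nhds Ψ₀ hρ) (inter_mem ?_ ?_)
    · exact iInter_mem.2 fun i => iInter_mem.2 fun j => hU i j
    · exact iInter_mem.2 fun i => iInter_mem.2 fun j => hU' i j
  · filter_upwards [ae_all_iff.2 fun i => ae_all_iff.2 fun j => hae i j,
      ae_all_iff.2 fun i => ae_all_iff.2 fun j => hae' i j] with ω h1 h2
    filter_upwards [eventually_all.2 fun i => eventually_all.2 fun j => h1 i j,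
      eventually_all.2 fun i => eventually_all.2 fun j => h2 i j] with n h1 h2 Ψ hΨ i j
    have e1 := h1 i j ⟨Ψ, hΨ.1⟩ (Set.mem_iInter.1 (Set.mem_iInter.1 hΨ.2.1 i) j)
    have e2 := h2 i j ⟨Ψ, hΨ.1⟩ (Set.mem_iInter.1 (Set.mem_iInter.1 hΨ.2.2 i) j)
    rw [← Finset.mul_sum] at e1 e2
    rw [abs_le]
    constructor <;> linarith

end ScoreAndHessian

/-! ### Linearization of the likelihood equations. -/

section Linearization

theorem EuclideanSpace.sum_smul_single {ι : Type*} [Fintype ι] [DecidableEq ι]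
    (d : EuclideanSpace ℝ ι) : ∑ a, d a • EuclideanSpace.single a (1 : ℝ) = d := by
  simpa using (EuclideanSpace.basisFun ι ℝ).sum_repr d

theorem EuclideanSpace.norm_le_sum_abs {ι : Type*} [Fintype ι] [DecidableEq ι]
    (d : EuclideanSpace ℝ ι) : ‖d‖ ≤ ∑ a, |d a| := by
  nth_rw 1 [← EuclideanSpace.sum_smul_single d]
  refine (norm_sum_le _ _).trans (Finset.sum_le_sum fun a _ => ?_)
  rw [norm_smul, Real.norm_eq_abs]
  simp

/-- One has `y - B s = B (A y - s)`. The error may grow with `y` itself: since the norm of `B` times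
`ε` is at most `1/2`, that part is absorbed on the left, so no prior bound on `y` is needed. -/
theorem sum_abs_sub_mulVec_le {ι : Type*} [Fintype ι] [DecidableEq ι] {A B : Matrix ι ι ℝ}
    (hBA : B * A = 1) {y s : ι → ℝ} {ε : ℝ} (hε : 0 ≤ ε)
    (h : ∀ j, |A.mulVec y j - s j| ≤ ε * (∑ a, |y a| + 1))
    (hB : (∑ i, ∑ j, |B i j|) * ε ≤ 1 / 2) :
    ∑ i, |y i - B.mulVec s i| ≤
      2 * ((∑ i, ∑ j, |B i j|) * ε) * (1 + ∑ i, |B.mulVec s i|) := by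
  set κ := ∑ i, ∑ j, |B i j| with hκ
  have hκ0 : 0 ≤ κ := by positivity
  have e : ∀ i, y i - B.mulVec s i = ∑ j, B i j * (A.mulVec y j - s j) := by
    intro i
    have : y = B.mulVec (A.mulVec y) := by rw [Matrix.mulVec_mulVec, hBA, Matrix.one_mulVec]
    nth_rw 1 [this]
    simp only [Matrix.mulVec, dotProduct, mul_sub, Finset.sum_sub_distrib]
  have h1 : ∑ i, |y i - B.mulVec s i| ≤ κ * ε * (∑ a, |y a| + 1) := by
    rw [hκ, mul_assoc, Finset.sum_mul]
    refine Finset.sum_le_sum fun i _ => ?_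
    rw [e, Finset.sum_mul]
    refine (Finset.abs_sum_le_sum_abs _ _).trans (Finset.sum_le_sum fun j _ => ?_)
    rw [abs_mul]
    exact mul_le_mul_of_nonneg_left (h j) (abs_nonneg _)
  have h2 : ∑ a, |y a| ≤ ∑ i, |y i - B.mulVec s i| + ∑ i, |B.mulVec s i| := by
    rw [← Finset.sum_add_distrib]
    refine Finset.sum_le_sum fun i _ => ?_
    calc |y i| = |(y i - B.mulVec s i) + B.mulVec s i| := by rw [sub_add_cancel]
      _ ≤ _ := abs_add_le _ _
  have h3 : 0 ≤ ∑ i, |y i - B.mulVec s i| := by positivity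
  have h4 : 0 ≤ κ * ε := mul_nonneg hκ0 hε
  nlinarith

variable {m : ℕ}

theorem score_eq (Ψ : Param m) (x : ℝ) (j : Idx m) : score Ψ x j =
    fderiv ℝ (fun Ψ' : Param m => Real.log (mixDensity Ψ' x)) Ψ (EuclideanSpace.single j 1) := rfl

/-- The likelihood equations of the penalized likelihood. -/
theorem abs_sum_score_le_of_isPMLE {n : ℕ} {x : ℕ → ℝ} {q r : ℝ → ℝ} {Ψ : Param m}
    (hΨ : IsPMLE n x q r Ψ) (hpos : ∀ k, 0 < weight Ψ k ∧ 0 < scale Ψ k)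
    (hd : ∀ y, DifferentiableAt ℝ (fun Ψ' : Param m => Real.log (mixDensity Ψ' y)) Ψ)
    (hq : DifferentiableOn ℝ q (Set.Ioi 0)) (hr : Differentiable ℝ r) (j : Idx m) :
    |∑ l ∈ Finset.range n, score Ψ (x l) j| ≤
      ∑ k, |deriv q (scale Ψ k)| + ∑ k, |deriv r (shape Ψ k)| := by
  set v : Param m := EuclideanSpace.single j 1 with hv
  have hv1 : ‖v‖ = 1 := by simp [hv]
  have hlik : HasDerivAt (fun t : ℝ => logLik n x (Ψ + t • v))
      (∑ l ∈ Finset.range n, score Ψ (x l) j) 0 := by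
    unfold logLik
    refine HasDerivAt.fun_sum fun l _ => ?_
    rw [score_eq]
    refine HasFDerivAt.hasDerivAt_line (F := fun Ψ' : Param m => Real.log (mixDensity Ψ' (x l))) ?_
    simpa using (hd (x l)).hasFDerivAt
  have hline : ∀ c d : ℝ, HasDerivAt (fun t : ℝ => c + t * d) d 0 := fun c d => by
    simpa using ((hasDerivAt_id (0 : ℝ)).mul_const d).const_add c
  have hscale : ∀ k, HasDerivAt (fun t : ℝ => q (scale (Ψ + t • v) k))
      (deriv q (scale Ψ k) * scale v k) 0 := by
    intro k
    have h1 : HasDerivAt q (deriv q (scale Ψ k)) (scale Ψ k + 0 * scale v k) := by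
      rw [zero_mul, add_zero]
      exact ((hq _ (hpos k).2).differentiableAt (Ioi_mem_nhds (hpos k).2)).hasDerivAt
    exact h1.comp 0 (hline (scale Ψ k) (scale v k))
  have hshape : ∀ k, HasDerivAt (fun t : ℝ => r (shape (Ψ + t • v) k))
      (deriv r (shape Ψ k) * shape v k) 0 := by
    intro k
    have h1 : HasDerivAt r (deriv r (shape Ψ k)) (shape Ψ k + 0 * shape v k) := by
      rw [zero_mul, add_zero]
      exact (hr _).hasDerivAt
    exact h1.comp 0 (hline (shape Ψ k) (shape v k))
  have hpen := hlik.add ((HasDerivAt.fun_sum fun k (_ : k ∈ Finset.univ) => hscale k).add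
    (HasDerivAt.fun_sum fun k (_ : k ∈ Finset.univ) => hshape k))
  -- Positive weights and scales make `Ψ` an interior point, so both directions along `v` are
  -- admissible and the derivative vanishes.
  have hmem : ∀ᶠ t : ℝ in 𝓝 0, Ψ + t • v ∈ paramSpace m := by
    refine (tendsto_line Ψ v).eventually ?_
    filter_upwards [eventually_pos_of_mem hΨ.1 fun k => (hpos k).1] with Ψ' h k
    exact ⟨(h k).1.le, (h k).2⟩
  have hmax : IsLocalMax (fun t : ℝ => penLogLik n x q r (Ψ + t • v)) 0 := by
    filter_upwards [hmem] with t ht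
    simpa using hΨ.2 ht
  have h0 := hmax.hasDerivAt_eq_zero hpen
  have hle : ∀ (i : Idx m), |v i| ≤ 1 := fun i => by
    rw [← hv1, ← Real.norm_eq_abs]; exact PiLp.norm_apply_le v i
  have hb : ∀ a b : ℝ, |b| ≤ 1 → |a * b| ≤ |a| := fun a b h => by
    rw [abs_mul]; exact mul_le_of_le_one_right (abs_nonneg _) h
  rw [eq_neg_of_add_eq_zero_left h0, abs_neg]
  refine (abs_add_le _ _).trans (add_le_add ?_ ?_)
  · exact (Finset.abs_sum_le_sum_abs _ _).trans (Finset.sum_le_sum fun k _ => hb _ _ (hle _))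
  · exact (Finset.abs_sum_le_sum_abs _ _).trans (Finset.sum_le_sum fun k _ => hb _ _ (hle _))

/-- The mean value theorem for the gradient of the log-likelihood. -/
theorem abs_sum_score_sub_add_le {n : ℕ} {x : ℕ → ℝ} {Ψ₀ Ψ : Param m} {ρ δ : ℝ}
    (hsmooth : ∀ Ψ' ∈ Metric.ball Ψ₀ ρ, ∀ y,
      ContDiffAt ℝ 2 (fun Ψ' : Param m => Real.log (mixDensity Ψ' y)) Ψ')
    {A : Matrix (Idx m) (Idx m) ℝ}
    (hhess : ∀ Ψ' ∈ Metric.ball Ψ₀ ρ, ∀ i j,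
      |∑ l ∈ Finset.range n, hess Ψ' (x l) i j + n * A i j| ≤ δ)
    (hΨ : Ψ ∈ Metric.ball Ψ₀ ρ) (j : Idx m) :
    |∑ l ∈ Finset.range n, score Ψ (x l) j - ∑ l ∈ Finset.range n, score Ψ₀ (x l) j +
      n * ∑ a, (Ψ a - Ψ₀ a) * A a j| ≤ δ * ∑ a, |Ψ a - Ψ₀ a| := by
  set d := Ψ - Ψ₀ with hd
  have hmem : ∀ s ∈ Set.Icc (0 : ℝ) 1, Ψ₀ + s • d ∈ Metric.ball Ψ₀ ρ := by
    intro s hs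
    have h0 : Ψ₀ ∈ Metric.ball Ψ₀ ρ := Metric.mem_ball_self (Metric.pos_of_mem_ball hΨ)
    exact (convex_ball Ψ₀ ρ).add_smul_sub_mem h0 hΨ hs
  -- Adding the linear term before applying the mean value inequality makes the derivative involve
  -- only the Hessian plus `n * A`, which is small along the whole segment.
  have hder : ∀ s ∈ Set.Icc (0 : ℝ) 1, HasDerivAt
      (fun s : ℝ => ∑ l ∈ Finset.range n, score (Ψ₀ + s • d) (x l) j + s * (n * ∑ a, d a * A a j))
      (∑ a, d a * (∑ l ∈ Finset.range n, hess (Ψ₀ + s • d) (x l) a j + n * A a j)) s := by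
    intro s hs
    have h1 : HasDerivAt (fun s : ℝ => ∑ l ∈ Finset.range n, score (Ψ₀ + s • d) (x l) j)
        (∑ l ∈ Finset.range n, ∑ a, d a * hess (Ψ₀ + s • d) (x l) a j) s := by
      refine HasDerivAt.fun_sum fun l _ => ?_
      refine (hasDerivAt_fderiv_line (hsmooth _ (hmem s hs) (x l))).congr_deriv ?_
      set D := fderiv ℝ (fderiv ℝ fun Ψ' : Param m => Real.log (mixDensity Ψ' (x l))) (Ψ₀ + s • d)
        with hD
      conv_lhs => rw [← EuclideanSpace.sum_smul_single d]
      rw [map_sum, _root_.sum_apply]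
      refine Finset.sum_congr rfl fun a _ => ?_
      rw [map_smul, _root_.smul_apply, smul_eq_mul]
      rfl
    refine (h1.add ((hasDerivAt_id s).mul_const (n * ∑ a, d a * A a j))).congr_deriv ?_
    rw [Finset.sum_comm, one_mul, Finset.mul_sum, ← Finset.sum_add_distrib]
    refine Finset.sum_congr rfl fun a _ => ?_
    rw [← Finset.mul_sum]; ring
  have h := norm_image_sub_le_of_norm_deriv_le_segment_01' (C := δ * ∑ a, |d a|)
    (fun s hs => (hder s hs).hasDerivWithinAt) fun s hs => ?_
  · have h1 : Ψ₀ + (1 : ℝ) • d = Ψ := by rw [one_smul, hd, add_sub_cancel]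
    rw [h1, zero_smul, add_zero, one_mul, zero_mul, add_zero, Real.norm_eq_abs] at h
    have h2 : ∀ a, d a = Ψ a - Ψ₀ a := fun a => by rw [hd, PiLp.sub_apply]
    simp only [h2] at h
    rwa [sub_add_eq_add_sub]
  · rw [Real.norm_eq_abs, Finset.mul_sum]
    refine (Finset.abs_sum_le_sum_abs _ _).trans (Finset.sum_le_sum fun a _ => ?_)
    rw [abs_mul, mul_comm]
    exact mul_le_mul_of_nonneg_right (hhess _ (hmem s ⟨hs.1, hs.2.le⟩) a j) (abs_nonneg _)

/-- The local uniformity in C4 allows the argument to move with `n`, as long as it converges. -/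
theorem eventually_sum_abs_deriv_penalty_le {q r : ℕ → ℝ → ℝ} (hC4 : C4 q r) {Ψ₀ : Param m}
    (hΨ₀ : Ψ₀ ∈ paramSpace m) {Ψ : ℕ → Param m} (hΨ : Tendsto Ψ atTop (𝓝 Ψ₀)) {ε : ℝ}
    (hε : 0 < ε) : ∀ᶠ n : ℕ in atTop,
      ∑ k, |deriv (q n) (scale (Ψ n) k)| + ∑ k, |deriv (r n) (shape (Ψ n) k)| ≤ ε * √n := by
  set δ := ε / (2 * (m + 1)) with hδ
  have hδpos : 0 < δ := by positivity
  have h1 : ∀ᶠ n : ℕ in atTop, ∀ k, |deriv (q n) (scale (Ψ n) k)| ≤ δ * √n := by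
    refine eventually_all.2 fun k => ?_
    obtain ⟨t, ht, h⟩ := Metric.tendstoLocallyUniformlyOn_iff.1 hC4.2.2.1 δ hδpos (scale Ψ₀ k)
      (hΨ₀ k).2
    rw [IsOpen.nhdsWithin_eq isOpen_Ioi (Set.mem_Ioi.2 (hΨ₀ k).2)] at ht
    filter_upwards [h, (((continuous_scale k).tendsto Ψ₀).comp hΨ).eventually ht,
      eventually_gt_atTop 0] with n h hn hn0
    have hs : 0 < √(n : ℝ) := Real.sqrt_pos.2 (by exact_mod_cast hn0)
    have := h _ hn
    rw [dist_zero_left, norm_div, Real.norm_of_nonneg hs.le, div_lt_iff₀ hs] at this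
    exact this.le
  have h2 : ∀ᶠ n : ℕ in atTop, ∀ k, |deriv (r n) (shape (Ψ n) k)| ≤ δ * √n := by
    refine eventually_all.2 fun k => ?_
    obtain ⟨t, ht, h⟩ := Metric.tendstoLocallyUniformly_iff.1 hC4.2.2.2 δ hδpos (shape Ψ₀ k)
    filter_upwards [h, (((continuous_shape k).tendsto Ψ₀).comp hΨ).eventually ht,
      eventually_gt_atTop 0] with n h hn hn0
    have hs : 0 < √(n : ℝ) := Real.sqrt_pos.2 (by exact_mod_cast hn0)
    have := h _ hn
    rw [dist_zero_left, norm_div, Real.norm_of_nonneg hs.le, div_lt_iff₀ hs] at this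
    exact this.le
  filter_upwards [h1, h2] with n h1 h2
  have e1 := Finset.sum_le_sum fun k (_ : k ∈ Finset.univ) => h1 k
  have e2 := Finset.sum_le_sum fun k (_ : k ∈ Finset.univ) => h2 k
  simp only [Finset.sum_const, Finset.card_univ, Fintype.card_fin, nsmul_eq_mul] at e1 e2
  push_cast at e1 e2
  have : ((m : ℝ) + 1) * (δ * √n) = ε / 2 * √n := by rw [hδ]; field_simp
  linarith

end Linearization

/-! ### Asymptotic linearity and normality. -/

section AsymptoticNormality

variable {m : ℕ} {Ψ₀ : Param m}

theorem fisherInfo_symm (Ψ : Param m) (i j : Idx m) : fisherInfo Ψ i j = fisherInfo Ψ j i := by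
  simp only [fisherInfo, Matrix.of_apply, mul_comm]

/-- The influence function of the maximum likelihood estimator. -/
noncomputable def influence (Ψ : Param m) (x : ℝ) : Param m :=
  WithLp.toLp 2 ((fisherInfo Ψ)⁻¹.mulVec (score Ψ x))

theorem influence_apply (Ψ : Param m) (x : ℝ) (i : Idx m) :
    influence Ψ x i = ∑ k, (fisherInfo Ψ)⁻¹ i k * score Ψ x k := rfl

theorem measurable_influence (hΨ₀ : Ψ₀ ∈ paramSpace m) (hw : ∀ k, 0 < weight Ψ₀ k) :
    Measurable (influence Ψ₀) := by
  obtain ⟨C, ρ, hC, hρ, h⟩ := exists_ball_jetBound hΨ₀ hw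
  have hm := (h Ψ₀ (Metric.mem_ball_self hρ)).2.2.1
  refine (MeasurableEquiv.toLp 2 (Idx m → ℝ)).measurable.comp (measurable_pi_iff.2 fun i => ?_)
  simp only [Matrix.mulVec, dotProduct]
  exact Finset.measurable_fun_sum _ fun k _ => (hm k).const_mul _

theorem memLp_influence (hΨ₀ : Ψ₀ ∈ paramSpace m) (hw : ∀ k, 0 < weight Ψ₀ k) (i : Idx m) :
    MemLp (fun x => influence Ψ₀ x i) 2 (mixLaw Ψ₀) := by
  simp_rw [influence_apply]
  exact memLp_finsetSum _ fun k _ => (memLp_score hΨ₀ hw k).const_mul _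

theorem integral_influence (hΨ₀ : Ψ₀ ∈ paramSpace m) (hw : ∀ k, 0 < weight Ψ₀ k) (i : Idx m) :
    ∫ x, influence Ψ₀ x i ∂(mixLaw Ψ₀) = 0 := by
  have := isProbabilityMeasure_mixLaw hΨ₀
  simp_rw [influence_apply]
  rw [integral_finsetSum _ fun k _ =>
    ((memLp_score hΨ₀ hw k).integrable one_le_two).const_mul _]
  simp [integral_const_mul, integral_score hΨ₀ hw]

theorem integral_influence_mul_influence (hΨ₀ : Ψ₀ ∈ paramSpace m) (hw : ∀ k, 0 < weight Ψ₀ k)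
    (hreg : (fisherInfo Ψ₀).PosDef) (i j : Idx m) :
    ∫ x, influence Ψ₀ x i * influence Ψ₀ x j ∂(mixLaw Ψ₀) = (fisherInfo Ψ₀)⁻¹ i j := by
  set J := (fisherInfo Ψ₀)⁻¹ with hJ
  have hint : ∀ k l, Integrable (fun x => score Ψ₀ x k * score Ψ₀ x l) (mixLaw Ψ₀) := fun k l =>
    (memLp_score hΨ₀ hw k).integrable_mul (memLp_score hΨ₀ hw l)
  have h1 : ∀ x, influence Ψ₀ x i * influence Ψ₀ x j =
      ∑ k, ∑ l, J i k * J j l * (score Ψ₀ x k * score Ψ₀ x l) := fun x => by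
    rw [influence_apply, influence_apply, Finset.sum_mul_sum]
    exact Finset.sum_congr rfl fun k _ => Finset.sum_congr rfl fun l _ => by ring
  simp_rw [h1]
  rw [integral_finsetSum _ fun k _ => integrable_finsetSum _ fun l _ => (hint k l).const_mul _]
  have h2 : ∀ k, ∫ x, ∑ l, J i k * J j l * (score Ψ₀ x k * score Ψ₀ x l) ∂(mixLaw Ψ₀) =
      ∑ l, J i k * fisherInfo Ψ₀ k l * J j l := fun k => by
    rw [integral_finsetSum _ fun l _ => (hint k l).const_mul _]
    refine Finset.sum_congr rfl fun l _ => ?_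
    rw [integral_const_mul, fisherInfo, Matrix.of_apply]; ring
  simp_rw [h2]
  have hJsymm : J.transpose = J := by
    have := hreg.inv.isHermitian
    rw [Matrix.IsHermitian, Matrix.conjTranspose_eq_transpose_of_trivial] at this
    exact this
  have h3 : J * fisherInfo Ψ₀ * J.transpose = J := by
    rw [hJ, Matrix.nonsing_inv_mul _ ((Matrix.isUnit_iff_isUnit_det _).1 hreg.isUnit),
      Matrix.one_mul, ← hJ, hJsymm]
  conv_rhs => rw [← h3]
  simp only [Matrix.mul_apply, Matrix.transpose_apply, Finset.sum_mul]
  exact Finset.sum_comm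

variable {Ω : Type*} [MeasurableSpace Ω] {P : Measure Ω}
  {X : ℕ → Ω → ℝ}

/-- A consistent penalized maximum likelihood estimator is asymptotically linear. -/
theorem ae_eventually_sum_abs_sub_le (hΨ₀ : Ψ₀ ∈ paramSpace m) (hw : ∀ k, 0 < weight Ψ₀ k)
    (hreg : (fisherInfo Ψ₀).PosDef)
    (hindep : iIndepFun X P) (hlaw : ∀ i, HasLaw (X i) (mixLaw Ψ₀) P) {q r : ℕ → Ω → ℝ → ℝ}
    (hC4 : ∀ᵐ ω ∂P, C4 (fun n => q n ω) (fun n => r n ω)) {Ψ : ℕ → Ω → Param m}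
    (hPMLE : ∀ᵐ ω ∂P, ∀ᶠ n in atTop, IsPMLE n (fun i => X i ω) (q n ω) (r n ω) (Ψ n ω))
    (hcons : ∀ᵐ ω ∂P, Tendsto (fun n => Ψ n ω) atTop (𝓝 Ψ₀)) {η : ℝ} (hη : 0 < η) :
    ∀ᵐ ω ∂P, ∀ᶠ n : ℕ in atTop,
      ∑ i, |(√(n : ℝ) • (Ψ n ω - Ψ₀)) i -
        ((√(n : ℝ))⁻¹ • ∑ l ∈ Finset.range n, influence Ψ₀ (X l ω)) i| ≤
      η * (1 + ∑ i, |((√(n : ℝ))⁻¹ • ∑ l ∈ Finset.range n, influence Ψ₀ (X l ω)) i|) := by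
  set A := fisherInfo Ψ₀ with hA
  set κ := ∑ i, ∑ j, |A⁻¹ i j| with hκ
  have hκ0 : 0 ≤ κ := by positivity
  -- Chosen so that `κ * ε` is at most `1/2`, for the absorption, and `2 * κ * ε ≤ η`, for the
  -- conclusion.
  set ε := min (1 / 2) (η / 2) / (κ + 1) with hε
  have hmin : 0 < min (1 / 2) (η / 2) := by positivity
  have hεpos : 0 < ε := by positivity
  have hκε : κ * ε ≤ min (1 / 2) (η / 2) := by
    rw [hε, mul_div_assoc', div_le_iff₀ (by positivity)]
    nlinarith
  obtain ⟨U, hU, hae⟩ := exists_nhds_abs_sum_hess_add_le hΨ₀ hw hindep hlaw hεpos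
  obtain ⟨C, ρ, hC, hρ, hball⟩ := exists_ball_jetBound hΨ₀ hw
  obtain ⟨ρ', hρ', hUρ⟩ := Metric.mem_nhds_iff.1 hU
  have hρm : 0 < min ρ ρ' := lt_min hρ hρ'
  filter_upwards [hae, hC4, hPMLE, hcons] with ω hae hC4 hP hcons
  filter_upwards [hae, hP, hcons.eventually (Metric.ball_mem_nhds Ψ₀ hρm),
    eventually_sum_abs_deriv_penalty_le hC4 hΨ₀ hcons hεpos, hC4.1, hC4.2.1,
    eventually_gt_atTop 0] with n hae hP hmem hpen hq hr hn
  have hn' : (0 : ℝ) < n := by exact_mod_cast hn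
  have hs : 0 < √(n : ℝ) := Real.sqrt_pos.2 hn'
  have hss : √(n : ℝ) * √n = n := Real.mul_self_sqrt hn'.le
  have hmem' : Ψ n ω ∈ Metric.ball Ψ₀ ρ := Metric.ball_subset_ball (min_le_left _ _) hmem
  obtain ⟨hpos, hjet, -⟩ := hball _ hmem'
  have hscore : ∀ j, |∑ l ∈ Finset.range n, score (Ψ n ω) (X l ω) j| ≤ ε * √n := fun j =>
    (abs_sum_score_le_of_isPMLE hP hpos (fun y => (hjet y).contDiffAt.differentiableAt (by simp))
      hq hr j).trans hpen
  have hmvt := fun j => abs_sum_score_sub_add_le (n := n) (x := fun l => X l ω) (A := A)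
    (δ := ε * n)
    (fun Ψ' hΨ' y => ((hball Ψ' (Metric.ball_subset_ball (min_le_left _ _) hΨ')).2.1 y).contDiffAt)
    (fun Ψ' hΨ' => hae Ψ' (hUρ (Metric.ball_subset_ball (min_le_right _ _) hΨ'))) hmem j
  set y : Idx m → ℝ := fun a => √n * (Ψ n ω a - Ψ₀ a) with hy
  set s : Idx m → ℝ := fun j => (√(n : ℝ))⁻¹ * ∑ l ∈ Finset.range n, score Ψ₀ (X l ω) j with hsdef
  have hysum : ∑ a, |y a| = √n * ∑ a, |Ψ n ω a - Ψ₀ a| := by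
    rw [Finset.mul_sum]
    exact Finset.sum_congr rfl fun a _ => by rw [hy, abs_mul, abs_of_pos hs]
  have hlin : ∀ j, |A.mulVec y j - s j| ≤ ε * (∑ a, |y a| + 1) := by
    intro j
    have e1 : √n * A.mulVec y j = n * ∑ a, (Ψ n ω a - Ψ₀ a) * A a j := by
      simp only [Matrix.mulVec, dotProduct, hy, Finset.mul_sum]
      refine Finset.sum_congr rfl fun a _ => ?_
      rw [hA, fisherInfo_symm Ψ₀ j a]
      linear_combination (fisherInfo Ψ₀ a j * (Ψ n ω a - Ψ₀ a)) * hss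
    have e2 : √n * s j = ∑ l ∈ Finset.range n, score Ψ₀ (X l ω) j := by
      rw [hsdef, mul_inv_cancel_left₀ hs.ne']
    have h1 := abs_le.1 (hmvt j)
    have h2 := abs_le.1 (hscore j)
    refine le_of_mul_le_mul_left ?_ hs
    rw [← abs_of_pos hs, ← abs_mul, abs_of_pos hs, mul_sub, e1, e2, hysum]
    have e3 : √(n : ℝ) * (ε * (√n * ∑ a, |Ψ n ω a - Ψ₀ a| + 1)) =
        ε * n * ∑ a, |Ψ n ω a - Ψ₀ a| + ε * √n := by
      linear_combination (ε * ∑ a, |Ψ n ω a - Ψ₀ a|) * hss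
    rw [e3, abs_le]
    constructor <;> linarith
  have hinv : A⁻¹ * A = 1 :=
    Matrix.nonsing_inv_mul _ ((Matrix.isUnit_iff_isUnit_det _).1 hreg.isUnit)
  have h := sum_abs_sub_mulVec_le hinv hεpos.le hlin (hκε.trans (min_le_left _ _))
  have hZ : ∀ i, ((√(n : ℝ))⁻¹ • ∑ l ∈ Finset.range n, influence Ψ₀ (X l ω)) i =
      A⁻¹.mulVec s i := by
    intro i
    rw [PiLp.smul_apply, smul_eq_mul]
    simp only [WithLp.ofLp_sum, Finset.sum_apply, influence_apply, Matrix.mulVec, dotProduct, hsdef,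
      Finset.mul_sum]
    rw [Finset.sum_comm]
    exact Finset.sum_congr rfl fun k _ => Finset.sum_congr rfl fun l _ => by ring
  simp only [hZ]
  refine h.trans (mul_le_mul_of_nonneg_right ?_ (by positivity))
  have := hκε.trans (min_le_right _ _)
  linarith

/-- Asymptotic normality of a consistent penalized maximum likelihood estimator. -/
theorem tendstoInDistribution_of_consistent [IsProbabilityMeasure P]
    (hΨ₀ : Ψ₀ ∈ paramSpace m) (hw : ∀ k, 0 < weight Ψ₀ k)
    (hreg : (fisherInfo Ψ₀).PosDef)
    (hindep : iIndepFun X P) (hlaw : ∀ i, HasLaw (X i) (mixLaw Ψ₀) P) {q r : ℕ → Ω → ℝ → ℝ}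
    (hC4 : ∀ᵐ ω ∂P, C4 (fun n => q n ω) (fun n => r n ω)) {Ψ : ℕ → Ω → Param m}
    (hmeas : ∀ n, AEMeasurable (Ψ n) P)
    (hPMLE : ∀ᵐ ω ∂P, ∀ᶠ n in atTop, IsPMLE n (fun i => X i ω) (q n ω) (r n ω) (Ψ n ω))
    (hcons : ∀ᵐ ω ∂P, Tendsto (fun n => Ψ n ω) atTop (𝓝 Ψ₀)) :
    TendstoInDistribution (fun (n : ℕ) ω => √(n : ℝ) • (Ψ n ω - Ψ₀)) atTop id (fun _ => P)
      (multivariateGaussian 0 (fisherInfo Ψ₀)⁻¹) := by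
  have := isProbabilityMeasure_mixLaw hΨ₀
  set Z : ℕ → Ω → Param m := fun n ω =>
    (√(n : ℝ))⁻¹ • ∑ l ∈ Finset.range n, influence Ψ₀ (X l ω) with hZdef
  have hclt : TendstoInDistribution Z atTop id (fun _ => P)
      (multivariateGaussian 0 (fisherInfo Ψ₀)⁻¹) :=
    tendstoInDistribution_multivariateGaussian hindep hlaw (measurable_influence hΨ₀ hw)
      (memLp_influence hΨ₀ hw) (integral_influence hΨ₀ hw)
      (integral_influence_mul_influence hΨ₀ hw hreg) hreg.inv.posSemidef
  have hZm : ∀ n, AEMeasurable (Z n) P := hclt.forall_aemeasurable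
  set N : Param m → ℝ := fun z => 1 + ∑ i, |z i| with hN
  have hNc : Continuous N := by fun_prop
  have hN1 : ∀ z, 0 < N z := fun z => by positivity
  -- The remainder is small only relative to `N (Z n ω)`. Normalized by it, it tends to zero almost
  -- surely, and the estimator is the continuous function `Z + N Z • W` of a convergent pair, to
  -- which Slutsky's lemma applies.
  set W : ℕ → Ω → Param m := fun n ω =>
    (N (Z n ω))⁻¹ • (√(n : ℝ) • (Ψ n ω - Ψ₀) - Z n ω) with hW
  have hYm : ∀ n : ℕ, AEMeasurable (fun ω => √(n : ℝ) • (Ψ n ω - Ψ₀)) P := fun n =>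
    ((hmeas n).sub_const Ψ₀).const_smul (√(n : ℝ))
  have hWm : ∀ n, AEMeasurable (W n) P := fun n =>
    (hNc.measurable.comp_aemeasurable (hZm n)).inv.smul ((hYm n).sub (hZm n))
  have hW0 : ∀ᵐ ω ∂P, Tendsto (fun n => W n ω) atTop (𝓝 0) := by
    filter_upwards [ae_all_iff.2 fun M : ℕ => ae_eventually_sum_abs_sub_le hΨ₀ hw hreg hindep hlaw
      hC4 hPMLE hcons (by positivity : (0 : ℝ) < 1 / (M + 1))] with ω hω
    rw [Metric.tendsto_nhds]
    intro ε hε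
    obtain ⟨M, hM⟩ := exists_nat_one_div_lt hε
    filter_upwards [hω M] with n hn
    rw [dist_zero_right, hW]
    simp only [norm_smul, norm_inv, Real.norm_of_nonneg (hN1 _).le]
    rw [inv_mul_lt_iff₀ (hN1 _)]
    refine (EuclideanSpace.norm_le_sum_abs _).trans_lt ?_
    refine lt_of_le_of_lt hn ?_
    rw [mul_comm]
    exact mul_lt_mul_of_pos_left hM (hN1 (Z n ω))
  have hWmeas : TendstoInMeasure P W atTop fun _ => (0 : Param m) :=
    tendstoInMeasure_of_tendsto_ae (fun n => (hWm n).aestronglyMeasurable) hW0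
  have hg : Continuous fun p : Param m × Param m => p.1 + N p.1 • p.2 := by fun_prop
  have h := hclt.continuous_comp_prodMk_of_tendstoInMeasure_const hg hWmeas hWm
  refine h.congr (fun n => .of_forall fun ω => ?_) (.of_forall fun ω => ?_)
  · simp only [hW]
    rw [smul_inv_smul₀ (hN1 _).ne', add_sub_cancel]
  · simp

end AsymptoticNormality

/-! ### What a nonsingular information matrix excludes. -/

section Regularity

variable {m : ℕ} {Ψ₀ : Param m}

theorem hasDerivAt_snDensity_line {σ : ℝ} (μ lam a b x : ℝ) :
    HasDerivAt (fun t : ℝ => snDensity (μ + t * a) σ (lam + t * b) x)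
      (2 / σ * npdf ((x - μ) / σ) * ((x - μ) / σ * (a / σ) * ncdf (lam * ((x - μ) / σ)) +
        npdf (lam * ((x - μ) / σ)) * (b * ((x - μ) / σ) - lam * (a / σ)))) 0 := by
  have hl : ∀ c d : ℝ, HasDerivAt (fun t : ℝ => c + t * d) d 0 := fun c d => by
    simpa using ((hasDerivAt_id (0 : ℝ)).mul_const d).const_add c
  have hz : HasDerivAt (fun t : ℝ => (x - (μ + t * a)) / σ) (-a / σ) 0 :=
    ((hl μ a).const_sub x).div_const σ
  have hzl := (hl lam b).mul hz
  have h1 : HasDerivAt (fun t : ℝ => npdf ((x - (μ + t * a)) / σ)) _ 0 :=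
    (hasDerivAt_npdf _).comp (0 : ℝ) hz
  have h2 : HasDerivAt (fun t : ℝ => ncdf ((lam + t * b) * ((x - (μ + t * a)) / σ))) _ 0 :=
    (hasDerivAt_ncdf _).comp (0 : ℝ) hzl
  refine ((h1.const_mul (2 / σ)).mul h2).congr_deriv ?_
  simp only [zero_mul, add_zero]
  ring

/-- The parameter vector with the given locations and shapes, all other coordinates being zero. -/
noncomputable def locShape (a b : Fin (m + 1) → ℝ) : Param m :=
  WithLp.toLp 2 (Sum.elim 0 (Sum.elim a (Sum.elim 0 b)))

theorem weight_add_smul_locShape (a b : Fin (m + 1) → ℝ) (t : ℝ) (k : Fin (m + 1)) :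
    weight (Ψ₀ + t • locShape a b) k = weight Ψ₀ k := by
  induction k using Fin.lastCases <;> simp [weight, locShape]

theorem hasDerivAt_mixDensity_locShape (a b : Fin (m + 1) → ℝ) (x : ℝ) :
    HasDerivAt (fun t : ℝ => mixDensity (Ψ₀ + t • locShape a b) x)
      (∑ k, weight Ψ₀ k * (2 / scale Ψ₀ k * npdf ((x - loc Ψ₀ k) / scale Ψ₀ k) *
        ((x - loc Ψ₀ k) / scale Ψ₀ k * (a k / scale Ψ₀ k) *
          ncdf (shape Ψ₀ k * ((x - loc Ψ₀ k) / scale Ψ₀ k)) +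
        npdf (shape Ψ₀ k * ((x - loc Ψ₀ k) / scale Ψ₀ k)) *
          (b k * ((x - loc Ψ₀ k) / scale Ψ₀ k) - shape Ψ₀ k * (a k / scale Ψ₀ k))))) 0 := by
  have h := HasDerivAt.fun_sum fun k (_ : k ∈ Finset.univ) =>
    (hasDerivAt_snDensity_line (σ := scale Ψ₀ k) (loc Ψ₀ k) (shape Ψ₀ k) (a k) (b k) x).const_mul
      (weight Ψ₀ k)
  refine h.congr_of_eventuallyEq (.of_forall fun t => ?_)
  unfold mixDensity
  refine Finset.sum_congr rfl fun k _ => ?_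
  rw [weight_add_smul_locShape]
  congr 2
  simp [scale, locShape]

theorem sum_mul_score (v : Param m) (x : ℝ) : ∑ i, v i * score Ψ₀ x i =
    fderiv ℝ (fun Ψ' : Param m => Real.log (mixDensity Ψ' x)) Ψ₀ v := by
  conv_rhs => rw [← EuclideanSpace.sum_smul_single v]
  simp [score]

/-- At a regular point the mixture density is not stationary in any direction. -/
theorem eq_zero_of_hasDerivAt_mixDensity_zero (hΨ₀ : Ψ₀ ∈ paramSpace m)
    (hw : ∀ k, 0 < weight Ψ₀ k) (hreg : (fisherInfo Ψ₀).PosDef) {v : Param m}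
    (h : ∀ x, HasDerivAt (fun t : ℝ => mixDensity (Ψ₀ + t • v) x) 0 0) : v = 0 := by
  by_contra hv
  obtain ⟨C, ρ, hC, hρ, hball⟩ := exists_ball_jetBound hΨ₀ hw
  have hjet := (hball Ψ₀ (Metric.mem_ball_self hρ)).2.1
  have hzero : ∀ x, ∑ i, v i * score Ψ₀ x i = 0 := by
    intro x
    rw [sum_mul_score]
    have h1 : HasDerivAt (fun t : ℝ => Real.log (mixDensity (Ψ₀ + t • v) x)) 0 0 := by
      have := (h x).log (by simpa using (mixDensity_pos hΨ₀ x).ne')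
      simpa using this
    have h2 : HasDerivAt (fun t : ℝ => Real.log (mixDensity (Ψ₀ + t • v) x))
        (fderiv ℝ (fun Ψ' : Param m => Real.log (mixDensity Ψ' x)) Ψ₀ v) 0 := by
      refine HasFDerivAt.hasDerivAt_line (F := fun Ψ' : Param m => Real.log (mixDensity Ψ' x)) ?_
      simpa using ((hjet x).contDiffAt.differentiableAt (by simp)).hasFDerivAt
    exact h2.unique h1
  have hint : ∀ i j, Integrable (fun x => score Ψ₀ x i * score Ψ₀ x j) (mixLaw Ψ₀) := fun i j =>
    (memLp_score hΨ₀ hw i).integrable_mul (memLp_score hΨ₀ hw j)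
  have hI : (fisherInfo Ψ₀).mulVec v = 0 := by
    ext i
    have e : ∀ j, fisherInfo Ψ₀ i j * v j =
        ∫ x, v j * (score Ψ₀ x i * score Ψ₀ x j) ∂(mixLaw Ψ₀) := fun j => by
      rw [integral_const_mul, fisherInfo, Matrix.of_apply, mul_comm]
    simp only [Matrix.mulVec, dotProduct, e]
    rw [← integral_finsetSum _ fun j _ => (hint i j).const_mul _]
    have : ∀ x, ∑ j, v j * (score Ψ₀ x i * score Ψ₀ x j) = 0 := fun x => by
      rw [← mul_zero (score Ψ₀ x i), ← hzero x, Finset.mul_sum]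
      exact Finset.sum_congr rfl fun j _ => by ring
    simp [this]
  have hv' : (v : Idx m → ℝ) ≠ 0 := fun h0 => hv (by ext i; exact congrFun h0 i)
  have := hreg.dotProduct_mulVec_pos hv'
  rw [hI] at this
  simp at this

theorem locShape_ne_zero {a b : Fin (m + 1) → ℝ} {k : Fin (m + 1)} (h : b k ≠ 0) :
    locShape a b ≠ 0 := fun h0 => h (by
  have := congrArg (fun v : Param m => shape v k) h0
  simpa [shape, locShape] using this)

/-- At shape zero the distribution function is `1/2`, and the derivatives in the location and in the
shape are both multiples of `z * npdf z`, with `z = (x - loc) / scale`; a combination of the two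
directions is therefore stationary. -/
theorem shape_ne_zero_of_posDef (hΨ₀ : Ψ₀ ∈ paramSpace m) (hw : ∀ k, 0 < weight Ψ₀ k)
    (hreg : (fisherInfo Ψ₀).PosDef) (k : Fin (m + 1)) : shape Ψ₀ k ≠ 0 := by
  intro hk
  refine locShape_ne_zero (a := Pi.single k (-2 * scale Ψ₀ k * npdf 0)) (b := Pi.single k 1)
    (k := k) (by simp) (eq_zero_of_hasDerivAt_mixDensity_zero hΨ₀ hw hreg fun x => ?_)
  refine (hasDerivAt_mixDensity_locShape _ _ x).congr_deriv (Finset.sum_eq_zero fun l _ => ?_)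
  by_cases hl : l = k
  · subst hl
    have := (hΨ₀ l).2.ne'
    rw [hk, zero_mul, ncdf_zero, Pi.single_eq_same, Pi.single_eq_same]
    field_simp
    ring
  · simp [hl]

/-- The derivative of the density in the shape is even in the shape. For two components with the
same location and scale and opposite shapes these derivatives coincide, so moving the shapes in
opposite directions, in the ratio of the swapped weights, keeps the mixture stationary. -/
theorem abs_shape_ne_of_posDef (hΨ₀ : Ψ₀ ∈ paramSpace m) (hw : ∀ k, 0 < weight Ψ₀ k)
    (hreg : (fisherInfo Ψ₀).PosDef)
    (hdistinct : ∀ k l, k ≠ l →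
      (loc Ψ₀ k, scale Ψ₀ k, shape Ψ₀ k) ≠ (loc Ψ₀ l, scale Ψ₀ l, shape Ψ₀ l))
    (k l : Fin (m + 1)) (hkl : k ≠ l) :
    (loc Ψ₀ k, scale Ψ₀ k, |shape Ψ₀ k|) ≠ (loc Ψ₀ l, scale Ψ₀ l, |shape Ψ₀ l|) := by
  intro heq
  simp only [Prod.mk.injEq] at heq
  obtain ⟨h1, h2, h3⟩ := heq
  rcases abs_eq_abs.1 h3 with h3 | h3
  · exact hdistinct k l hkl (by rw [h1, h2, h3])
  refine locShape_ne_zero (a := 0)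
    (b := Pi.single k (weight Ψ₀ l) - Pi.single l (weight Ψ₀ k)) (k := k)
    (by simp [hkl, (hw l).ne']) (eq_zero_of_hasDerivAt_mixDensity_zero hΨ₀ hw hreg fun x => ?_)
  refine (hasDerivAt_mixDensity_locShape _ _ x).congr_deriv ?_
  rw [Fintype.sum_eq_add k l hkl fun j hj => by simp [hj.1, hj.2]]
  simp only [Pi.sub_apply, Pi.single_eq_same, Pi.single_eq_of_ne hkl, Pi.single_eq_of_ne hkl.symm,
    Pi.zero_apply, h1, h2, h3, neg_mul, npdf_neg]
  ring

end Regularity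

/-! ### Conclusion: regularity gives identifiability, hence consistency, hence normality. -/

theorem theorem5 {m : ℕ} {Ω : Type*} [MeasurableSpace Ω] (P : Measure Ω) [IsProbabilityMeasure P]
    -- the true parameter: a mixture with exactly `m + 1` components, regular at `Ψ₀`
    (Ψ₀ : Param m) (hΨ₀ : Ψ₀ ∈ paramSpace m)
    (hweight : ∀ k, 0 < weight Ψ₀ k)
    (hdistinct : ∀ k l, k ≠ l →
      (loc Ψ₀ k, scale Ψ₀ k, shape Ψ₀ k) ≠ (loc Ψ₀ l, scale Ψ₀ l, shape Ψ₀ l))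
    (hregular : (fisherInfo Ψ₀).PosDef)
    -- the sample
    (X : ℕ → Ω → ℝ) (hindep : iIndepFun X P) (hlaw : ∀ i, HasLaw (X i) (mixLaw Ψ₀) P)
    -- the penalties for sample size `n`, which may depend on the data
    (q r : ℕ → Ω → ℝ → ℝ)
    (hC1 : ∀ᵐ ω ∂P, C1 (fun n => q n ω))
    (hC2 : ∀ᵐ ω ∂P, C2 (fun n => q n ω))
    (hC3 : ∀ᵐ ω ∂P, C3 (fun n => r n ω))
    (hC4 : ∀ᵐ ω ∂P, C4 (fun n => q n ω) (fun n => r n ω))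
    -- the penalized maximum likelihood estimators
    (Ψ : ℕ → Ω → Param m) (hmeas : ∀ n, AEMeasurable (Ψ n) P)
    (hPMLE : ∀ᵐ ω ∂P, ∀ᶠ n in atTop, IsPMLE n (fun i => X i ω) (q n ω) (r n ω) (Ψ n ω))
    -- their components are numbered so as to match those of `Ψ₀` as closely as possible
    (hlabel : ∀ᵐ ω ∂P, ∀ᶠ n in atTop, ∀ τ : Equiv.Perm (Fin (m + 1)),
      dist (Ψ n ω) Ψ₀ ≤ dist (relabel τ (Ψ n ω)) Ψ₀) :
    TendstoInDistribution (fun (n : ℕ) ω => √(n : ℝ) • (Ψ n ω - Ψ₀)) atTop id (fun _ => P)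
      (multivariateGaussian 0 (fisherInfo Ψ₀)⁻¹) := by
  have hdist := abs_shape_ne_of_posDef hΨ₀ hweight hregular hdistinct
  exact tendstoInDistribution_of_consistent hΨ₀ hweight hregular hindep hlaw hC4 hmeas hPMLE
    (ae_tendsto_of_isPMLE hΨ₀ hweight (shape_ne_zero_of_posDef hΨ₀ hweight hregular) hdist hindep
      hlaw hC1 hC2 hC3 hC4 hPMLE hlabel)
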